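/- Let $n\ge 1$ and let $\mathfrak L_j=\{|\zeta-\zeta_j|=r_j\}$, $j=0,\dots,n-1$, be circles, oriented counterclockwise, bounding pairwise disjoint closed discs; $\mathfrak L=\bigcup_j\mathfrak L_j$, and $\mathfrak D^e\ni\infty$ is the exterior of these discs on the Riemann sphere. Let $T_j(\zeta)=\zeta_j+r_j^2/(\bar\zeta-\bar\zeta_j)$, $\sigma_j=T_jT_0$, and let $\mathfrak G$ be the group generated by $\sigma_0,\dots,\sigma_{n-1}$. Assume that $\sum_{\sigma\in\mathfrak G\setminus\{\mathrm{id}\}}|\alpha_\sigma\delta_\sigma-\beta_\sigma\gamma_\sigma|/|\gamma_\sigma|^2<\infty$, where $\sigma(\zeta)=(\alpha_\sigma\zeta+\beta_\sigma)/(\gamma_\sigma\zeta+\delta_\sigma)$. Put $\Omega'=\bigcup_{\sigma\in\mathfrak G}\sigma(\mathfrak D^e\cup T_0(\mathfrak D^e))$ and $\Omega=\Omega'\cup\bigcup_{\sigma\in\mathfrak G}\sigma(\mathfrak L)$. Fix $\zeta_*\in\mathfrak D^e$ and let $$\mathcal K(\zeta,\eta)=\sum_{\sigma\in\mathfrak G}\Big(\frac1{\eta-\sigma(\zeta)}-\frac1{\eta-\sigma(\zeta_*)}\Big),\qquad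 \chi_{\sigma_j}(\eta)=\mathcal K(\sigma_j(\zeta_*),\eta),$$ with $1/(\eta-\infty)=0$. Let $\mu>0$, $\mu_j>0$, $\mu_j\ne\mu$, $\kappa_j=\mu_j/\mu$, $\lambda_j=\kappa_j/(1-\kappa_j)$; let $\tau,\tau^\infty,c_{-1}\in\mathbb C$ with $\tau\neq0$, and $c=\frac{\bar\tau^\infty-\bar\tau}{\mu}c_{-1}$. Let $a_0,\dots,a_{n-1}$ be real with $$a_j=a_0+\frac1{2\pi}\operatorname{Im}\sum_{l}\int_{\mathfrak L_l}\operatorname{Im}(c\eta)\chi_{\sigma_j}(\eta)\,d\eta\quad(j\ge1),$$ let $C_1\in\mathbb R$, $\Psi_1(\zeta)=\frac1{2\pi}\sum_l\int_{\mathfrak L_l}[\operatorname{Im}(c\eta)-a_l]\mathcal K(\zeta,\eta)\,d\eta$ and, for $\xi\in\mathfrak L_j$ (with principal values, obtained by deleting from $\mathfrak L$ the part $|\eta-\xi|\le\varepsilon$ and letting $\varepsilon\to0^+$), $$F(\xi)=c\xi-i[\operatorname{Im}(c\xi)-a_j]+\Psi_1(\xi)+\overline{\Psi_1(T_0(\xi))}+C_1,\qquad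 g^\circ_{2j}(\xi)=\operatorname{Re}\Big(\frac{\kappa_j}{\kappa_j-1}F(\xi)+\frac{\bar\tau}{\mu}c_{-1}\xi\Big).$$ For real $\tilde d=(\tilde d_0,\dots,\tilde d_{n-1})$ and $C_2$ put $$\Psi_2(\zeta)=\frac1{2\pi}\sum_{l}\int_{\mathfrak L_l}[g^\circ_{2l}(\eta)-\tilde d_l]\,\mathcal K(\zeta,\eta)\,d\eta,\qquad \Phi_2(\zeta)=\Psi_2(\zeta)+\overline{\Psi_2(T_0(\zeta))}+C_2 .$$ Then the kernel series converges absolutely for $\zeta\in\Omega$, $\eta\in\mathfrak L$; for each $\zeta\in\Omega$ its sum is continuous in $\eta\in\mathfrak L\setminus\mathfrak G\zeta$; the principal values in $F$ exist, and $g^\circ_{2j}$ is continuous on $\mathfrak L_j$. Moreover: 1. For all real $\tilde d$, $C_2$ and $\xi\in\mathfrak L_j$, the principal values $\Psi_2(\xi)$, $\Psi_2(T_0(\xi))$ exist, and the limits of $\Phi_2$ at $\xi$ from the interior ($+$) of $\mathfrak L_j$ and from $\mathfrak D^e$ ($-$) are $$\Phi_2^\pm(\xi)=\pm i[g^\circ_{2j}(\xi)-\tilde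 d_j]+\Psi_2(\xi)+\overline{\Psi_2(T_0(\xi))}+C_2 .$$ 2. $\Phi_2$ is $\mathfrak G$-automorphic on $\Omega'$ if and only if $$\tilde d_j=\tilde d_0+\frac1{2\pi}\operatorname{Im}\sum_{l}\int_{\mathfrak L_l}g^\circ_{2l}(\eta)\chi_{\sigma_j}(\eta)\,d\eta,\quad j=1,\dots,n-1.\tag{$*$}$$ In particular $\tilde d_0$ is free: for every real $\tilde d_0$ and $C_2$ there is exactly one $\tilde d$ with this zeroth entry for which $\Phi_2$ is automorphic. 3. Let $\tilde d$ be real. A function $\Phi$ is analytic on $\Omega'$ (including at $\infty$), $\mathfrak G$-automorphic, satisfies $\overline{\Phi(T_j(\zeta))}=\Phi(\zeta)$ on $\Omega'$ for all $j$, and has boundary values on the circles with $\Phi^+(\xi)-\Phi^-(\xi)=-2i\tilde d_j+2ig^\circ_{2j}(\xi)$, $\xi\in\mathfrak L_j$, if and only if $(*)$ holds and $\Phi=\Phi_2$ on $\Omega'$ for some real $C_2$. 4. Let $d'_j$ be real and $\tilde d_j=\frac{\kappa_j}{\kappa_j-1}d_j'$. A function $\omega$ is analytic in $\mathfrak D^e\setminus\{\infty\}$,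 with $\omega(\zeta)-c_{-1}\zeta$ bounded at infinity, extends continuously to $\mathfrak L$, and satisfies $\operatorname{Re}[\frac{\bar\tau}{\mu}\omega(\xi)]=\lambda_j[\operatorname{Re}F(\xi)-d'_j]$ for $\xi\in\mathfrak L_j$, all $j$, if and only if $(*)$ holds and $\frac{i\bar\tau}{\mu}[\omega(\zeta)-c_{-1}\zeta]=\Phi_2(\zeta)$ on $\mathfrak D^e\setminus\{\infty\}$ for some real $C_2$. -/

import Mathlib

open Filter Topology OnePoint
open scoped ComplexConjugate

noncomputable section

namespace CircularRH

/-- Inversion (symmetry) of the Riemann sphere in the circle with centre `a` and radius `r`: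
`z ↦ a + r² / conj (z - a)`, which exchanges `a` and `∞`. -/
def reflect (a : ℂ) (r : ℝ) (p : OnePoint ℂ) : OnePoint ℂ :=
  p.elim ((a : ℂ) : OnePoint ℂ) (fun z =>
    if z = a then ∞ else ((a + (r : ℂ) ^ 2 / conj (z - a) : ℂ) : OnePoint ℂ))

theorem reflect_involutive (a : ℂ) (r : ℝ) (hr : 0 < r) :
    Function.Involutive (reflect a r) := by
  intro p
  have hr' : (r : ℂ) ≠ 0 := by exact_mod_cast hr.ne'
  induction p using OnePoint.rec with
  | infty => simp [reflect]
  | coe z =>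
    by_cases hz : z = a
    · simp [reflect, hz]
    · have h3 : z - a ≠ 0 := sub_ne_zero.mpr hz
      have h1 : conj (z - a) ≠ 0 := (map_ne_zero _).mpr h3
      have h2 : a + (r : ℂ) ^ 2 / conj (z - a) ≠ a := by
        intro h
        have h4 : (r : ℂ) ^ 2 / conj (z - a) = 0 := by simpa using h
        exact (div_ne_zero (pow_ne_zero 2 hr') h1) h4
      simp only [reflect, OnePoint.elim_some, if_neg hz, if_neg h2]
      congr 1
      rw [add_sub_cancel_left, map_div₀, map_pow, Complex.conj_ofReal, Complex.conj_conj]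
      field_simp
      ring

/-- A system of `n` circles in the plane which bound pairwise disjoint closed discs. -/
structure CircleSystem (n : ℕ) where
  center : Fin n → ℂ
  radius : Fin n → ℝ
  radius_pos : ∀ j, 0 < radius j
  disjoint : ∀ i j, i ≠ j → radius i + radius j < dist (center i) (center j)

namespace CircleSystem

variable {n : ℕ} (S : CircleSystem n)

/-- The `j`-th circle `𝔏_j`. -/
def circle (j : Fin n) : Set ℂ := Metric.sphere (S.center j) (S.radius j)

/-- The union `𝔏` of all circles. -/
def contour : Set ℂ := ⋃ j, S.circle j

/-- The finite part of the domain exterior to all the circles. -/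
def exteriorPlane : Set ℂ := {z | ∀ j, S.radius j < dist z (S.center j)}

/-- The `n`-connected circular domain `𝔇ᵉ` on the sphere; it contains `∞`. -/
def exterior : Set (OnePoint ℂ) := insert ∞ ((fun z : ℂ => (z : OnePoint ℂ)) '' S.exteriorPlane)

/-- The symmetry map `T_j` of the sphere in the `j`-th circle. -/
def T (j : Fin n) : Equiv.Perm (OnePoint ℂ) :=
  (reflect_involutive (S.center j) (S.radius j) (S.radius_pos j)).toPerm _

variable [NeZero n]

/-- The generators `σ_j = T_j T_0`. -/
def gen (j : Fin n) : Equiv.Perm (OnePoint ℂ) := S.T j * S.T 0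

/-- The symmetry Schottky group `𝔊` generated by `σ_0, …, σ_{n-1}`. -/
def group : Subgroup (Equiv.Perm (OnePoint ℂ)) := Subgroup.closure (Set.range S.gen)

/-- Convergence of `∑ |αδ - βγ| / |γ|²` over the non-identical elements
`ζ ↦ (αζ + β) / (γζ + δ)` of the group. (The terms do not depend on the choice of the matrices.) -/
def FirstClass : Prop :=
  ∃ M : S.group → GL (Fin 2) ℂ,
    (∀ (σ : S.group) (p : OnePoint ℂ), (σ : Equiv.Perm (OnePoint ℂ)) p = M σ • p) ∧
    Summable (fun σ : {σ : S.group // σ ≠ 1} =>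
      ‖(M σ.1).val.det‖ / ‖(M σ.1) 1 0‖ ^ 2)

/-- `⋃_σ σ(𝔇ᵉ ∪ T_0(𝔇ᵉ))`: the region of discontinuity of the group without the circles `σ(𝔏)`.
This is where piecewise analytic functions live. -/
def offCircles : Set (OnePoint ℂ) :=
  {p | ∃ σ ∈ S.group, ∃ q, (q ∈ S.exterior ∨ S.T 0 q ∈ S.exterior) ∧ p = σ q}

/-- `Ω = ⋃_σ σ(𝔇ᵉ ∪ T_0(𝔇ᵉ) ∪ 𝔏)`, the region of discontinuity of the group. -/
def Omega : Set (OnePoint ℂ) :=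
  S.offCircles ∪ {p | ∃ σ ∈ S.group, ∃ z ∈ S.contour, p = σ (z : OnePoint ℂ)}

/-- `1 / (η - p)` for a point `p` of the sphere; it is `0` for `p = ∞`. -/
def cauchyTerm (η : ℂ) (p : OnePoint ℂ) : ℂ := p.elim 0 (fun z => (η - z)⁻¹)

/-- The summands `1 / (η - σ(ζ)) - 1 / (η - σ(ζ_*))` of the kernel. -/
def kernelTerm (zs ζ : OnePoint ℂ) (η : ℂ) (σ : S.group) : ℂ :=
  cauchyTerm η ((σ : Equiv.Perm (OnePoint ℂ)) ζ) - cauchyTerm η ((σ : Equiv.Perm (OnePoint ℂ)) zs)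

/-- The quasiautomorphic analogue `𝒦(ζ, η)` of the Cauchy kernel, with base point `ζ_*`. -/
def kernel (zs ζ : OnePoint ℂ) (η : ℂ) : ℂ := ∑' σ : S.group, S.kernelTerm zs ζ η σ

/-- `χ_{σ_j}(η) = 𝒦(σ_j(ζ_*), η)`. -/
def chi (zs : OnePoint ℂ) (j : Fin n) (η : ℂ) : ℂ := S.kernel zs (S.gen j zs) η

/-- `Ψ(ζ) = (1/2π) ∑_l ∫_{𝔏_l} h_l(η) 𝒦(ζ, η) dη`, all circles being oriented counterclockwise. -/
def potential (zs : OnePoint ℂ) (h : Fin n → ℂ → ℝ) (ζ : OnePoint ℂ) : ℂ :=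
  1 / (2 * Real.pi) *
    ∑ l, ∮ η in C(S.center l, S.radius l), (h l η : ℂ) * S.kernel zs ζ η

/-- The same integral over the part `|η - ξ| > ε` of the circles. -/
def truncPotential (zs : OnePoint ℂ) (h : Fin n → ℂ → ℝ) (ζ : OnePoint ℂ) (ξ : ℂ) (ε : ℝ) : ℂ :=
  1 / (2 * Real.pi) *
    ∑ l, ∮ η in C(S.center l, S.radius l),
      (if ε < dist η ξ then (h l η : ℂ) * S.kernel zs ζ η else 0)

/-- `v` is the Cauchy principal value of `Ψ(ζ)`, where `ξ ∈ 𝔏` is the singular point of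
`𝒦(ζ, ·)` on the circles (so `ζ = ξ`, or `ζ = T_0(ξ)`). -/
def HasPV (zs : OnePoint ℂ) (h : Fin n → ℂ → ℝ) (ζ : OnePoint ℂ) (ξ : ℂ) (v : ℂ) : Prop :=
  Tendsto (S.truncPotential zs h ζ ξ) (𝓝[>] 0) (𝓝 v)

/-- The Cauchy principal value of `Ψ(ζ)`. -/
def pv (zs : OnePoint ℂ) (h : Fin n → ℂ → ℝ) (ζ : OnePoint ℂ) (ξ : ℂ) : ℂ :=
  limUnder (𝓝[>] 0) (S.truncPotential zs h ζ ξ)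

/-- `(1/2π) Im ∑_l ∫_{𝔏_l} h_l(η) χ_{σ_j}(η) dη`. -/
def period (zs : OnePoint ℂ) (h : Fin n → ℂ → ℝ) (j : Fin n) : ℝ :=
  1 / (2 * Real.pi) *
    (∑ l, ∮ η in C(S.center l, S.radius l), (h l η : ℂ) * S.chi zs j η).im

/-- Analyticity of a function on the sphere at a point; at `∞` in the coordinate `1/ζ`
(in particular the function is then bounded near `∞`). -/
def AnalyticAtSphere (Φ : OnePoint ℂ → ℂ) (p : OnePoint ℂ) : Prop :=
  p.elim
    (AnalyticAt ℂ (fun w : ℂ => Φ (if w = 0 then ∞ else ((w⁻¹ : ℂ) : OnePoint ℂ))) 0)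
    (fun z => AnalyticAt ℂ (fun w : ℂ => Φ (w : OnePoint ℂ)) z)

/-- `Φ(σ(ζ)) = Φ(ζ)` for all `σ ∈ 𝔊`. -/
def Automorphic (Φ : OnePoint ℂ → ℂ) : Prop :=
  ∀ σ ∈ S.group, ∀ p ∈ S.offCircles, Φ (σ p) = Φ p

/-- `conj Φ(T_j(ζ)) = Φ(ζ)` for all `j`. -/
def Symmetric (Φ : OnePoint ℂ → ℂ) : Prop :=
  ∀ j, ∀ p ∈ S.offCircles, conj (Φ (S.T j p)) = Φ p

/-- `v = Φ⁺(ξ)`, the limit from the interior of the `j`-th circle. -/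
def HasInnerValue (Φ : OnePoint ℂ → ℂ) (j : Fin n) (ξ v : ℂ) : Prop :=
  Tendsto (fun z : ℂ => Φ (z : OnePoint ℂ))
    (𝓝[Metric.ball (S.center j) (S.radius j)] ξ) (𝓝 v)

/-- `v = Φ⁻(ξ)`, the limit from the exterior of the circles. -/
def HasOuterValue (Φ : OnePoint ℂ → ℂ) (ξ v : ℂ) : Prop :=
  Tendsto (fun z : ℂ => Φ (z : OnePoint ℂ)) (𝓝[S.exteriorPlane] ξ) (𝓝 v)

/-- The Riemann–Hilbert problem for symmetric automorphic functions, with the jump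
`Φ⁺ - Φ⁻ = -2i d_j + 2i g_j` on the `j`-th circle. -/
structure SolvesRH (g : Fin n → ℂ → ℝ) (d : Fin n → ℝ) (Φ : OnePoint ℂ → ℂ) : Prop where
  analytic : ∀ p ∈ S.offCircles, AnalyticAtSphere Φ p
  automorphic : S.Automorphic Φ
  symmetric : S.Symmetric Φ
  jump : ∀ j, ∀ ξ ∈ S.circle j, ∃ vp vm : ℂ,
    S.HasInnerValue Φ j ξ vp ∧ S.HasOuterValue Φ ξ vm ∧
      vp - vm = -2 * Complex.I * d j + 2 * Complex.I * g j ξ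

end CircleSystem

/-- The physical data: shear moduli `μ` of the matrix and `μ_j ≠ μ` of the inclusions, the stresses
`τ = τ_1 + iτ_2 ≠ 0` in the inclusions and `τ^∞` at infinity, and the leading coefficient `c_{-1}`
of the conformal map. -/
structure ElasticData (n : ℕ) where
  mu : ℝ
  mu_pos : 0 < mu
  muIncl : Fin n → ℝ
  muIncl_pos : ∀ j, 0 < muIncl j
  muIncl_ne : ∀ j, muIncl j ≠ mu
  tau : ℂ
  tau_ne : tau ≠ 0
  tauInf : ℂ
  cm1 : ℂ

namespace ElasticData

variable {n : ℕ} (E : ElasticData n)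

/-- `κ_j = μ_j / μ`. -/
def kappa (j : Fin n) : ℝ := E.muIncl j / E.mu

/-- `λ_j = κ_j / (1 - κ_j)`. -/
def lam (j : Fin n) : ℝ := E.kappa j / (1 - E.kappa j)

/-- `c = ((conj τ^∞ - conj τ) / μ) c_{-1}`. -/
def c : ℂ := (conj E.tauInf - conj E.tau) / E.mu * E.cm1

/-- The density `Im(cη) - a_j` of the first problem. -/
def density₁ (a : Fin n → ℝ) (j : Fin n) (η : ℂ) : ℝ := (E.c * η).im - a j

variable [NeZero n] (S : CircleSystem n)

/-- The boundary values on the `j`-th circle of the solution of the first problem,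
`F(ξ) = cξ - i[Im(cξ) - a_j] + Ψ₁(ξ) + conj Ψ₁(T_0(ξ)) + C₁`. -/
def F (zs : OnePoint ℂ) (a : Fin n → ℝ) (C₁ : ℝ) (j : Fin n) (ξ : ℂ) : ℂ :=
  E.c * ξ - Complex.I * ((E.c * ξ).im - a j : ℝ)
    + S.pv zs (E.density₁ a) (ξ : OnePoint ℂ) ξ
    + conj (S.pv zs (E.density₁ a) (S.T 0 (ξ : OnePoint ℂ)) ξ) + C₁

/-- `g°_{2j}(ξ) = Re(κ_j/(κ_j - 1) F(ξ) + (conj τ / μ) c_{-1} ξ)`. -/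
def g₂ (zs : OnePoint ℂ) (a : Fin n → ℝ) (C₁ : ℝ) (j : Fin n) (ξ : ℂ) : ℝ :=
  ((E.kappa j / (E.kappa j - 1) : ℝ) * E.F S zs a C₁ j ξ
    + conj E.tau / E.mu * E.cm1 * ξ).re

/-- The density `g°_{2j} - d̃_j` of the second problem. -/
def density₂ (zs : OnePoint ℂ) (a : Fin n → ℝ) (C₁ : ℝ) (d : Fin n → ℝ) (j : Fin n) (η : ℂ) : ℝ :=
  E.g₂ S zs a C₁ j η - d j

/-- `Ψ₂`, the kernel integral of `g°_{2j} - d̃_j`. -/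
def Psi₂ (zs : OnePoint ℂ) (a : Fin n → ℝ) (C₁ : ℝ) (d : Fin n → ℝ) : OnePoint ℂ → ℂ :=
  S.potential zs (E.density₂ S zs a C₁ d)

/-- `Φ₂(ζ) = Ψ₂(ζ) + conj Ψ₂(T_0(ζ)) + C₂`. -/
def Phi₂ (zs : OnePoint ℂ) (a : Fin n → ℝ) (C₁ : ℝ) (d : Fin n → ℝ) (C₂ : ℝ) (ζ : OnePoint ℂ) : ℂ :=
  E.Psi₂ S zs a C₁ d ζ + conj (E.Psi₂ S zs a C₁ d (S.T 0 ζ)) + C₂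

/-- The condition `a_j = a_0 + (1/2π) Im ∑_l ∫_{𝔏_l} Im(cη) χ_{σ_j}(η) dη`, `j ≠ 0`, under which the
first problem is solvable. -/
def FirstConstants (zs : OnePoint ℂ) (a : Fin n → ℝ) : Prop :=
  ∀ j, j ≠ 0 → a j = a 0 + S.period zs (fun _ η => (E.c * η).im) j

/-- The condition `d̃_j = d̃_0 + (1/2π) Im ∑_l ∫_{𝔏_l} g°_{2l}(η) χ_{σ_j}(η) dη`, `j ≠ 0`. -/
def SecondConstants (zs : OnePoint ℂ) (a : Fin n → ℝ) (C₁ : ℝ) (d : Fin n → ℝ) : Prop :=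
  ∀ j, j ≠ 0 → d j = d 0 + S.period zs (E.g₂ S zs a C₁) j

/-- The second Schwarz problem for `ω`: analytic in the exterior domain, with the principal part
`c_{-1}ζ` at infinity, continuous up to the circles, and
`Re[(conj τ / μ) ω] = λ_j [Re F - d'_j]` on the `j`-th circle. -/
structure SolvesSchwarz (zs : OnePoint ℂ) (a : Fin n → ℝ) (C₁ : ℝ) (d' : Fin n → ℝ) (ω : ℂ → ℂ) :
    Prop where
  analytic : AnalyticOnNhd ℂ ω S.exteriorPlane
  at_infty : (fun ζ : ℂ => ω ζ - E.cm1 * ζ) =O[cocompact ℂ] (fun _ => (1 : ℝ))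
  boundary : ∀ j, ∀ ξ ∈ S.circle j, ∃ w : ℂ, Tendsto ω (𝓝[S.exteriorPlane] ξ) (𝓝 w) ∧
    (conj E.tau / E.mu * w).re = E.lam j * ((E.F S zs a C₁ j ξ).re - d' j)

end ElasticData

end CircularRH

end

noncomputable section

namespace CircularRH

namespace CircleSystem

/-! ### The symmetries and the group -/

section Geometry

variable {n : ℕ} (S : CircleSystem n)

/-! The kernel is a Cauchy kernel summed over the group. Near the closed exterior domain only the
identity term is singular on the circles. Every other element sends a collar of the exterior into a
slightly smaller disc (`exists_isMargin`), so it has the form `A + B/(z - P)` with `P` well inside a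
disc. The hypothesis `FirstClass` says exactly that the `|B|` are summable. Hence the kernel is
`1/(η - ζ) - 1/(η - ζ_*)` plus a part that is analytic in `ζ` across the circles
(`exists_kernelBound`, `kernel_eq`). Beyond the collar, convergence and continuity are propagated by
the group and by `T_0` (`related_T`, `related_apply`).

Let `Ψ` be the potential of a real density `h`. Sokhotski's formulas give its boundary values as
principal value `± (i/2) h`. The kernel changes by an additive term independent of `ζ` under the
group, and by conjugation plus such a term under `T_0`. So `Ψ(σζ) = Ψ(ζ) + Ψ(σζ_*)`
(`potential_apply`), and `conj Ψ(T_0 ζ)` is `Ψ(ζ)` plus a constant (`potential_T`). The symmetrized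
potential is therefore `2Ψ` plus a constant, and it is automorphic exactly when the multipliers
`Ψ(σ_j ζ_*)` vanish. Comparing the two sides of a circle shows that these multipliers are purely
imaginary (`pvValue_sub_conj`, `conj_potential_gen`), so only their imaginary parts, the periods,
matter. A locally constant density `d` has multipliers `i(d_j - d_0)` (`potential_const`). This
turns vanishing of the periods of `g - d` into the condition on the constants and leaves `d_0` free.

Uniqueness rests on `eq_of_im_const`: a function analytic in the exterior, with a limit at infinity
and constant imaginary part on each circle, is constant. For a symmetric function the jump
prescribes the imaginary part of the outer boundary value, so the jump problem and the Schwarz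
problem both reduce to `eq_symPotential`. Analyticity on the other components is carried there by
reflections.

All this needs Lipschitz densities. For the second problem the density contains principal values of
the first potential. These are Lipschitz because the singular integral of `Im(cη)` over a circle can
be computed in closed form (`circleIntegral_density₁`). -/

theorem T_infty (j : Fin n) : S.T j ∞ = (S.center j : OnePoint ℂ) := rfl

theorem T_center (j : Fin n) : S.T j (S.center j : OnePoint ℂ) = ∞ := by
  simp [T, reflect]

theorem T_coe_of_ne (j : Fin n) {z : ℂ} (hz : z ≠ S.center j) :
    S.T j (z : OnePoint ℂ) =
      ((S.center j + (S.radius j : ℂ) ^ 2 / conj (z - S.center j) : ℂ) : OnePoint ℂ) := by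
  simp [T, reflect, hz]

@[simp] theorem T_T (j : Fin n) (p : OnePoint ℂ) : S.T j (S.T j p) = p :=
  reflect_involutive _ _ (S.radius_pos j) p

@[simp] theorem T_mul_T_self (j : Fin n) : S.T j * S.T j = 1 :=
  Equiv.ext fun p => S.T_T j p

@[simp] theorem T_inv (j : Fin n) : (S.T j)⁻¹ = S.T j :=
  inv_eq_of_mul_eq_one_left (S.T_mul_T_self j)

theorem ne_center_of_mem_circle {j : Fin n} {z : ℂ} (hz : z ∈ S.circle j) : z ≠ S.center j := by
  rintro rfl
  have : dist (S.center j) (S.center j) = S.radius j := hz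
  rw [dist_self] at this
  exact (S.radius_pos j).ne this

theorem conj_sub_of_mem_circle {j : Fin n} {z : ℂ} (hz : z ∈ S.circle j) :
    (z - S.center j) * conj (z - S.center j) = (S.radius j : ℂ) ^ 2 := by
  have h : ‖z - S.center j‖ = S.radius j := by rw [← dist_eq_norm]; exact hz
  rw [Complex.mul_conj, Complex.normSq_eq_norm_sq, h]; push_cast; rfl

theorem T_of_mem_circle {j : Fin n} {z : ℂ} (hz : z ∈ S.circle j) :
    S.T j (z : OnePoint ℂ) = (z : OnePoint ℂ) := by
  have h0 := S.ne_center_of_mem_circle hz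
  rw [S.T_coe_of_ne j h0, ← S.conj_sub_of_mem_circle hz,
    mul_div_cancel_right₀ _ ((map_ne_zero _).mpr (sub_ne_zero.mpr h0)), add_sub_cancel]

/-- A point outside the ball of radius `s` about the centre is reflected into the ball of radius
`t` as soon as `r² ≤ s t`. -/
theorem exists_T_eq_of_le_dist (j : Fin n) {s t : ℝ} (hs : 0 < s)
    (hst : S.radius j ^ 2 ≤ s * t) {p : OnePoint ℂ}
    (hp : ∀ z : ℂ, p = z → s ≤ dist z (S.center j)) :
    ∃ w ∈ Metric.closedBall (S.center j) t, S.T j p = (w : OnePoint ℂ) := by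
  have ht : 0 ≤ t := by
    by_contra h
    nlinarith [sq_nonneg (S.radius j), mul_neg_of_pos_of_neg hs (not_le.mp h)]
  induction p using OnePoint.rec with
  | infty => exact ⟨S.center j, Metric.mem_closedBall_self ht, rfl⟩
  | coe z =>
    have h1 := hp z rfl
    have h2 : 0 < ‖z - S.center j‖ := by rw [← dist_eq_norm]; linarith
    refine ⟨_, ?_, S.T_coe_of_ne j (sub_ne_zero.mp (norm_pos_iff.mp h2))⟩
    rw [Metric.mem_closedBall, dist_eq_norm, add_sub_cancel_left, norm_div, norm_pow,
      Complex.norm_conj, Complex.norm_real, Real.norm_of_nonneg (S.radius_pos j).le,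
      div_le_iff₀ h2]
    rw [dist_eq_norm] at h1
    nlinarith

/-- Points of the sphere at distance at least `r_j - δ` from all centres. -/
def collar (δ : ℝ) : Set (OnePoint ℂ) :=
  {p | ∀ z : ℂ, p = z → ∀ j, S.radius j - δ ≤ dist z (S.center j)}

theorem coe_mem_collar {δ : ℝ} {z : ℂ} :
    (z : OnePoint ℂ) ∈ S.collar δ ↔ ∀ j, S.radius j - δ ≤ dist z (S.center j) :=
  ⟨fun h => h z rfl, fun h w hw => by rw [← OnePoint.coe_injective hw]; exact h⟩

theorem infty_mem_collar (δ : ℝ) : (∞ : OnePoint ℂ) ∈ S.collar δ :=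
  fun z hz => absurd hz (OnePoint.infty_ne_coe z)

theorem collar_mono {δ ε : ℝ} (h : δ ≤ ε) : S.collar δ ⊆ S.collar ε :=
  fun _ hp z hz j => (sub_le_sub_left h _).trans (hp z hz j)

theorem coe_mem_exterior {z : ℂ} : (z : OnePoint ℂ) ∈ S.exterior ↔ z ∈ S.exteriorPlane := by
  simp [exterior]

theorem infty_mem_exterior : ∞ ∈ S.exterior := by simp [exterior]

theorem exterior_subset_collar {δ : ℝ} (hδ : 0 ≤ δ) : S.exterior ⊆ S.collar δ := by
  intro p hp z hz j
  subst hz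
  have := S.coe_mem_exterior.mp hp j
  linarith

theorem dist_of_mem_circle_ne {i j : Fin n} (hij : i ≠ j) {z : ℂ} (hz : z ∈ S.circle i) :
    S.radius j < dist z (S.center j) := by
  have h1 := S.disjoint i j hij
  have h2 : dist z (S.center i) = S.radius i := hz
  have h3 := dist_triangle_left (S.center i) (S.center j) z
  linarith

theorem le_dist_of_mem_contour {z : ℂ} (hz : z ∈ S.contour) (j : Fin n) :
    S.radius j ≤ dist z (S.center j) := by
  obtain ⟨i, hi⟩ := Set.mem_iUnion.mp hz
  by_cases hij : i = j
  · subst hij; exact (show dist z (S.center i) = S.radius i from hi).ge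
  · exact (S.dist_of_mem_circle_ne hij hi).le

theorem contour_subset_collar {δ : ℝ} (hδ : 0 ≤ δ) {z : ℂ} (hz : z ∈ S.contour) :
    (z : OnePoint ℂ) ∈ S.collar δ :=
  S.coe_mem_collar.mpr fun j => by linarith [S.le_dist_of_mem_contour hz j]

theorem circle_subset_contour (j : Fin n) : S.circle j ⊆ S.contour :=
  Set.subset_iUnion _ j

theorem notMem_contour_of_mem_exteriorPlane {z : ℂ} (hz : z ∈ S.exteriorPlane) :
    z ∉ S.contour := by
  intro h
  obtain ⟨i, hi⟩ := Set.mem_iUnion.mp h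
  exact (hz i).ne' hi

/-- Product of the symmetries along a word. -/
def wordProd (w : List (Fin n)) : Equiv.Perm (OnePoint ℂ) := (w.map S.T).prod

theorem wordProd_cons (i : Fin n) (w : List (Fin n)) :
    S.wordProd (i :: w) = S.T i * S.wordProd w := by simp [wordProd]

theorem wordProd_append (v w : List (Fin n)) :
    S.wordProd (v ++ w) = S.wordProd v * S.wordProd w := by simp [wordProd]

theorem wordProd_reverse (w : List (Fin n)) : S.wordProd w.reverse = (S.wordProd w)⁻¹ := by
  induction w with
  | nil => simp [wordProd]
  | cons i w ih =>
    rw [List.reverse_cons, wordProd_append, ih, S.wordProd_cons i w, mul_inv_rev, T_inv]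
    simp [wordProd]

/-- Cancelling a pair `T_i T_i` removes two letters, so the parity of the length survives. Parity is
what later forces a nontrivial group element to have a reduced word of length at least two. -/
theorem exists_reduced (w : List (Fin n)) : ∃ v : List (Fin n), v.IsChain (· ≠ ·) ∧
    S.wordProd v = S.wordProd w ∧ (Even v.length ↔ Even w.length) := by
  induction w with
  | nil => exact ⟨[], by simp, rfl, Iff.rfl⟩
  | cons i w ih =>
    obtain ⟨v, hv, hvw, hl⟩ := ih
    cases v with
    | nil =>
      refine ⟨[i], by simp, ?_, ?_⟩
      · rw [wordProd_cons, wordProd_cons, hvw]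
      · simp only [List.length_cons, Nat.even_add_one, hl]
    | cons k v =>
      by_cases hik : i = k
      · subst hik
        refine ⟨v, hv.tail, ?_, ?_⟩
        · rw [S.wordProd_cons i w, ← hvw, wordProd_cons, ← mul_assoc, T_mul_T_self, one_mul]
        · rw [List.length_cons, Nat.even_add_one, ← hl, List.length_cons, Nat.even_add_one, not_not]
      · refine ⟨i :: k :: v, by simpa using ⟨hik, hv⟩, ?_, ?_⟩
        · rw [wordProd_cons, S.wordProd_cons i w, hvw]
        · rw [List.length_cons, Nat.even_add_one, List.length_cons (as := w), Nat.even_add_one, hl]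

/-- Ping-pong with two radii. A single reflection of a collar point only reaches the enlarged disc
of radius `r_i + m`. The enlarged discs are still far apart, so any further reflection acts on a
point at distance at least `r_i + m` from its centre and lands in the shrunken disc of radius `r_i -
δ`. -/
theorem exists_wordProd_mem {δ m : ℝ} (hδ0 : 0 ≤ δ) (hδ : ∀ i, δ < S.radius i) (hm : 0 ≤ m)
    (hsep : ∀ i j, i ≠ j → S.radius i + S.radius j + 2 * m ≤ dist (S.center i) (S.center j))
    (hrad : ∀ i, S.radius i ^ 2 ≤ (S.radius i - δ) * (S.radius i + m))
    (w : List (Fin n)) (i : Fin n) (hw : (i :: w).IsChain (· ≠ ·)) {p : OnePoint ℂ}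
    (hp : p ∈ S.collar δ) :
    (∃ z ∈ Metric.closedBall (S.center i) (S.radius i + m),
      S.wordProd (i :: w) p = (z : OnePoint ℂ)) ∧
    (w ≠ [] → ∃ z ∈ Metric.closedBall (S.center i) (S.radius i - δ),
      S.wordProd (i :: w) p = (z : OnePoint ℂ)) := by
  induction w generalizing i with
  | nil =>
    refine ⟨?_, fun h => absurd rfl h⟩
    rw [wordProd_cons]
    exact S.exists_T_eq_of_le_dist i (sub_pos.mpr (hδ i)) (hrad i) fun z hz => hp z hz i
  | cons k w ih =>
    have hik : i ≠ k := by simp at hw; exact hw.1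
    obtain ⟨z, hz, hzw⟩ := (ih k hw.tail).1
    have hd : S.radius i + m ≤ dist z (S.center i) := by
      have h1 := hsep i k hik
      have h2 := dist_triangle_left (S.center i) (S.center k) z
      rw [Metric.mem_closedBall] at hz
      linarith
    have key : ∃ y ∈ Metric.closedBall (S.center i) (S.radius i - δ),
        S.wordProd (i :: k :: w) p = (y : OnePoint ℂ) := by
      rw [wordProd_cons, Equiv.Perm.mul_apply, hzw]
      refine S.exists_T_eq_of_le_dist i (by linarith [S.radius_pos i]) ?_ (s := S.radius i + m) ?_
      · rw [mul_comm]; exact hrad i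
      · intro y hy; rw [← OnePoint.coe_injective hy]; exact hd
    refine ⟨?_, fun _ => key⟩
    rw [wordProd_cons, Equiv.Perm.mul_apply, hzw]
    refine S.exists_T_eq_of_le_dist i (sub_pos.mpr (hδ i)) (hrad i) fun y hy => ?_
    rw [← OnePoint.coe_injective hy]
    linarith

theorem exists_pos_forall_le {ι : Type*} [Finite ι] (f : ι → ℝ) (hf : ∀ i, 0 < f i) :
    ∃ m > 0, ∀ i, m ≤ f i := by
  rcases isEmpty_or_nonempty ι with h | h
  · exact ⟨1, one_pos, fun i => h.elim i⟩
  · obtain ⟨i, hi⟩ := Finite.exists_min f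
    exact ⟨f i, hf i, hi⟩

variable [NeZero n]

theorem gen_zero : S.gen 0 = 1 := S.T_mul_T_self 0

theorem gen_mem (j : Fin n) : S.gen j ∈ S.group := Subgroup.subset_closure ⟨j, rfl⟩

theorem T_mul_T_mem (i j : Fin n) : S.T i * S.T j ∈ S.group := by
  have h : S.T i * S.T j = S.gen i * (S.gen j)⁻¹ := by
    rw [gen, gen, mul_inv_rev, T_inv, T_inv, mul_assoc, ← mul_assoc (S.T 0), T_mul_T_self, one_mul]
  rw [h]
  exact mul_mem (S.gen_mem i) (inv_mem (S.gen_mem j))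

theorem wordProd_mem_group : ∀ w : List (Fin n), Even w.length → S.wordProd w ∈ S.group
  | [], _ => one_mem _
  | [_], h => by simp at h
  | i :: j :: w, h => by
    rw [wordProd_cons, wordProd_cons, ← mul_assoc]
    refine mul_mem (S.T_mul_T_mem i j) (wordProd_mem_group w ?_)
    simpa [Nat.even_add_one] using h

theorem mem_group_iff {σ : Equiv.Perm (OnePoint ℂ)} :
    σ ∈ S.group ↔ ∃ w : List (Fin n), Even w.length ∧ S.wordProd w = σ := by
  refine ⟨fun h => ?_, fun ⟨w, hw, h⟩ => h ▸ S.wordProd_mem_group w hw⟩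
  refine Subgroup.closure_induction (p := fun σ _ => ∃ w, Even w.length ∧ S.wordProd w = σ)
    ?_ ?_ ?_ ?_ h
  · rintro _ ⟨j, rfl⟩
    exact ⟨[j, 0], by simp, by simp [wordProd, gen]⟩
  · exact ⟨[], by simp, rfl⟩
  · rintro _ _ _ _ ⟨v, hv, rfl⟩ ⟨w, hw, rfl⟩
    exact ⟨v ++ w, by simpa using hv.add hw, S.wordProd_append v w⟩
  · rintro _ _ ⟨w, hw, rfl⟩
    exact ⟨w.reverse, by simpa using hw, S.wordProd_reverse w⟩

theorem T_mul_mul_T_mem (i j : Fin n) {σ : Equiv.Perm (OnePoint ℂ)} (hσ : σ ∈ S.group) :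
    S.T i * σ * S.T j ∈ S.group := by
  obtain ⟨w, hw, rfl⟩ := S.mem_group_iff.mp hσ
  refine S.mem_group_iff.mpr ⟨i :: (w ++ [j]), ?_, ?_⟩
  · simpa [Nat.even_add_one] using hw
  · rw [wordProd_cons, wordProd_append, mul_assoc]; simp [wordProd]

/-- The bijection `σ ↦ T_i σ T_j` of the group. -/
def twist (i j : Fin n) : S.group ≃ S.group where
  toFun σ := ⟨S.T i * σ * S.T j, S.T_mul_mul_T_mem i j σ.2⟩
  invFun σ := ⟨S.T i * σ * S.T j, S.T_mul_mul_T_mem i j σ.2⟩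
  left_inv σ := by ext p; simp
  right_inv σ := by ext p; simp

/-- `δ` is so small that every nontrivial element of the group maps the points which are at
distance at least `r_j - δ` from the centres into one of the discs of radius `r_i - δ`. -/
structure IsMargin (δ : ℝ) : Prop where
  pos : 0 < δ
  sep : ∀ i j, i ≠ j → S.radius i + S.radius j + δ ≤ dist (S.center i) (S.center j)
  maps : ∀ σ ∈ S.group, σ ≠ 1 → ∃ i, ∀ p ∈ S.collar δ,
    ∃ z ∈ Metric.closedBall (S.center i) (S.radius i - δ), σ p = (z : OnePoint ℂ)

theorem exists_isMargin : ∃ δ, S.IsMargin δ := by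
  obtain ⟨m, hm, hsep⟩ : ∃ m > 0, ∀ x : {x : Fin n × Fin n // x.1 ≠ x.2}, m ≤
      (dist (S.center x.1.1) (S.center x.1.2) - (S.radius x.1.1 + S.radius x.1.2)) / 2 :=
    exists_pos_forall_le _ fun x => by linarith [S.disjoint _ _ x.2]
  -- The bound `δ ≤ r m / (r + m)` is equivalent to `r² ≤ (r - δ)(r + m)`, the condition under which
  -- reflection exchanges the two radii.
  obtain ⟨δ, hδ, hδm⟩ := exists_pos_forall_le
    (fun i => S.radius i * m / (S.radius i + m)) fun i => by
      have := S.radius_pos i; positivity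
  have hle : ∀ i, δ * (S.radius i + m) ≤ S.radius i * m := fun i =>
    (le_div_iff₀ (by linarith [S.radius_pos i])).mp (hδm i)
  have hlt : ∀ i, δ < S.radius i := fun i => by
    nlinarith [hle i, S.radius_pos i, mul_pos hδ (S.radius_pos i)]
  have hδm' : δ ≤ m := by nlinarith [hle 0, S.radius_pos 0, mul_pos hδ hm]
  have hsep' : ∀ i j, i ≠ j →
      S.radius i + S.radius j + 2 * m ≤ dist (S.center i) (S.center j) := fun i j hij => by
    have := hsep ⟨(i, j), hij⟩
    simp only at this
    linarith
  refine ⟨δ, hδ, fun i j hij => by linarith [hsep' i j hij], fun σ hσ hσ1 => ?_⟩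
  obtain ⟨w, hw, rfl⟩ := S.mem_group_iff.mp hσ
  obtain ⟨v, hv, hvw, hl⟩ := S.exists_reduced w
  rw [← hvw] at hσ1 ⊢
  rw [← hl] at hw
  -- The empty word is the identity and a single letter has odd length, so at least two letters
  -- remain.
  match v, hv, hw, hσ1 with
  | [], _, _, h => exact absurd rfl h
  | [_], _, h, _ => simp at h
  | i :: k :: v, hv, _, _ =>
    exact ⟨i, fun p hp => (S.exists_wordProd_mem hδ.le hlt hm.le hsep'
      (fun i => by nlinarith [hle i]) (k :: v) i hv hp).2 (by simp)⟩

end Geometry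

end CircleSystem

end CircularRH

end

noncomputable section

namespace CircularRH

namespace CircleSystem

/-! ### Estimates for the terms of the kernel -/

section Estimates

@[simp] theorem cauchyTerm_infty (η : ℂ) : cauchyTerm η ∞ = 0 := rfl

@[simp] theorem cauchyTerm_coe (η z : ℂ) : cauchyTerm η (z : OnePoint ℂ) = (η - z)⁻¹ := rfl

theorem norm_inv_sub_inv_le {x y : ℂ} {s : ℝ} (hs : 0 < s) (hx : s ≤ ‖x‖) (hy : s ≤ ‖y‖) :
    ‖x⁻¹ - y⁻¹‖ ≤ ‖x - y‖ / s ^ 2 := by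
  have hx0 : x ≠ 0 := norm_pos_iff.mp (hs.trans_le hx)
  have hy0 : y ≠ 0 := norm_pos_iff.mp (hs.trans_le hy)
  rw [inv_sub_inv hx0 hy0, norm_div, norm_mul, norm_sub_rev y x]
  gcongr
  nlinarith

variable {n : ℕ} (S : CircleSystem n)

/-- Poles are kept in the discs of radius `r_i - δ` but points only in the collar of width `δ/2`.
The gap `δ/2` makes all later estimates uniform up to and slightly across the circles. -/
theorem half_le_norm_pole_sub {δ : ℝ} {i : Fin n} {w z : ℂ}
    (hw : w ∈ Metric.closedBall (S.center i) (S.radius i - δ))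
    (hz : (z : OnePoint ℂ) ∈ S.collar (δ / 2)) : δ / 2 ≤ ‖w - z‖ := by
  have h1 := S.coe_mem_collar.mp hz i
  rw [Metric.mem_closedBall] at hw
  have h2 := dist_triangle_left z (S.center i) w
  rw [← dist_eq_norm]
  linarith

variable [NeZero n]

theorem isMargin_dist {S : CircleSystem n} {δ : ℝ} (_h : S.IsMargin δ) {i : Fin n} {w η : ℂ}
    (hw : w ∈ Metric.closedBall (S.center i) (S.radius i - δ)) (hη : η ∈ S.contour) :
    δ ≤ ‖η - w‖ := by
  have h1 := S.le_dist_of_mem_contour hη i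
  have h2 := dist_triangle η w (S.center i)
  rw [Metric.mem_closedBall] at hw
  rw [← dist_eq_norm]
  linarith

/-- Partial fractions: with `γ ≠ 0`, `(αz + β)/(γz + δ) = α/γ - ((αδ - βγ)/γ²)/(z + δ/γ)`. Thus `‖B
σ‖` is the general term of the series in `FirstClass`. `B` is set to zero at the identity, where
that representation is not available. -/
theorem exists_moebius (hS : S.FirstClass) : ∃ A B P : S.group → ℂ,
    Summable (fun σ => ‖B σ‖) ∧ ∀ σ : S.group, σ ≠ 1 →
      (σ : Equiv.Perm (OnePoint ℂ)) ∞ = (A σ : OnePoint ℂ) ∧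
      (σ : Equiv.Perm (OnePoint ℂ)) (P σ : OnePoint ℂ) = ∞ ∧
      ∀ z : ℂ, z ≠ P σ →
        (σ : Equiv.Perm (OnePoint ℂ)) (z : OnePoint ℂ) =
          ((A σ + B σ / (z - P σ) : ℂ) : OnePoint ℂ) := by
  classical
  obtain ⟨M, hM, hsum⟩ := hS
  obtain ⟨δ, hδ⟩ := S.exists_isMargin
  refine ⟨fun σ => M σ 0 0 / M σ 1 0,
    fun σ => if σ = 1 then 0 else -((M σ).val.det / (M σ 1 0) ^ 2), fun σ => -(M σ 1 1) / M σ 1 0,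
    ?_, fun σ hσ => ?_⟩
  · have h1 : Summable ((fun σ : S.group => ‖if σ = 1 then (0 : ℂ) else
        -((M σ).val.det / (M σ 1 0) ^ 2)‖) ∘ (Subtype.val : {σ : S.group // σ ≠ 1} → S.group)) := by
      refine hsum.congr fun σ => ?_
      simp [σ.2]
    refine (Function.Injective.summable_iff Subtype.val_injective ?_).mp h1
    intro σ hσ
    have : σ = 1 := by by_contra h; exact hσ ⟨⟨σ, h⟩, rfl⟩
    simp [this]
  -- A nontrivial element moves `∞` into a disc, whereas `γ = 0` would fix `∞`.
  · have hc : M σ 1 0 ≠ 0 := by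
      intro h
      obtain ⟨i, hi⟩ := hδ.maps σ σ.2 (fun h => hσ (Subtype.ext h))
      obtain ⟨z, -, hz⟩ := hi ∞ (S.infty_mem_collar δ)
      rw [hM, OnePoint.smul_infty_eq_self_iff.mpr h] at hz
      exact OnePoint.infty_ne_coe z hz
    refine ⟨?_, ?_, fun z hz => ?_⟩
    · rw [hM, OnePoint.smul_infty_eq_ite, if_neg hc]
    · rw [hM, OnePoint.smul_some_eq_ite, if_pos]
      field_simp
      ring
    · have h1 : M σ 1 0 * z + M σ 1 1 ≠ 0 := by
        intro h
        apply hz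
        field_simp
        linear_combination h
      simp only [if_neg hσ]
      rw [hM, OnePoint.smul_some_eq_ite, if_neg h1]
      congr 1
      have h2 : z - -(M σ 1 1) / M σ 1 0 = (M σ 1 0 * z + M σ 1 1) / M σ 1 0 := by
        field_simp
        ring
      have key : ∀ a b c d : ℂ, c ≠ 0 → c * z + d ≠ 0 →
          (a * z + b) / (c * z + d) = a / c + -((a * d - b * c) / c ^ 2) / ((c * z + d) / c) := by
        intro a b c d hc hd
        rw [div_div_eq_mul_div, div_add_div _ _ hc hd, div_eq_div_iff hd (mul_ne_zero hc hd)]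
        field_simp
        ring
      rw [h2, Matrix.det_fin_two]
      exact key _ _ _ _ hc h1

/-- Bounds for the terms of the kernel, in terms of the poles `P σ = σ⁻¹(∞)`. -/
structure KernelBound (δ : ℝ) (b : S.group → ℝ) (P : S.group → ℂ) : Prop where
  margin : S.IsMargin δ
  summable : Summable b
  nonneg : ∀ σ, 0 ≤ b σ
  pole : ∀ σ, σ ≠ 1 → ∃ i, P σ ∈ Metric.closedBall (S.center i) (S.radius i - δ)
  le : ∀ σ, σ ≠ 1 → ∀ η ∈ S.contour, ∀ p ∈ S.collar (δ / 2), ∀ q ∈ S.collar (δ / 2),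
    ‖S.kernelTerm q p η σ‖ ≤ b σ * ‖cauchyTerm (P σ) p - cauchyTerm (P σ) q‖
  diff : ∀ σ : S.group, σ ≠ 1 → ∀ η ∈ S.contour, ∀ z : ℂ, (z : OnePoint ℂ) ∈ S.collar (δ / 2) →
    DifferentiableAt ℂ (fun z : ℂ => cauchyTerm η ((σ : Equiv.Perm (OnePoint ℂ)) z)) z

/-- Since `σ p = A - B/(P - p)`, differences of images are `B` times differences of `1/(P - p)`. The
images stay at distance `δ` from the circles, so passing to `1/(η - σ p)` costs only a factor `δ⁻²`.
This gives the weight `‖B σ‖ / δ²`. -/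
theorem exists_kernelBound (hS : S.FirstClass) : ∃ δ b P, S.KernelBound δ b P := by
  obtain ⟨A, B, P, hB, hσ⟩ := S.exists_moebius hS
  obtain ⟨δ, hδ⟩ := S.exists_isMargin
  have h0 := hδ.pos
  have hcol : S.collar (δ / 2) ⊆ S.collar δ := S.collar_mono (by linarith)
  have hpole : ∀ σ : S.group, σ ≠ 1 →
      ∃ i, P σ ∈ Metric.closedBall (S.center i) (S.radius i - δ) := by
    intro σ h1
    -- The pole is `σ⁻¹(∞)`, so the margin property is applied to the inverse.
    obtain ⟨i, hi⟩ := hδ.maps (σ : Equiv.Perm _)⁻¹ (inv_mem σ.2)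
      (fun h => h1 (Subtype.ext (inv_eq_one.mp h)))
    obtain ⟨z, hz, hzi⟩ := hi ∞ (S.infty_mem_collar δ)
    rw [Equiv.Perm.inv_eq_iff_eq] at hzi
    rw [← (hσ σ h1).2.1] at hzi
    exact ⟨i, OnePoint.coe_injective ((σ : Equiv.Perm (OnePoint ℂ)).injective hzi) ▸ hz⟩
  have hform : ∀ σ : S.group, σ ≠ 1 → ∀ p ∈ S.collar (δ / 2),
      (σ : Equiv.Perm (OnePoint ℂ)) p = ((A σ - B σ * cauchyTerm (P σ) p : ℂ) : OnePoint ℂ) := by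
    intro σ h1 p hp
    induction p using OnePoint.rec with
    | infty => simp [(hσ σ h1).1]
    | coe z =>
      obtain ⟨i, hi⟩ := hpole σ h1
      have h2 := S.half_le_norm_pole_sub hi hp
      have h3 : P σ - z ≠ 0 := norm_pos_iff.mp (by linarith)
      rw [(hσ σ h1).2.2 z (fun h => h3 (by rw [h, sub_self])), cauchyTerm_coe, ← neg_sub (P σ) z,
        div_neg, div_eq_mul_inv, ← sub_eq_add_neg]
  have hdist : ∀ σ : S.group, σ ≠ 1 → ∀ η ∈ S.contour, ∀ p ∈ S.collar (δ / 2),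
      δ ≤ ‖η - (A σ - B σ * cauchyTerm (P σ) p)‖ := by
    intro σ h1 η hη p hp
    obtain ⟨i, hi⟩ := hδ.maps σ σ.2 (fun h => h1 (Subtype.ext h))
    obtain ⟨z, hz, hzi⟩ := hi p (hcol hp)
    rw [hform σ h1 p hp] at hzi
    rw [OnePoint.coe_injective hzi]
    exact isMargin_dist hδ hz hη
  refine ⟨δ, fun σ => ‖B σ‖ / δ ^ 2, P, hδ, hB.div_const _, fun σ => by positivity, hpole,
    fun σ h1 η hη p hp q hq => ?_, fun σ h1 η hη z hz => ?_⟩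
  · rw [kernelTerm, hform σ h1 p hp, hform σ h1 q hq, cauchyTerm_coe, cauchyTerm_coe]
    refine (norm_inv_sub_inv_le h0 (hdist σ h1 η hη p hp) (hdist σ h1 η hη q hq)).trans_eq ?_
    rw [show η - (A σ - B σ * cauchyTerm (P σ) p) - (η - (A σ - B σ * cauchyTerm (P σ) q)) =
      B σ * (cauchyTerm (P σ) p - cauchyTerm (P σ) q) by ring, norm_mul]
    ring
  · obtain ⟨i, hi⟩ := hpole σ h1
    have h2 := S.half_le_norm_pole_sub hi hz
    have h3 : P σ - z ≠ 0 := norm_pos_iff.mp (by linarith)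
    have h4 : η - (A σ - B σ * (P σ - z)⁻¹) ≠ 0 :=
      norm_pos_iff.mp (h0.trans_le (hdist σ h1 η hη z hz))
    have h5 : (fun z : ℂ => cauchyTerm η ((σ : Equiv.Perm (OnePoint ℂ)) z)) =ᶠ[𝓝 z]
        fun z => (η - (A σ - B σ * (P σ - z)⁻¹))⁻¹ := by
      have : ∀ᶠ y in 𝓝 z, P σ - y ≠ 0 :=
        ((continuous_const.sub continuous_id).continuousAt (x := z)).eventually_ne h3
      filter_upwards [this] with y hy
      rw [(hσ σ h1).2.2 y (fun h => hy (by rw [h, sub_self])), cauchyTerm_coe, ← neg_sub (P σ) y,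
        div_neg, div_eq_mul_inv, ← sub_eq_add_neg]
    refine DifferentiableAt.congr_of_eventuallyEq ?_ h5
    have h6 : DifferentiableAt ℂ (fun y => P σ - y) z := by fun_prop
    have h7 := h6.inv h3
    have h8 : DifferentiableAt ℂ (fun y => η - (A σ - B σ * (P σ - y)⁻¹)) z :=
      (((h7.const_mul (B σ)).const_sub (A σ)).const_sub η)
    exact h8.inv h4

/-- The kernel without the term of the identity. -/
def regKernel (q p : OnePoint ℂ) (η : ℂ) : ℂ :=
  open Classical in ∑' σ : S.group, if σ = 1 then 0 else S.kernelTerm q p η σ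

namespace KernelBound

variable {S} {δ : ℝ} {b : S.group → ℝ} {P : S.group → ℂ} (hb : S.KernelBound δ b P)
include hb

theorem norm_cauchyTerm_le {σ : S.group} (hσ : σ ≠ 1) {p : OnePoint ℂ}
    (hp : p ∈ S.collar (δ / 2)) : ‖cauchyTerm (P σ) p‖ ≤ 2 / δ := by
  have h0 := hb.margin.pos
  induction p using OnePoint.rec with
  | infty => rw [cauchyTerm_infty, norm_zero]; positivity
  | coe z =>
    obtain ⟨i, hi⟩ := hb.pole σ hσ
    have h2 := S.half_le_norm_pole_sub hi hp
    rw [cauchyTerm_coe, norm_inv, ← inv_div]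
    exact inv_anti₀ (by positivity) h2

theorem norm_kernelTerm_le {σ : S.group} (hσ : σ ≠ 1) {η : ℂ} (hη : η ∈ S.contour)
    {p q : OnePoint ℂ} (hp : p ∈ S.collar (δ / 2)) (hq : q ∈ S.collar (δ / 2)) :
    ‖S.kernelTerm q p η σ‖ ≤ b σ * (4 / δ) := by
  refine (hb.le σ hσ η hη p hp q hq).trans (mul_le_mul_of_nonneg_left ?_ (hb.nonneg σ))
  refine (norm_sub_le _ _).trans ?_
  have h1 := hb.norm_cauchyTerm_le hσ hp
  have h2 := hb.norm_cauchyTerm_le hσ hq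
  have h3 : (4 : ℝ) / δ = 2 / δ + 2 / δ := by ring
  linarith

theorem norm_ite_le {η : ℂ} (hη : η ∈ S.contour) {p q : OnePoint ℂ}
    (hp : p ∈ S.collar (δ / 2)) (hq : q ∈ S.collar (δ / 2)) (σ : S.group) [Decidable (σ = 1)] :
    ‖if σ = 1 then 0 else S.kernelTerm q p η σ‖ ≤ b σ * (4 / δ) := by
  split_ifs with h
  · have h0 := hb.margin.pos
    have := hb.nonneg σ
    rw [norm_zero]; positivity
  · exact hb.norm_kernelTerm_le h hη hp hq

theorem summable_kernelTerm {η : ℂ} (hη : η ∈ S.contour) {p q : OnePoint ℂ}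
    (hp : p ∈ S.collar (δ / 2)) (hq : q ∈ S.collar (δ / 2)) : Summable (S.kernelTerm q p η) := by
  refine Summable.of_norm_bounded_eventually (hb.summable.mul_right (4 / δ)) ?_
  filter_upwards [(Set.finite_singleton (1 : S.group)).compl_mem_cofinite] with σ hσ
  exact hb.norm_kernelTerm_le hσ hη hp hq

theorem kernel_eq {η : ℂ} (hη : η ∈ S.contour) {p q : OnePoint ℂ}
    (hp : p ∈ S.collar (δ / 2)) (hq : q ∈ S.collar (δ / 2)) :
    S.kernel q p η = cauchyTerm η p - cauchyTerm η q + S.regKernel q p η := by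
  classical
  rw [kernel, (hb.summable_kernelTerm hη hp hq).tsum_eq_add_tsum_ite 1, regKernel]
  congr

theorem continuousOn_regKernel {p q : OnePoint ℂ}
    (hp : p ∈ S.collar (δ / 2)) (hq : q ∈ S.collar (δ / 2)) :
    ContinuousOn (S.regKernel q p) S.contour := by
  classical
  refine continuousOn_tsum (fun σ => ?_) (hb.summable.mul_right (4 / δ))
    fun σ η hη => hb.norm_ite_le hη hp hq σ
  by_cases hσ : σ = 1
  · simp only [hσ, if_true]; exact continuousOn_const
  · simp only [hσ, if_false]
    have h0 := hb.margin.pos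
    have key : ∀ p ∈ S.collar (δ / 2), ContinuousOn
        (fun η => cauchyTerm η ((σ : Equiv.Perm (OnePoint ℂ)) p)) S.contour := by
      intro p hp
      obtain ⟨i, hi⟩ := hb.margin.maps σ σ.2 (fun h => hσ (Subtype.ext h))
      obtain ⟨z, hz, hzi⟩ := hi p (S.collar_mono (by linarith) hp)
      simp only [hzi, cauchyTerm_coe]
      refine ContinuousOn.inv₀ (by fun_prop) fun η hη => ?_
      exact norm_pos_iff.mp (h0.trans_le (isMargin_dist hb.margin hz hη))
    exact (key p hp).sub (key q hq)

/-- The base point cancels: the difference of the terms for `p` and `p'` is the term for `p` with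
base point `p'`. Formulating smallness through `1/(P σ - p)` lets one estimate serve both Lipschitz
dependence on `p` and convergence as `p → ∞`. -/
theorem norm_regKernel_sub_le {η : ℂ} (hη : η ∈ S.contour) {p p' q : OnePoint ℂ}
    (hp : p ∈ S.collar (δ / 2)) (hp' : p' ∈ S.collar (δ / 2)) (hq : q ∈ S.collar (δ / 2)) {ε : ℝ}
    (hε : 0 ≤ ε) (h : ∀ σ, σ ≠ 1 → ‖cauchyTerm (P σ) p - cauchyTerm (P σ) p'‖ ≤ ε) :
    ‖S.regKernel q p η - S.regKernel q p' η‖ ≤ (∑' σ, b σ) * ε := by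
  classical
  have hs : ∀ p ∈ S.collar (δ / 2),
      Summable fun σ : S.group => if σ = 1 then 0 else S.kernelTerm q p η σ := fun p hp =>
    Summable.of_norm_bounded (hb.summable.mul_right (4 / δ)) fun σ => hb.norm_ite_le hη hp hq σ
  rw [regKernel, regKernel, ← (hs p hp).tsum_sub (hs p' hp'), ← tsum_mul_right]
  refine tsum_of_norm_bounded (hb.summable.mul_right ε).hasSum fun σ => ?_
  split_ifs with hσ
  · have := hb.nonneg σ
    rw [sub_zero, norm_zero]; positivity
  · have h1 : S.kernelTerm q p η σ - S.kernelTerm q p' η σ = S.kernelTerm p' p η σ := by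
      simp only [kernelTerm]; ring
    rw [h1]
    exact (hb.le σ hσ η hη p hp p' hp').trans (mul_le_mul_of_nonneg_left (h σ hσ) (hb.nonneg σ))

theorem norm_regKernel_sub_le_mul {η : ℂ} (hη : η ∈ S.contour) {q : OnePoint ℂ} {z z' : ℂ}
    (hz : (z : OnePoint ℂ) ∈ S.collar (δ / 2)) (hz' : (z' : OnePoint ℂ) ∈ S.collar (δ / 2))
    (hq : q ∈ S.collar (δ / 2)) :
    ‖S.regKernel q z η - S.regKernel q z' η‖ ≤ (∑' σ, b σ) / (δ / 2) ^ 2 * ‖z - z'‖ := by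
  have h0 := hb.margin.pos
  refine (hb.norm_regKernel_sub_le hη hz hz' hq (ε := ‖z - z'‖ / (δ / 2) ^ 2)
    (by positivity) fun σ hσ => ?_).trans_eq (by ring)
  obtain ⟨i, hi⟩ := hb.pole σ hσ
  refine (norm_inv_sub_inv_le (by positivity) (S.half_le_norm_pole_sub hi hz)
    (S.half_le_norm_pole_sub hi hz')).trans_eq ?_
  rw [sub_sub_sub_cancel_left, norm_sub_rev]

theorem tendstoUniformlyOn_regKernel {q : OnePoint ℂ} (hq : q ∈ S.collar (δ / 2)) :
    TendstoUniformlyOn (fun z : ℂ => S.regKernel q z) (S.regKernel q ∞) (cocompact ℂ)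
      S.contour := by
  have h0 := hb.margin.pos
  obtain ⟨R, hR⟩ : ∃ R, ∀ i, ‖S.center i‖ + S.radius i ≤ R := by
    obtain ⟨i, hi⟩ := Finite.exists_max fun i => ‖S.center i‖ + S.radius i
    exact ⟨_, hi⟩
  have hP : ∀ σ : S.group, σ ≠ 1 → ‖P σ‖ ≤ R := by
    intro σ hσ
    obtain ⟨i, hi⟩ := hb.pole σ hσ
    rw [Metric.mem_closedBall, dist_eq_norm] at hi
    have h1 := norm_le_norm_add_norm_sub' (P σ) (S.center i)
    linarith [hR i]
  rw [Metric.tendstoUniformlyOn_iff]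
  intro ε hε
  have hB : 0 ≤ ∑' σ, b σ := tsum_nonneg hb.nonneg
  -- All poles satisfy `‖P σ‖ ≤ R`, so `‖1/(P σ - z)‖ ≤ 1/(‖z‖ - R)`. The second threshold makes
  -- this smaller than `ε` divided by the total weight; the first puts `z` in the collar.
  have ht : ∀ᶠ z : ℂ in cocompact ℂ, max (R + δ) (R + (∑' σ, b σ) * (2 / ε) + 1) ≤ ‖z‖ :=
    tendsto_norm_cocompact_atTop.eventually_ge_atTop _
  filter_upwards [ht] with z hz η hη
  have hz1 := (le_max_left _ _).trans hz
  have hz2 := (le_max_right _ _).trans hz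
  have hzc : (z : OnePoint ℂ) ∈ S.collar (δ / 2) := by
    refine S.coe_mem_collar.mpr fun j => ?_
    rw [dist_eq_norm]
    have h1 := norm_le_norm_add_norm_sub' z (S.center j)
    linarith [hR j]
  have hpos : 0 < (∑' σ, b σ) * (2 / ε) + 1 := by positivity
  rw [dist_comm, dist_eq_norm]
  refine (hb.norm_regKernel_sub_le hη hzc (S.infty_mem_collar _) hq
    (ε := ((∑' σ, b σ) * (2 / ε) + 1)⁻¹) (by positivity) fun σ hσ => ?_).trans_lt ?_
  · rw [cauchyTerm_infty, sub_zero, cauchyTerm_coe, norm_inv]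
    refine inv_anti₀ hpos ?_
    have h1 := norm_le_norm_add_norm_sub' z (P σ)
    rw [norm_sub_rev] at h1
    linarith [hP σ hσ]
  · rw [← div_eq_mul_inv, div_lt_iff₀ hpos]
    field_simp
    nlinarith

/-- The planar open neighbourhood of the closed exterior on which the regular part is analytic. -/
theorem differentiableOn_regKernel {η : ℂ} (hη : η ∈ S.contour) {q : OnePoint ℂ}
    (hq : q ∈ S.collar (δ / 2)) :
    DifferentiableOn ℂ (fun z : ℂ => S.regKernel q z η)
      {z | ∀ j, S.radius j - δ / 2 < dist z (S.center j)} := by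
  classical
  have hmem : ∀ z ∈ {z | ∀ j, S.radius j - δ / 2 < dist z (S.center j)},
      (z : OnePoint ℂ) ∈ S.collar (δ / 2) := fun z hz => S.coe_mem_collar.mpr fun j => (hz j).le
  refine Complex.differentiableOn_tsum_of_summable_norm (hb.summable.mul_right (4 / δ))
    (fun σ => ?_) ?_ fun σ z hz => hb.norm_ite_le hη (hmem z hz) hq σ
  · by_cases hσ : σ = 1
    · simp only [hσ, if_true]; exact differentiableOn_const _
    · simp only [hσ, if_false]
      exact fun z hz => ((hb.diff σ hσ η hη z (hmem z hz)).sub_const _).differentiableWithinAt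
  · rw [Set.ofPred_forall]
    exact isOpen_iInter_of_finite fun j => isOpen_lt continuous_const
      (continuous_id.dist continuous_const)

end KernelBound

end Estimates

end CircleSystem

end CircularRH

end

noncomputable section

namespace CircularRH

namespace CircleSystem

/-! ### Quasiautomorphy and symmetry of the kernel -/

section Kernel

variable {n : ℕ} (S : CircleSystem n)

/-- On the `l`-th circle the symmetry `T_l` acts on the Cauchy kernel by conjugation. -/
theorem mul_cauchyTerm_T {l : Fin n} {η : ℂ} (hη : η ∈ S.circle l) {p : OnePoint ℂ}
    (hp : p ≠ (η : OnePoint ℂ)) :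
    (η - S.center l) * cauchyTerm η (S.T l p) + conj ((η - S.center l) * cauchyTerm η p) = 1 := by
  have hu : η - S.center l ≠ 0 := sub_ne_zero.mpr (S.ne_center_of_mem_circle hη)
  have hn := S.conj_sub_of_mem_circle hη
  have hu' : conj (η - S.center l) ≠ 0 := (map_ne_zero _).mpr hu
  induction p using OnePoint.rec with
  | infty => rw [T_infty, cauchyTerm_infty, cauchyTerm_coe, mul_inv_cancel₀ hu]; simp
  | coe z =>
    by_cases hz : z = S.center l
    · subst hz
      rw [T_center, cauchyTerm_infty, cauchyTerm_coe, mul_inv_cancel₀ hu]; simp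
    · have hzη : η - z ≠ 0 := sub_ne_zero.mpr fun h => hp (by rw [h])
      have hv : z - S.center l ≠ 0 := sub_ne_zero.mpr hz
      rw [S.T_coe_of_ne l hz, cauchyTerm_coe, cauchyTerm_coe, ← hn, map_mul, map_inv₀]
      set u := η - S.center l with hu_def
      set v := z - S.center l with hv_def
      have hη' : η = S.center l + u := by simp [u]
      have hv' : conj v ≠ 0 := (map_ne_zero _).mpr hv
      have h1 : η - z = u - v := by simp [u, v]
      rw [h1] at hzη ⊢
      rw [hη']
      clear_value u v
      -- On the circle `r² = u ū`, so `η - T_l z = u(v̄ - ū)/v̄`. The two terms of the identity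
      -- become `v̄/(v̄ - ū)` and `-ū/(v̄ - ū)`.
      have h2 : S.center l + u - (S.center l + u * conj u / conj v) =
          u * (conj v - conj u) / conj v := by
        field_simp
        ring
      have h3 : conj v - conj u ≠ 0 := by
        rw [← map_sub, ← neg_sub]; exact (map_ne_zero _).mpr (neg_ne_zero.mpr hzη)
      have h4 : conj u - conj v = -(conj v - conj u) := by ring
      rw [h2, map_sub, h4]
      field_simp
      ring

theorem eventually_mem_circle {l : Fin n} {η : ℂ} (hη : η ∈ S.circle l) :
    ∀ᶠ η' in 𝓝[S.contour] η, η' ∈ S.circle l := by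
  have h1 : ∀ᶠ η' in 𝓝 η, ∀ j, j ≠ l → η' ∉ S.circle j := by
    rw [eventually_all]
    intro j
    by_cases hj : j = l
    · exact Eventually.of_forall fun _ h => absurd hj h
    · have h2 : η ∉ S.circle j := fun h => (S.dist_of_mem_circle_ne (Ne.symm hj) hη).ne' h
      filter_upwards [(Metric.isClosed_sphere).isOpen_compl.mem_nhds h2] with η' hη' _ using hη'
  filter_upwards [nhdsWithin_le_nhds h1, self_mem_nhdsWithin] with η' h2 h3
  obtain ⟨j, hj⟩ := Set.mem_iUnion.mp h3
  by_cases hjl : j = l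
  · exact hjl ▸ hj
  · exact absurd hj (h2 j hjl)

/-- Two antipodal points cannot both equal `η`. The point found serves as a fixed point of `T_j` at
which the kernel is not singular at `η`. -/
theorem exists_mem_circle_ne (j : Fin n) (η : ℂ) : ∃ m ∈ S.circle j, m ≠ η := by
  have h0 := S.radius_pos j
  have h1 : S.center j + S.radius j ∈ S.circle j := by
    simp [circle, abs_of_pos h0]
  have h2 : S.center j - S.radius j ∈ S.circle j := by
    simp [circle, abs_of_pos h0]
  by_cases h : S.center j + S.radius j = η
  · refine ⟨_, h2, fun h3 => ?_⟩
    have h4 : (S.radius j : ℂ) = 0 := by linear_combination (h - h3) / 2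
    exact h0.ne' (by exact_mod_cast h4)
  · exact ⟨_, h1, h⟩

theorem eventually_coe_ne {p : OnePoint ℂ} {η : ℂ} (hp : p ≠ (η : OnePoint ℂ)) :
    ∀ᶠ η' : ℂ in 𝓝 η, p ≠ (η' : OnePoint ℂ) := by
  induction p using OnePoint.rec with
  | infty => exact Eventually.of_forall fun η' => OnePoint.infty_ne_coe η'
  | coe z =>
    have : η ≠ z := fun h => hp (by rw [h])
    filter_upwards [eventually_ne_nhds this] with η' h h'
    exact h (OnePoint.coe_injective h').symm

theorem continuousAt_cauchyTerm {p : OnePoint ℂ} {η : ℂ} (hp : p ≠ (η : OnePoint ℂ)) :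
    ContinuousAt (fun η => cauchyTerm η p) η := by
  induction p using OnePoint.rec with
  | infty => exact continuousAt_const
  | coe z =>
    have : η - z ≠ 0 := sub_ne_zero.mpr fun h => hp (by rw [h])
    simp only [cauchyTerm_coe]
    exact ContinuousAt.inv₀ (by fun_prop) this

theorem ne_of_mem_exterior {p : OnePoint ℂ} (hp : p ∈ S.exterior) {η : ℂ} (hη : η ∈ S.contour) :
    p ≠ (η : OnePoint ℂ) := by
  rintro rfl
  exact S.notMem_contour_of_mem_exteriorPlane (S.coe_mem_exterior.mp hp) hη

variable [NeZero n]

theorem kernelTerm_add (m q p : OnePoint ℂ) (η : ℂ) (σ : S.group) :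
    S.kernelTerm m q η σ + S.kernelTerm q p η σ = S.kernelTerm m p η σ := by
  simp only [kernelTerm]; ring

variable {S} in
theorem kernel_add {m q p : OnePoint ℂ} {η : ℂ} (h1 : Summable (S.kernelTerm m q η))
    (h2 : Summable (S.kernelTerm q p η)) :
    S.kernel m q η + S.kernel q p η = S.kernel m p η := by
  rw [kernel, kernel, kernel, ← h1.tsum_add h2]
  simp only [kernelTerm_add]

variable {S} in
theorem summable_kernelTerm_trans {m q p : OnePoint ℂ} {η : ℂ}
    (h1 : Summable (S.kernelTerm m q η)) (h2 : Summable (S.kernelTerm q p η)) :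
    Summable (S.kernelTerm m p η) :=
  (h1.add h2).congr fun σ => S.kernelTerm_add m q p η σ

/-- Moving both points by the same group element only permutes the series; quasiautomorphy of the
kernel comes from this and the telescoping `kernel_add`. -/
theorem kernelTerm_smul (σ : S.group) (q p : OnePoint ℂ) (η : ℂ) :
    S.kernelTerm ((σ : Equiv.Perm (OnePoint ℂ)) q) ((σ : Equiv.Perm (OnePoint ℂ)) p) η =
      S.kernelTerm q p η ∘ Equiv.mulRight σ := by
  ext τ; simp [kernelTerm]

theorem kernel_smul (σ : S.group) (q p : OnePoint ℂ) (η : ℂ) :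
    S.kernel ((σ : Equiv.Perm (OnePoint ℂ)) q) ((σ : Equiv.Perm (OnePoint ℂ)) p) η =
      S.kernel q p η := by
  rw [kernel, kernelTerm_smul]
  exact (Equiv.mulRight σ).tsum_eq _

theorem summable_kernelTerm_smul (σ : S.group) {q p : OnePoint ℂ} {η : ℂ} :
    Summable (S.kernelTerm ((σ : Equiv.Perm (OnePoint ℂ)) q) ((σ : Equiv.Perm (OnePoint ℂ)) p) η) ↔
      Summable (S.kernelTerm q p η) := by
  rw [kernelTerm_smul]
  exact (Equiv.mulRight σ).summable_iff

variable {S} in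
-- Write `σ T_0 = T_l (T_l σ T_0)`: the inner factor runs through the group, and `T_l` acts on the
-- Cauchy term by `mul_cauchyTerm_T`. The constant `1` in that identity cancels between `p` and `q`.
theorem kernelTerm_T {l : Fin n} {η : ℂ} (hη : η ∈ S.circle l) {q p : OnePoint ℂ}
    (hp : ∀ σ ∈ S.group, σ p ≠ (η : OnePoint ℂ)) (hq : ∀ σ ∈ S.group, σ q ≠ (η : OnePoint ℂ)) :
    S.kernelTerm (S.T 0 q) (S.T 0 p) η = fun σ =>
      -(conj ((η - S.center l) * S.kernelTerm q p η (S.twist l 0 σ)) / (η - S.center l)) := by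
  have hu : η - S.center l ≠ 0 := sub_ne_zero.mpr (S.ne_center_of_mem_circle hη)
  ext σ
  have h1 : ∀ p, (σ : Equiv.Perm (OnePoint ℂ)) (S.T 0 p) =
      S.T l ((S.twist l 0 σ : Equiv.Perm (OnePoint ℂ)) p) := fun p => by simp [twist]
  have h2 := S.mul_cauchyTerm_T hη (hp _ (S.twist l 0 σ).2)
  have h3 := S.mul_cauchyTerm_T hη (hq _ (S.twist l 0 σ).2)
  simp only [kernelTerm, h1]
  rw [← neg_div, eq_div_iff hu, mul_sub (η - S.center l), map_sub]
  linear_combination h2 - h3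

variable {S} in
theorem summable_kernelTerm_T {l : Fin n} {η : ℂ} (hη : η ∈ S.circle l) {q p : OnePoint ℂ}
    (hp : ∀ σ ∈ S.group, σ p ≠ (η : OnePoint ℂ)) (hq : ∀ σ ∈ S.group, σ q ≠ (η : OnePoint ℂ))
    (h : Summable (S.kernelTerm q p η)) : Summable (S.kernelTerm (S.T 0 q) (S.T 0 p) η) := by
  rw [kernelTerm_T hη hp hq]
  refine Summable.neg (Summable.div_const ?_ _)
  exact (Complex.conjCLE.summable).mpr
    (((S.twist l 0).summable_iff.mpr h).mul_left (η - S.center l))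

variable {S} in
theorem kernel_T {l : Fin n} {η : ℂ} (hη : η ∈ S.circle l) {q p : OnePoint ℂ}
    (hp : ∀ σ ∈ S.group, σ p ≠ (η : OnePoint ℂ)) (hq : ∀ σ ∈ S.group, σ q ≠ (η : OnePoint ℂ)) :
    S.kernel (S.T 0 q) (S.T 0 p) η =
      -(conj ((η - S.center l) * S.kernel q p η) / (η - S.center l)) := by
  rw [kernel, kernelTerm_T hη hp hq, tsum_neg, tsum_div_const, ← Complex.conj_tsum, tsum_mul_left,
    (S.twist l 0).tsum_eq (S.kernelTerm q p η)]
  rfl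

/-- The differences `1/(η - σ(p)) - 1/(η - σ(q))` are summable near `η` in `𝔏`, with a sum which is
continuous at `η`. -/
def Related (η : ℂ) (q p : OnePoint ℂ) : Prop :=
  (∀ᶠ η' in 𝓝[S.contour] η, Summable (S.kernelTerm q p η')) ∧
    ContinuousWithinAt (S.kernel q p) S.contour η

namespace Related

variable {S} {η : ℂ} {m q p : OnePoint ℂ}

theorem refl (η : ℂ) (p : OnePoint ℂ) : S.Related η p p := by
  have : ∀ η', S.kernelTerm p p η' = 0 := fun η' => by ext σ; simp [kernelTerm]
  refine ⟨Eventually.of_forall fun η' => by rw [this]; exact summable_zero, ?_⟩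
  have h : S.kernel p p = fun _ => 0 := by ext η'; simp [kernel, this]
  rw [h]
  exact continuousWithinAt_const

theorem symm (h : S.Related η q p) : S.Related η p q := by
  have : ∀ η', S.kernelTerm p q η' = fun σ => -S.kernelTerm q p η' σ := fun η' => by
    ext σ; simp [kernelTerm]
  refine ⟨h.1.mono fun η' h' => by rw [this]; exact h'.neg, ?_⟩
  have h2 : S.kernel p q = fun η' => -S.kernel q p η' := by
    ext η'; simp only [kernel, this, tsum_neg]
  rw [h2]
  exact h.2.neg

theorem trans (h1 : S.Related η m q) (h2 : S.Related η q p) (hη : η ∈ S.contour) :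
    S.Related η m p := by
  have h3 : ∀ᶠ η' in 𝓝[S.contour] η, S.kernel m p η' = S.kernel m q η' + S.kernel q p η' := by
    filter_upwards [h1.1, h2.1] with η' h h' using (kernel_add h h').symm
  refine ⟨?_, (h1.2.add h2.2).congr_of_eventuallyEq h3 (h3.self_of_nhdsWithin hη)⟩
  filter_upwards [h1.1, h2.1] with η' h h' using summable_kernelTerm_trans h h'

theorem smul (σ : Equiv.Perm (OnePoint ℂ)) (hσ : σ ∈ S.group) (h : S.Related η q p) :
    S.Related η (σ q) (σ p) := by
  lift σ to S.group using hσ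
  refine ⟨h.1.mono fun η' h' => (S.summable_kernelTerm_smul σ).mpr h', ?_⟩
  have : S.kernel ((σ : Equiv.Perm (OnePoint ℂ)) q) ((σ : Equiv.Perm (OnePoint ℂ)) p) =
      S.kernel q p := funext fun η' => S.kernel_smul σ q p η'
  rw [this]
  exact h.2

theorem T (h : S.Related η q p) (hη : η ∈ S.contour)
    (hp : ∀ᶠ η' : ℂ in 𝓝[S.contour] η, ∀ σ ∈ S.group, σ p ≠ (η' : OnePoint ℂ))
    (hq : ∀ᶠ η' : ℂ in 𝓝[S.contour] η, ∀ σ ∈ S.group, σ q ≠ (η' : OnePoint ℂ)) :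
    S.Related η (S.T 0 q) (S.T 0 p) := by
  obtain ⟨l, hl⟩ := Set.mem_iUnion.mp hη
  have hu : η - S.center l ≠ 0 := sub_ne_zero.mpr (S.ne_center_of_mem_circle hl)
  have h1 := S.eventually_mem_circle hl
  refine ⟨?_, ?_⟩
  · filter_upwards [h1, hp, hq, h.1] with η' h1 hp hq h using summable_kernelTerm_T h1 hp hq h
  · have h2 : ∀ᶠ η' in 𝓝[S.contour] η, S.kernel (S.T 0 q) (S.T 0 p) η' =
        -(conj ((η' - S.center l) * S.kernel q p η') / (η' - S.center l)) := by
      filter_upwards [h1, hp, hq] with η' h1 hp hq using kernel_T h1 hp hq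
    refine ContinuousWithinAt.congr_of_eventuallyEq ?_ h2 (h2.self_of_nhdsWithin hη)
    have h3 : ContinuousWithinAt (fun η' => η' - S.center l) S.contour η := by fun_prop
    exact ((Complex.continuous_conj.continuousAt.comp_continuousWithinAt
      (h3.mul h.2)).div h3 hu).neg

theorem summable (h : S.Related η q p) (hη : η ∈ S.contour) : Summable (S.kernelTerm q p η) :=
  h.1.self_of_nhdsWithin hη

end Related

namespace KernelBound

variable {S} {δ : ℝ} {b : S.group → ℝ} {P : S.group → ℂ} (hb : S.KernelBound δ b P)
include hb

theorem apply_ne {p : OnePoint ℂ} (hp : p ∈ S.collar (δ / 2)) {η : ℂ} (hη : η ∈ S.contour)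
    (hpη : p ≠ (η : OnePoint ℂ)) {σ : Equiv.Perm (OnePoint ℂ)} (hσ : σ ∈ S.group) :
    σ p ≠ (η : OnePoint ℂ) := by
  have h0 := hb.margin.pos
  by_cases h1 : σ = 1
  · simpa [h1] using hpη
  · obtain ⟨i, hi⟩ := hb.margin.maps σ hσ h1
    obtain ⟨z, hz, hzi⟩ := hi p (S.collar_mono (by linarith) hp)
    rw [hzi]
    intro h
    have h2 := isMargin_dist hb.margin hz hη
    rw [OnePoint.coe_injective h, sub_self, norm_zero] at h2
    linarith

theorem eventually_apply_ne {p : OnePoint ℂ} (hp : p ∈ S.collar (δ / 2)) {η : ℂ}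
    (hpη : p ≠ (η : OnePoint ℂ)) :
    ∀ᶠ η' : ℂ in 𝓝[S.contour] η, ∀ σ ∈ S.group, σ p ≠ (η' : OnePoint ℂ) := by
  filter_upwards [self_mem_nhdsWithin, nhdsWithin_le_nhds (eventually_coe_ne hpη)]
    with η' h1 h2 σ hσ using hb.apply_ne hp h1 h2 hσ

theorem related {q p : OnePoint ℂ} (hq : q ∈ S.collar (δ / 2)) (hp : p ∈ S.collar (δ / 2)) {η : ℂ}
    (hη : η ∈ S.contour) (hqη : q ≠ (η : OnePoint ℂ)) (hpη : p ≠ (η : OnePoint ℂ)) :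
    S.Related η q p := by
  refine ⟨?_, ?_⟩
  · filter_upwards [self_mem_nhdsWithin] with η' h using hb.summable_kernelTerm h hp hq
  · refine ContinuousWithinAt.congr ?_ (fun η' h => hb.kernel_eq h hp hq) (hb.kernel_eq hη hp hq)
    exact ((continuousAt_cauchyTerm hpη).sub (continuousAt_cauchyTerm hqη)).continuousWithinAt.add
      (hb.continuousOn_regKernel hp hq η hη)

/-- `T_0 p` may leave the collar, where no direct estimate exists. The chain runs through a point `m
= T_0 m` of the circle `0`: `q` is related to `m`, and reflecting the relation between `m` and `p`
relates `m` to `T_0 p`. -/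
theorem related_T {q p : OnePoint ℂ} (hq : q ∈ S.collar (δ / 2)) (hp : p ∈ S.collar (δ / 2)) {η : ℂ}
    (hη : η ∈ S.contour) (hqη : q ≠ (η : OnePoint ℂ)) (hpη : p ≠ (η : OnePoint ℂ)) :
    S.Related η q (S.T 0 p) := by
  have h0 := hb.margin.pos
  obtain ⟨m, hm, hmη⟩ := S.exists_mem_circle_ne 0 η
  have hmη' : (m : OnePoint ℂ) ≠ (η : OnePoint ℂ) := fun h => hmη (OnePoint.coe_injective h)
  have hmc := S.contour_subset_collar (δ := δ / 2) (by linarith) (S.circle_subset_contour 0 hm)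
  have h1 := (hb.related hmc hp hη hmη' hpη).T hη (hb.eventually_apply_ne hp hpη)
    (hb.eventually_apply_ne hmc hmη')
  rw [S.T_of_mem_circle hm] at h1
  exact (hb.related hq hmc hη hqη hmη').trans h1 hη

/-- For a generator, take `m` on the `j`-th circle, so that `σ_j(T_0 m) = T_j m = m`. Applying `σ_j`
to the relation between `p` and `T_0 m` relates `σ_j p` to `m`, and `m` is related to `p`. The
relation is transitive and invariant under the group, so products and inverses follow. -/
theorem related_apply {p : OnePoint ℂ} (hp : p ∈ S.collar (δ / 2)) {η : ℂ}
    (hη : η ∈ S.contour) (hpη : p ≠ (η : OnePoint ℂ)) {σ : Equiv.Perm (OnePoint ℂ)}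
    (hσ : σ ∈ S.group) : S.Related η p (σ p) := by
  have h0 := hb.margin.pos
  have hσ' : σ ∈ Subgroup.closure (Set.range S.gen) := hσ
  clear hσ
  induction hσ' using Subgroup.closure_induction with
  | mem σ hσ =>
    obtain ⟨j, rfl⟩ := hσ
    obtain ⟨m, hm, hmη⟩ := S.exists_mem_circle_ne j η
    have hmη' : (m : OnePoint ℂ) ≠ (η : OnePoint ℂ) := fun h => hmη (OnePoint.coe_injective h)
    have hmc := S.contour_subset_collar (δ := δ / 2) (by linarith) (S.circle_subset_contour j hm)
    have h1 := (hb.related_T hp hmc hη hpη hmη').smul (S.gen j) (S.gen_mem j)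
    have h2 : S.gen j (S.T 0 m) = (m : OnePoint ℂ) := by
      rw [gen, Equiv.Perm.mul_apply, T_T, S.T_of_mem_circle hm]
    rw [h2] at h1
    exact (hb.related hp hmc hη hpη hmη').trans h1.symm hη
  | one => exact Related.refl η p
  | mul σ τ hσ hτ h1 h2 => exact h1.trans (h2.smul σ hσ) hη
  | inv σ hσ h =>
    have h1 := (h.smul σ⁻¹ (inv_mem hσ)).symm
    rwa [← Equiv.Perm.mul_apply, inv_mul_cancel, Equiv.Perm.one_apply] at h1

theorem mem_collar_of_mem_exterior {p : OnePoint ℂ} (hp : p ∈ S.exterior) :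
    p ∈ S.collar (δ / 2) :=
  S.exterior_subset_collar (by linarith [hb.margin.pos]) hp

end KernelBound

/-- The orbit of `p` avoids the circles, and the kernel `𝒦(p, η)` is continuous in `η ∈ 𝔏`. -/
structure Regular (zs p : OnePoint ℂ) : Prop where
  ne : ∀ η ∈ S.contour, ∀ σ ∈ S.group, σ p ≠ (η : OnePoint ℂ)
  related : ∀ η ∈ S.contour, S.Related η zs p

variable {S} {zs p : OnePoint ℂ}

theorem Regular.summable (h : S.Regular zs p) {η : ℂ} (hη : η ∈ S.contour) :
    Summable (S.kernelTerm zs p η) := (h.related η hη).summable hη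

theorem Regular.continuousOn (h : S.Regular zs p) : ContinuousOn (S.kernel zs p) S.contour :=
  fun η hη => (h.related η hη).2

namespace KernelBound

variable {δ : ℝ} {b : S.group → ℝ} {P : S.group → ℂ} (hb : S.KernelBound δ b P)
  (hzs : zs ∈ S.exterior)
include hb hzs

theorem regular_of_mem_collar (hp : p ∈ S.collar (δ / 2))
    (hpc : ∀ η ∈ S.contour, p ≠ (η : OnePoint ℂ)) : S.Regular zs p :=
  ⟨fun η hη _ hσ => hb.apply_ne hp hη (hpc η hη) hσ, fun η hη =>
    hb.related (hb.mem_collar_of_mem_exterior hzs) hp hη (S.ne_of_mem_exterior hzs hη) (hpc η hη)⟩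

theorem regular_of_mem_exterior (hp : p ∈ S.exterior) : S.Regular zs p :=
  hb.regular_of_mem_collar hzs (hb.mem_collar_of_mem_exterior hp)
    fun _ hη => S.ne_of_mem_exterior hp hη

theorem regular_smul (h : S.Regular zs p) {σ : Equiv.Perm (OnePoint ℂ)} (hσ : σ ∈ S.group) :
    S.Regular zs (σ p) :=
  ⟨fun η hη τ hτ => h.ne η hη (τ * σ) (mul_mem hτ hσ), fun η hη =>
    (hb.related_apply (hb.mem_collar_of_mem_exterior hzs) hη (S.ne_of_mem_exterior hzs hη) hσ).trans
      ((h.related η hη).smul σ hσ) hη⟩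

theorem regular_T (h : S.Regular zs p) : S.Regular zs (S.T 0 p) := by
  refine ⟨fun η hη σ hσ h1 => ?_, fun η hη => ?_⟩
  · obtain ⟨l, hl⟩ := Set.mem_iUnion.mp hη
    refine h.ne η hη _ (S.T_mul_mul_T_mem l 0 hσ) ?_
    rw [Equiv.Perm.mul_apply, Equiv.Perm.mul_apply, h1, S.T_of_mem_circle hl]
  · have hz := hb.mem_collar_of_mem_exterior hzs
    have hzη := S.ne_of_mem_exterior hzs hη
    refine (hb.related_T hz hz hη hzη hzη).trans ((h.related η hη).T hη ?_
      (hb.eventually_apply_ne hz hzη)) hη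
    filter_upwards [self_mem_nhdsWithin] with η' h' using h.ne η' h'

theorem regular_of_mem_offCircles (hp : p ∈ S.offCircles) : S.Regular zs p := by
  obtain ⟨σ, hσ, q, hq | hq, rfl⟩ := hp
  · exact hb.regular_smul hzs (hb.regular_of_mem_exterior hzs hq) hσ
  · have := hb.regular_T hzs (hb.regular_of_mem_exterior hzs hq)
    rw [T_T] at this
    exact hb.regular_smul hzs this hσ

theorem summable_kernelTerm_base {η : ℂ} (hη : η ∈ S.contour) {σ : Equiv.Perm (OnePoint ℂ)}
    (hσ : σ ∈ S.group) : Summable (S.kernelTerm zs (σ zs) η) :=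
  (hb.related_apply (hb.mem_collar_of_mem_exterior hzs) hη (S.ne_of_mem_exterior hzs hη)
    hσ).summable hη

/-- Quasiautomorphy of the kernel. -/
theorem kernel_apply {η : ℂ} (hη : η ∈ S.contour) (hp : Summable (S.kernelTerm zs p η))
    {σ : Equiv.Perm (OnePoint ℂ)} (hσ : σ ∈ S.group) :
    S.kernel zs (σ p) η = S.kernel zs p η + S.kernel zs (σ zs) η := by
  have h1 := hb.summable_kernelTerm_base hzs hη hσ
  lift σ to S.group using hσ
  have h2 := (S.summable_kernelTerm_smul σ).mpr hp
  rw [← kernel_add h1 h2, kernel_smul, add_comm]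

/-- Symmetry of the kernel. -/
theorem kernel_T {l : Fin n} {η : ℂ} (hη : η ∈ S.circle l) (hp : S.Regular zs p) :
    (η - S.center l) * (S.kernel zs (S.T 0 p) η - S.kernel zs (S.T 0 zs) η) =
      -conj ((η - S.center l) * S.kernel zs p η) := by
  have hηc := S.circle_subset_contour l hη
  have hu : η - S.center l ≠ 0 := sub_ne_zero.mpr (S.ne_center_of_mem_circle hη)
  have hz := hb.regular_of_mem_exterior hzs hzs
  have hz' := hb.regular_T hzs hz
  have h1 := CircleSystem.kernel_T hη (hp.ne η hηc) (hz.ne η hηc)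
  have h2 := summable_kernelTerm_T hη (hp.ne η hηc) (hz.ne η hηc) (hp.summable hηc)
  rw [← kernel_add (hz'.summable hηc) h2, add_sub_cancel_left, h1]
  field_simp

/-- Points `η` in the orbit of `ζ` are included: in a singular term the inverse of zero is `0`,
which does not affect summability. -/
theorem summable_of_mem_Omega {ζ : OnePoint ℂ} (hζ : ζ ∈ S.Omega) {η : ℂ} (hη : η ∈ S.contour) :
    Summable (S.kernelTerm zs ζ η) := by
  rcases hζ with hζ | ⟨σ, hσ, z, hz, rfl⟩
  · exact (hb.regular_of_mem_offCircles hzs hζ).summable hη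
  · have h1 := hb.summable_kernelTerm_base hzs hη hσ
    lift σ to S.group using hσ
    exact summable_kernelTerm_trans h1 ((S.summable_kernelTerm_smul σ).mpr
      (hb.summable_kernelTerm hη (S.contour_subset_collar (by linarith [hb.margin.pos]) hz)
        (hb.mem_collar_of_mem_exterior hzs)))

theorem continuousOn_kernel_of_mem_Omega {ζ : OnePoint ℂ} (hζ : ζ ∈ S.Omega) :
    ContinuousOn (S.kernel zs ζ)
      {η | η ∈ S.contour ∧ ∀ σ ∈ S.group, σ ζ ≠ (η : OnePoint ℂ)} := by
  rcases hζ with hζ | ⟨σ, hσ, z, hz, rfl⟩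
  · exact (hb.regular_of_mem_offCircles hzs hζ).continuousOn.mono fun η h => h.1
  · rintro η ⟨hη, h⟩
    have hzη : (z : OnePoint ℂ) ≠ (η : OnePoint ℂ) := by
      have := h σ⁻¹ (inv_mem hσ)
      rwa [← Equiv.Perm.mul_apply, inv_mul_cancel, Equiv.Perm.one_apply] at this
    have hc := hb.mem_collar_of_mem_exterior hzs
    have hne := S.ne_of_mem_exterior hzs hη
    exact ((hb.related_apply hc hη hne hσ).trans ((hb.related hc (S.contour_subset_collar
      (by linarith [hb.margin.pos]) hz) hη hne hzη).smul σ hσ) hη).2.mono fun η h => h.1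

end KernelBound

end Kernel

end CircleSystem

end CircularRH

end

noncomputable section

namespace CircularRH

/-! ### Cauchy integrals over a circle -/

section Circle

open MeasureTheory Metric

variable {c : ℂ} {r : ℝ}

theorem norm_deriv_circleMap (hr : 0 < r) (θ : ℝ) : ‖deriv (circleMap c r) θ‖ = r := by
  simp [deriv_circleMap, circleMap, abs_of_pos hr]

theorem continuous_deriv_circleMap (c : ℂ) (r : ℝ) : Continuous (deriv (circleMap c r)) := by
  have : deriv (circleMap c r) = fun θ => circleMap 0 r θ * Complex.I :=
    funext fun θ => deriv_circleMap c r θ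
  rw [this]
  exact (continuous_circleMap 0 r).mul continuous_const

theorem continuous_comp_circleMap (hr : 0 < r) {f : ℂ → ℂ} (hf : ContinuousOn f (sphere c r)) :
    Continuous fun θ => f (circleMap c r θ) :=
  hf.comp_continuous (continuous_circleMap c r) fun θ => circleMap_mem_sphere c hr.le θ

theorem norm_circleIntegral_le_of_sphere {f : ℂ → ℂ} {M : ℝ} (hr : 0 < r)
    (hf : ∀ η ∈ sphere c r, ‖f η‖ ≤ M) : ‖∮ η in C(c, r), f η‖ ≤ 2 * Real.pi * r * M :=
  circleIntegral.norm_integral_le_of_norm_le_const hr.le hf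

/-- Dominated convergence on a circle, with one exceptional point. -/
theorem tendsto_circleIntegral_of_dominated (hr : 0 < r) {ι : Type*} {l : Filter ι}
    [l.IsCountablyGenerated] {F : ι → ℂ → ℂ} {f : ℂ → ℂ} {M : ℝ} (ξ : ℂ)
    (hm : ∀ᶠ i in l, Measurable fun θ => F i (circleMap c r θ))
    (hb : ∀ᶠ i in l, ∀ η ∈ sphere c r, ‖F i η‖ ≤ M)
    (hlim : ∀ η ∈ sphere c r, η ≠ ξ → Tendsto (fun i => F i η) l (𝓝 (f η))) :
    Tendsto (fun i => ∮ η in C(c, r), F i η) l (𝓝 (∮ η in C(c, r), f η)) := by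
  unfold circleIntegral
  refine intervalIntegral.tendsto_integral_filter_of_dominated_convergence (fun _ => r * M) ?_ ?_
    (by simp) ?_
  · filter_upwards [hm] with i hi
    exact ((continuous_deriv_circleMap c r).measurable.mul hi).aestronglyMeasurable
  · filter_upwards [hb] with i hi
    refine Eventually.of_forall fun θ _ => ?_
    rw [norm_smul, norm_deriv_circleMap hr]
    exact mul_le_mul_of_nonneg_left (hi _ (circleMap_mem_sphere c hr.le θ)) hr.le
  · have h1 : ∀ᵐ θ : ℝ, circleMap c r θ ≠ ξ := by
      have := ((Set.countable_singleton ξ).preimage_circleMap c hr.ne').measure_zero volume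
      rw [ae_iff]
      convert this using 2
      ext θ; simp
    filter_upwards [h1] with θ hθ _
    exact (hlim _ (circleMap_mem_sphere c hr.le θ) hθ).const_smul _

theorem exists_norm_le_of_continuousOn_sphere {f : ℂ → ℂ} (hf : ContinuousOn f (sphere c r)) :
    ∃ M, 0 ≤ M ∧ ∀ η ∈ sphere c r, ‖f η‖ ≤ M := by
  obtain ⟨M, hM⟩ := (isCompact_sphere c r).exists_bound_of_continuousOn hf
  exact ⟨max M 0, le_max_right _ _, fun η hη => (hM η hη).trans (le_max_left _ _)⟩

theorem measurableSet_lt_dist_circleMap (c : ℂ) (r ε : ℝ) (ξ : ℂ) :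
    MeasurableSet {θ | ε < dist (circleMap c r θ) ξ} :=
  measurableSet_lt measurable_const
    ((continuous_circleMap c r).dist continuous_const).measurable

theorem tendsto_ite_lt_dist {η ξ : ℂ} (h : η ≠ ξ) (v : ℂ) :
    Tendsto (fun ε : ℝ => if ε < dist η ξ then v else 0) (𝓝[>] 0) (𝓝 v) := by
  refine tendsto_const_nhds.congr' ?_
  have : ∀ᶠ ε : ℝ in 𝓝 0, ε < dist η ξ := eventually_lt_nhds (dist_pos.mpr h)
  filter_upwards [nhdsWithin_le_nhds this] with ε hε
  rw [if_pos hε]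

/-- Truncated integrals of a continuous function converge. -/
theorem tendsto_circleIntegral_truncate (hr : 0 < r) {f : ℂ → ℂ} {M : ℝ} (ξ : ℂ)
    (hf : Measurable fun θ => f (circleMap c r θ)) (hM : ∀ η ∈ sphere c r, ‖f η‖ ≤ M) :
    Tendsto (fun ε : ℝ => ∮ η in C(c, r), if ε < dist η ξ then f η else 0) (𝓝[>] 0)
      (𝓝 (∮ η in C(c, r), f η)) := by
  refine tendsto_circleIntegral_of_dominated hr (M := M) ξ (Eventually.of_forall fun ε => ?_)
    (Eventually.of_forall fun ε η hη => ?_) fun η _ hne => tendsto_ite_lt_dist hne _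
  · exact Measurable.ite (measurableSet_lt_dist_circleMap c r ε ξ) hf measurable_const
  · split_ifs
    · exact hM η hη
    · rw [norm_zero]; exact (norm_nonneg _).trans (hM η hη)

/-- Holomorphic dependence of a circle integral on a parameter. -/
theorem differentiableAt_circleIntegral (hr : 0 < r) {F : ℂ → ℂ → ℂ} {z₀ : ℂ} {s : Set ℂ}
    (hs : s ∈ 𝓝 z₀) {C : ℝ} (hC : 0 ≤ C) (hcont : ∀ z ∈ s, ContinuousOn (F z) (sphere c r))
    (hlip : ∀ η ∈ sphere c r, ∀ z ∈ s, ∀ z' ∈ s, ‖F z η - F z' η‖ ≤ C * ‖z - z'‖)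
    (hdiff : ∀ η ∈ sphere c r, DifferentiableAt ℂ (fun z => F z η) z₀) :
    DifferentiableAt ℂ (fun z => ∮ η in C(c, r), F z η) z₀ := by
  have hmem : ∀ θ, circleMap c r θ ∈ sphere c r := circleMap_mem_sphere c hr.le
  have hc : ∀ z ∈ s, Continuous fun θ => deriv (circleMap c r) θ • F z (circleMap c r θ) :=
    fun z hz => (continuous_deriv_circleMap c r).smul (continuous_comp_circleMap hr (hcont z hz))
  obtain ⟨ε, hε, hεs⟩ := Metric.mem_nhds_iff.mp hs
  have hder : ∀ θ, HasDerivAt (fun z => deriv (circleMap c r) θ • F z (circleMap c r θ))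
      (deriv (circleMap c r) θ • deriv (fun z => F z (circleMap c r θ)) z₀) z₀ :=
    fun θ => by
      simp only [smul_eq_mul]
      exact (hdiff _ (hmem θ)).hasDerivAt.const_mul _
  -- The sequence `t k → 0` serves only to show that the derivative is measurable in `θ`, as a
  -- pointwise limit of difference quotients. The shift by `2` keeps `z₀ + t k` strictly inside the
  -- ball of radius `ε`.
  set t : ℕ → ℂ := fun k => ((ε / (k + 2) : ℝ) : ℂ)
  have ht0 : ∀ k, t k ≠ 0 := fun k => by
    simp only [t]
    exact_mod_cast (by positivity : ε / ((k : ℝ) + 2) ≠ 0)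
  have hts : ∀ k, z₀ + t k ∈ s := fun k => hεs <| by
    rw [mem_ball, dist_eq_norm, add_sub_cancel_left, Complex.norm_real,
      Real.norm_of_nonneg (by positivity), div_lt_iff₀ (by positivity)]
    nlinarith [hε, (k.cast_nonneg : (0 : ℝ) ≤ k)]
  have htlim : Tendsto t atTop (𝓝[≠] 0) := by
    refine tendsto_nhdsWithin_iff.mpr ⟨?_, Eventually.of_forall ht0⟩
    have h1 : Tendsto (fun k : ℕ => ε / ((k : ℝ) + 2)) atTop (𝓝 0) :=
      Tendsto.div_atTop tendsto_const_nhds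
        (tendsto_atTop_add_const_right _ _ tendsto_natCast_atTop_atTop)
    have h2 := (Complex.continuous_ofReal.tendsto 0).comp h1
    rwa [Complex.ofReal_zero] at h2
  refine (intervalIntegral.hasDerivAt_integral_of_dominated_loc_of_lip (bound := fun _ => r * C)
    (F := fun z θ => deriv (circleMap c r) θ • F z (circleMap c r θ))
    hs ?_ ?_ ?_ ?_ (by simp) (Eventually.of_forall fun θ _ => hder θ)).2.differentiableAt
  · filter_upwards [hs] with z hz using (hc z hz).aestronglyMeasurable
  · exact (hc z₀ (mem_of_mem_nhds hs)).intervalIntegrable _ _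
  · refine aestronglyMeasurable_of_tendsto_ae atTop
      (f := fun k θ => (t k)⁻¹ • (deriv (circleMap c r) θ • F (z₀ + t k) (circleMap c r θ) -
        deriv (circleMap c r) θ • F z₀ (circleMap c r θ))) (fun k => ?_)
      (Eventually.of_forall fun θ => ?_)
    · exact ((continuous_const (y := (t k)⁻¹)).smul
        ((hc _ (hts k)).sub (hc _ (mem_of_mem_nhds hs)))).aestronglyMeasurable
    · exact (hder θ).tendsto_slope_zero.comp htlim
  · refine Eventually.of_forall fun θ _ => LipschitzOnWith.of_dist_le_mul fun z hz z' hz' => ?_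
    rw [dist_eq_norm, dist_eq_norm, ← smul_sub, norm_smul, norm_deriv_circleMap hr,
      Real.coe_nnabs, abs_of_nonneg (by positivity), mul_assoc]
    exact mul_le_mul_of_nonneg_left (hlip _ (hmem θ) z hz z' hz') hr.le

/-- Radial projection onto a circle. -/
def radialProj (c : ℂ) (r : ℝ) (ζ : ℂ) : ℂ := c + (r / ‖ζ - c‖ : ℝ) * (ζ - c)

theorem radialProj_mem (hr : 0 < r) {ζ : ℂ} (hζ : ζ ≠ c) : radialProj c r ζ ∈ sphere c r := by
  have h : 0 < ‖ζ - c‖ := norm_pos_iff.mpr (sub_ne_zero.mpr hζ)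
  rw [mem_sphere, dist_eq_norm, radialProj, add_sub_cancel_left, norm_mul, Complex.norm_real,
    Real.norm_of_nonneg (by positivity), div_mul_cancel₀ _ h.ne']

theorem radialProj_of_mem {ξ : ℂ} (hr : 0 < r) (hξ : ξ ∈ sphere c r) : radialProj c r ξ = ξ := by
  rw [mem_sphere, dist_eq_norm] at hξ
  rw [radialProj, hξ, div_self hr.ne']; simp

/-- The radial projection is a nearest point of the circle: its distance from `ζ` is `|‖ζ - c‖ -
r|`, bounded by the reverse triangle inequality. -/
theorem norm_sub_radialProj_le {ζ η : ℂ} (hζ : ζ ≠ c) (hη : η ∈ sphere c r) :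
    ‖ζ - radialProj c r ζ‖ ≤ ‖η - ζ‖ := by
  have h : 0 < ‖ζ - c‖ := norm_pos_iff.mpr (sub_ne_zero.mpr hζ)
  have h1 : ζ - radialProj c r ζ = (((‖ζ - c‖ - r) / ‖ζ - c‖ : ℝ) : ℂ) * (ζ - c) := by
    have h2 : (‖ζ - c‖ : ℂ) ≠ 0 := by exact_mod_cast h.ne'
    rw [radialProj]; push_cast
    field_simp
    ring
  rw [mem_sphere, dist_eq_norm] at hη
  rw [h1, norm_mul, Complex.norm_real, Real.norm_eq_abs, abs_div, abs_of_pos h,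
    div_mul_cancel₀ _ h.ne', ← hη]
  refine (abs_norm_sub_norm_le _ _).trans_eq ?_
  rw [sub_sub_sub_cancel_right, norm_sub_rev]

theorem continuousAt_radialProj {ζ : ℂ} (hζ : ζ ≠ c) : ContinuousAt (radialProj c r) ζ := by
  have h : ‖ζ - c‖ ≠ 0 := norm_ne_zero_iff.mpr (sub_ne_zero.mpr hζ)
  have h1 : ContinuousAt (fun ζ => r / ‖ζ - c‖) ζ := by fun_prop (disch := exact h)
  unfold radialProj
  exact continuousAt_const.add
    ((Complex.continuous_ofReal.continuousAt.comp h1).mul (by fun_prop))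

variable {h : ℂ → ℂ} {K : ℝ}

theorem continuousOn_of_lipschitz {s : Set ℂ}
    (hK : ∀ η ∈ s, ∀ ξ ∈ s, ‖h η - h ξ‖ ≤ K * ‖η - ξ‖) : ContinuousOn h s := by
  have : LipschitzOnWith (Real.toNNReal K) h s := LipschitzOnWith.of_dist_le_mul fun x hx y hy => by
    rw [dist_eq_norm, dist_eq_norm]
    exact (hK x hx y hy).trans (mul_le_mul_of_nonneg_right (Real.le_coe_toNNReal K) (norm_nonneg _))
  exact this.continuousOn

theorem circleIntegral_inv_sub_of_mem_ball {ζ : ℂ} (hζ : ζ ∈ ball c r) :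
    ∮ η in C(c, r), (η - ζ)⁻¹ = 2 * Real.pi * Complex.I :=
  circleIntegral.integral_sub_inv_of_mem_ball hζ

theorem circleIntegral_inv_sub_of_notMem (hr : 0 < r) {ζ : ℂ} (hζ : r < dist ζ c) :
    ∮ η in C(c, r), (η - ζ)⁻¹ = 0 := by
  have hne : ∀ η ∈ closedBall c r, η - ζ ≠ 0 := fun η hη h => by
    rw [sub_eq_zero.mp h, mem_closedBall] at hη
    linarith
  refine DiffContOnCl.circleIntegral_eq_zero hr.le (DifferentiableOn.diffContOnCl ?_)
  rw [closure_ball c hr.ne']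
  intro η hη
  have h1 : DifferentiableAt ℂ (fun η => η - ζ) η := by fun_prop
  exact (h1.inv (hne η hη)).differentiableWithinAt

/-- The part of the Cauchy integral of a Lipschitz density which is continuous across the
circle. -/
theorem tendsto_circleIntegral_sub_radialProj (hr : 0 < r)
    (hK : ∀ η ∈ sphere c r, ∀ ξ ∈ sphere c r, ‖h η - h ξ‖ ≤ K * ‖η - ξ‖) {ξ : ℂ}
    (hξ : ξ ∈ sphere c r) :
    Tendsto (fun ζ => ∮ η in C(c, r), (h η - h (radialProj c r ζ)) * (η - ζ)⁻¹) (𝓝[(sphere c r)ᶜ] ξ)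
      (𝓝 (∮ η in C(c, r), (h η - h ξ) * (η - ξ)⁻¹)) := by
  have hc := continuousOn_of_lipschitz hK
  have hξc : ξ ≠ c := by
    rintro rfl
    rw [mem_sphere, dist_self] at hξ
    exact hr.ne hξ
  have hev : ∀ᶠ ζ in 𝓝[(sphere c r)ᶜ] ξ, ζ ≠ c := nhdsWithin_le_nhds (eventually_ne_nhds hξc)
  have hK0 : 0 ≤ K := by
    have h1 : (2 * c - ξ) ∈ sphere c r := by
      rw [mem_sphere, dist_eq_norm] at hξ ⊢
      rw [← hξ, ← norm_neg]; congr 1; ring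
    have h2 := (norm_nonneg _).trans (hK _ h1 _ hξ)
    have h3 : 0 < ‖2 * c - ξ - ξ‖ := norm_pos_iff.mpr fun h => hξc (by linear_combination -h / 2)
    exact nonneg_of_mul_nonneg_left h2 h3
  refine tendsto_circleIntegral_of_dominated hr (M := K * 2) ξ ?_ ?_ ?_
  · filter_upwards [self_mem_nhdsWithin] with ζ hζ
    have h1 : ContinuousOn (fun η => (η - ζ)⁻¹) (sphere c r) :=
      ContinuousOn.inv₀ (by fun_prop) fun η hη h0 => hζ (sub_eq_zero.mp h0 ▸ hη)
    have h2 : ContinuousOn (fun η => h η - h (radialProj c r ζ)) (sphere c r) :=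
      hc.sub continuousOn_const
    exact (continuous_comp_circleMap hr (h2.mul h1)).measurable
  · filter_upwards [hev] with ζ hζ η hη
    have h1 := hK η hη _ (radialProj_mem hr hζ)
    have h2 := norm_sub_radialProj_le hζ hη
    -- Comparing with the density at the projection of `ζ`, instead of at `ξ`, bounds the integrand
    -- by `2K` uniformly, with no restriction to nontangential approach.
    have h3 : ‖η - radialProj c r ζ‖ ≤ 2 * ‖η - ζ‖ := by
      have := norm_add_le (η - ζ) (ζ - radialProj c r ζ)
      rw [sub_add_sub_cancel] at this
      linarith
    rw [norm_mul, norm_inv]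
    rcases (norm_nonneg (η - ζ)).eq_or_lt with h0 | h0
    · rw [← h0, inv_zero, mul_zero]; positivity
    · rw [← div_eq_mul_inv, div_le_iff₀ h0]
      calc _ ≤ K * ‖η - radialProj c r ζ‖ := h1
        _ ≤ K * (2 * ‖η - ζ‖) := mul_le_mul_of_nonneg_left h3 hK0
        _ = _ := by ring
  · intro η hη hne
    have h1 : Tendsto (radialProj c r) (𝓝[(sphere c r)ᶜ] ξ) (𝓝[sphere c r] ξ) := by
      refine tendsto_nhdsWithin_iff.mpr ⟨?_, hev.mono fun ζ hζ => radialProj_mem hr hζ⟩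
      have := (continuousAt_radialProj (r := r) hξc).tendsto
      rw [radialProj_of_mem hr hξ] at this
      exact this.mono_left nhdsWithin_le_nhds
    have h2 : Tendsto (fun ζ => h (radialProj c r ζ)) (𝓝[(sphere c r)ᶜ] ξ) (𝓝 (h ξ)) :=
      (hc ξ hξ).tendsto.comp h1
    have h3 : Tendsto (fun ζ => (η - ζ)⁻¹) (𝓝[(sphere c r)ᶜ] ξ) (𝓝 (η - ξ)⁻¹) :=
      (tendsto_const_nhds.sub (tendsto_id.mono_left nhdsWithin_le_nhds)).inv₀
        (sub_ne_zero.mpr hne)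
    exact (tendsto_const_nhds.sub h2).mul h3

/-- With `a` the density at the projection of `ζ`, the first integral is continuous across the
circle. The second is `2πi` or `0` according to the side and carries the whole jump. -/
theorem circleIntegral_eq_sub_radialProj (hr : 0 < r) (hc : ContinuousOn h (sphere c r)) {ζ : ℂ}
    (hζ : ζ ∉ sphere c r) (a : ℂ) :
    ∮ η in C(c, r), h η * (η - ζ)⁻¹ = (∮ η in C(c, r), (h η - a) * (η - ζ)⁻¹) +
      a * ∮ η in C(c, r), (η - ζ)⁻¹ := by
  have h1 : ContinuousOn (fun η => (η - ζ)⁻¹) (sphere c r) :=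
    ContinuousOn.inv₀ (by fun_prop) fun η hη h0 => hζ (sub_eq_zero.mp h0 ▸ hη)
  rw [← circleIntegral.integral_const_mul, ← circleIntegral.integral_add]
  · congr 1; ext η; ring
  · exact ((hc.sub continuousOn_const).mul h1).circleIntegrable hr.le
  · exact (continuousOn_const.mul h1).circleIntegrable hr.le

/-- Sokhotski's formula from the inside. -/
theorem tendsto_cauchyIntegral_inner (hr : 0 < r)
    (hK : ∀ η ∈ sphere c r, ∀ ξ ∈ sphere c r, ‖h η - h ξ‖ ≤ K * ‖η - ξ‖) {ξ : ℂ}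
    (hξ : ξ ∈ sphere c r) :
    Tendsto (fun ζ => ∮ η in C(c, r), h η * (η - ζ)⁻¹) (𝓝[ball c r] ξ)
      (𝓝 ((∮ η in C(c, r), (h η - h ξ) * (η - ξ)⁻¹) + 2 * Real.pi * Complex.I * h ξ)) := by
  have hc := continuousOn_of_lipschitz hK
  have hsub : ball c r ⊆ (sphere c r)ᶜ := fun ζ hζ h => (mem_ball.mp hζ).ne h
  have hξc : ξ ≠ c := by
    rintro rfl
    rw [mem_sphere, dist_self] at hξ
    exact hr.ne hξ
  have h1 := (tendsto_circleIntegral_sub_radialProj hr hK hξ).mono_left (nhdsWithin_mono ξ hsub)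
  have h2 : Tendsto (fun ζ => h (radialProj c r ζ)) (𝓝[ball c r] ξ) (𝓝 (h ξ)) := by
    refine (hc ξ hξ).tendsto.comp (tendsto_nhdsWithin_iff.mpr ⟨?_, ?_⟩)
    · have := (continuousAt_radialProj (r := r) hξc).tendsto
      rw [radialProj_of_mem hr hξ] at this
      exact this.mono_left nhdsWithin_le_nhds
    · filter_upwards [nhdsWithin_le_nhds (eventually_ne_nhds hξc)] with ζ hζ
        using radialProj_mem hr hζ
  refine (h1.add (h2.const_mul (2 * Real.pi * Complex.I))).congr' ?_
  filter_upwards [self_mem_nhdsWithin] with ζ hζ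
  rw [circleIntegral_eq_sub_radialProj hr hc (hsub hζ) (h (radialProj c r ζ)),
    circleIntegral_inv_sub_of_mem_ball hζ]
  ring

/-- Sokhotski's formula from the outside. -/
theorem tendsto_cauchyIntegral_outer (hr : 0 < r)
    (hK : ∀ η ∈ sphere c r, ∀ ξ ∈ sphere c r, ‖h η - h ξ‖ ≤ K * ‖η - ξ‖) {ξ : ℂ}
    (hξ : ξ ∈ sphere c r) :
    Tendsto (fun ζ => ∮ η in C(c, r), h η * (η - ζ)⁻¹) (𝓝[{ζ | r < dist ζ c}] ξ)
      (𝓝 (∮ η in C(c, r), (h η - h ξ) * (η - ξ)⁻¹)) := by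
  have hc := continuousOn_of_lipschitz hK
  have hsub : {ζ | r < dist ζ c} ⊆ (sphere c r)ᶜ := fun ζ (hζ : r < dist ζ c) h => hζ.ne' h
  refine ((tendsto_circleIntegral_sub_radialProj hr hK hξ).mono_left
    (nhdsWithin_mono ξ hsub)).congr' ?_
  filter_upwards [self_mem_nhdsWithin] with ζ hζ
  rw [circleIntegral_eq_sub_radialProj hr hc (hsub hζ) (h (radialProj c r ζ)),
    circleIntegral_inv_sub_of_notMem hr hζ, mul_zero, add_zero]

/-- The integral of `dη / (η - ξ)` over the part `|η - ξ| > ε` of the circle. -/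
theorem circleIntegral_truncate_inv (hr : 0 < r) {ξ : ℂ} (hξ : ξ ∈ sphere c r) {ε : ℝ}
    (hε : 0 < ε) :
    ∮ η in C(c, r), (if ε < dist η ξ then (η - ξ)⁻¹ else 0) =
      Complex.I * ∫ θ in (0 : ℝ)..2 * Real.pi,
        (if ε < dist (circleMap c r θ) ξ then (1 / 2 : ℂ) else 0) := by
  obtain ⟨θ₀, rfl⟩ : ∃ θ₀, circleMap c r θ₀ = ξ := by
    have : ξ ∈ Set.range (circleMap c r) := by rwa [range_circleMap, abs_of_pos hr]
    exact this
  set ξ := circleMap c r θ₀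
  -- With `u = η - c` one has `dη = i u dθ`, so the truncated integral is `i` times the integral of
  -- `q`.
  set q : ℝ → ℂ := fun θ => circleMap 0 r θ *
    (if ε < dist (circleMap c r θ) ξ then (circleMap c r θ - ξ)⁻¹ else 0) with hq
  have hsub : ∀ θ, circleMap c r θ - ξ = circleMap 0 r θ - circleMap 0 r θ₀ := fun θ => by
    simp [ξ, circleMap]
  have hu0 : ∀ θ, circleMap 0 r θ ≠ 0 := fun θ => circleMap_ne_center hr.ne'
  have hnorm : ∀ θ, circleMap 0 r θ * conj (circleMap 0 r θ) = (r : ℂ) ^ 2 := fun θ => by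
    rw [Complex.mul_conj, Complex.normSq_eq_norm_sq, norm_circleMap_zero, sq_abs]
    push_cast; rfl
  have hrefl : ∀ θ, circleMap 0 r (2 * θ₀ - θ) * conj (circleMap 0 r θ₀) =
      conj (circleMap 0 r θ) * circleMap 0 r θ₀ := fun θ => by
    simp only [circleMap, zero_add, map_mul, Complex.conj_ofReal, ← Complex.exp_conj,
      Complex.conj_I]
    have : Complex.exp ((2 * θ₀ - θ : ℝ) * Complex.I) * Complex.exp (θ₀ * -Complex.I) =
        Complex.exp (θ * -Complex.I) * Complex.exp (θ₀ * Complex.I) := by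
      rw [← Complex.exp_add, ← Complex.exp_add]; congr 1; push_cast; ring
    linear_combination (r : ℂ) * r * this
  have hd : ∀ θ, dist (circleMap c r (2 * θ₀ - θ)) ξ = dist (circleMap c r θ) ξ := by
    intro θ
    have h1 : (circleMap c r (2 * θ₀ - θ) - ξ) * conj (circleMap 0 r θ₀) =
        conj (circleMap c r θ - ξ) * circleMap 0 r θ₀ := by
      rw [hsub, hsub, map_sub]
      linear_combination hrefl θ
    have h2 := congrArg norm h1
    rw [norm_mul, norm_mul, Complex.norm_conj, Complex.norm_conj] at h2
    rw [dist_eq_norm, dist_eq_norm]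
    exact mul_right_cancel₀ (norm_ne_zero_iff.mpr (hu0 θ₀)) h2
  -- Reflection in the axis through `c` and `ξ` preserves the truncation and conjugates `q`; hence
  -- the integral of `q` is real and equals that of its real part.
  have hconj : ∀ θ, q (2 * θ₀ - θ) = conj (q θ) := by
    intro θ
    simp only [hq, hd]
    split_ifs with hlt
    · have hne : circleMap c r θ - ξ ≠ 0 := fun h0 => by
        rw [dist_eq_norm, h0, norm_zero] at hlt; linarith
      have hne' : circleMap c r (2 * θ₀ - θ) - ξ ≠ 0 := fun h0 => by
        rw [← hd, dist_eq_norm, h0, norm_zero] at hlt; linarith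
      have hne2 : conj (circleMap c r θ - ξ) ≠ 0 := (map_ne_zero _).mpr hne
      rw [map_mul, map_inv₀, ← div_eq_mul_inv, ← div_eq_mul_inv, div_eq_div_iff hne' hne2]
      have hv : conj (circleMap 0 r θ₀) ≠ 0 := (map_ne_zero _).mpr (hu0 θ₀)
      refine mul_right_cancel₀ hv ?_
      rw [hsub, hsub, map_sub]
      linear_combination (conj (circleMap 0 r θ) - conj (circleMap 0 r θ₀)) * hrefl θ -
        conj (circleMap 0 r θ) * hrefl θ
    · simp
  have hper : Function.Periodic q (2 * Real.pi) := fun θ => by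
    simp only [hq, periodic_circleMap c r θ, periodic_circleMap 0 r θ]
  have hreal : conj (∫ θ in (0 : ℝ)..2 * Real.pi, q θ) = ∫ θ in (0 : ℝ)..2 * Real.pi, q θ := by
    rw [← intervalIntegral.intervalIntegral_conj]
    simp only [← hconj]
    rw [intervalIntegral.integral_comp_sub_left (fun θ => q θ) (2 * θ₀), sub_zero]
    have := hper.intervalIntegral_add_eq (2 * θ₀ - 2 * Real.pi) 0
    rwa [sub_add_cancel, zero_add] at this
  -- For `‖u‖ = ‖u₀‖` and `u ≠ u₀` the real part of `u/(u - u₀)` is `1/2`. The singularity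
  -- disappears, and the limit is half of the full `2πi`.
  have hsum : ∀ θ, q θ + conj (q θ) =
      2 * (if ε < dist (circleMap c r θ) ξ then (1 / 2 : ℂ) else 0) := by
    intro θ
    simp only [hq]
    split_ifs with hlt
    · have hne : circleMap c r θ - ξ ≠ 0 := fun h0 => by
        rw [dist_eq_norm, h0, norm_zero] at hlt; linarith
      have hne2 : conj (circleMap c r θ - ξ) ≠ 0 := (map_ne_zero _).mpr hne
      rw [map_mul, map_inv₀, ← div_eq_mul_inv, ← div_eq_mul_inv, div_add_div _ _ hne hne2,
        div_eq_iff (mul_ne_zero hne hne2), hsub, map_sub]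
      linear_combination hnorm θ - hnorm θ₀
    · simp
  have hqm : Measurable q := by
    refine (continuous_circleMap 0 r).measurable.mul (Measurable.ite
      (measurableSet_lt_dist_circleMap c r ε ξ) ?_ measurable_const)
    exact ((continuous_circleMap c r).measurable.sub_const _).inv
  have hqb : ∀ θ, ‖q θ‖ ≤ r * ε⁻¹ := by
    intro θ
    simp only [hq]
    rw [norm_mul, norm_circleMap_zero, abs_of_pos hr]
    refine mul_le_mul_of_nonneg_left ?_ hr.le
    split_ifs with hlt
    · rw [norm_inv, ← dist_eq_norm]; exact inv_anti₀ hε hlt.le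
    · rw [norm_zero]; positivity
  have hqi : IntervalIntegrable q volume 0 (2 * Real.pi) :=
    (intervalIntegrable_const (c := r * ε⁻¹)).mono_fun' hqm.aestronglyMeasurable
      (Eventually.of_forall hqb)
  have hqi' : IntervalIntegrable (fun θ => conj (q θ)) volume 0 (2 * Real.pi) :=
    (intervalIntegrable_const (c := r * ε⁻¹)).mono_fun'
      (Complex.continuous_conj.measurable.comp hqm).aestronglyMeasurable
      (Eventually.of_forall fun θ => by simpa only [Complex.norm_conj] using hqb θ)
  have hfin : 2 * ∫ θ in (0 : ℝ)..2 * Real.pi, q θ = 2 * ∫ θ in (0 : ℝ)..2 * Real.pi,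
      (if ε < dist (circleMap c r θ) ξ then (1 / 2 : ℂ) else 0) := by
    rw [two_mul]
    nth_rewrite 2 [← hreal]
    rw [← intervalIntegral.intervalIntegral_conj, ← intervalIntegral.integral_add hqi hqi',
      ← intervalIntegral.integral_const_mul]
    simp only [hsum]
  rw [← mul_left_cancel₀ two_ne_zero hfin, ← intervalIntegral.integral_const_mul]
  unfold circleIntegral
  congr 1; ext θ
  rw [deriv_circleMap, smul_eq_mul, hq]
  ring

theorem tendsto_circleIntegral_truncate_inv (hr : 0 < r) {ξ : ℂ} (hξ : ξ ∈ sphere c r) :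
    Tendsto (fun ε : ℝ => ∮ η in C(c, r), (if ε < dist η ξ then (η - ξ)⁻¹ else 0)) (𝓝[>] 0)
      (𝓝 (Real.pi * Complex.I)) := by
  have h1 : Tendsto (fun ε : ℝ => ∫ θ in (0 : ℝ)..2 * Real.pi,
      (if ε < dist (circleMap c r θ) ξ then (1 / 2 : ℂ) else 0)) (𝓝[>] 0)
      (𝓝 (∫ θ in (0 : ℝ)..2 * Real.pi, (1 / 2 : ℂ))) := by
    refine intervalIntegral.tendsto_integral_filter_of_dominated_convergence (fun _ => 1 / 2)
      (Eventually.of_forall fun ε => ?_) (Eventually.of_forall fun ε => ?_) (by simp) ?_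
    · exact (Measurable.ite (measurableSet_lt_dist_circleMap c r ε ξ) measurable_const
        measurable_const).aestronglyMeasurable
    · refine Eventually.of_forall fun θ _ => ?_
      split_ifs <;> norm_num
    · have h1 : ∀ᵐ θ : ℝ, circleMap c r θ ≠ ξ := by
        have := ((Set.countable_singleton ξ).preimage_circleMap c hr.ne').measure_zero volume
        rw [ae_iff]
        convert this using 2
        ext θ; simp
      filter_upwards [h1] with θ hθ _ using tendsto_ite_lt_dist hθ _
  have h2 : (Real.pi * Complex.I : ℂ) = Complex.I * ∫ θ in (0 : ℝ)..2 * Real.pi, (1 / 2 : ℂ) := by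
    rw [intervalIntegral.integral_const, sub_zero, Complex.real_smul]; push_cast; ring
  rw [h2]
  refine (h1.const_mul Complex.I).congr' ?_
  filter_upwards [self_mem_nhdsWithin] with ε hε using (circleIntegral_truncate_inv hr hξ hε).symm

theorem circleIntegrable_of_bounded {f : ℂ → ℂ} {M : ℝ}
    (hf : Measurable fun θ => f (circleMap c r θ)) (hM : ∀ θ, ‖f (circleMap c r θ)‖ ≤ M) :
    CircleIntegrable f c r :=
  (intervalIntegrable_const (c := M)).mono_fun' hf.aestronglyMeasurable (Eventually.of_forall hM)

/-- The Cauchy principal value of the Cauchy integral of a Lipschitz density. -/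
theorem tendsto_cauchyIntegral_truncate (hr : 0 < r)
    (hK : ∀ η ∈ sphere c r, ∀ ξ ∈ sphere c r, ‖h η - h ξ‖ ≤ K * ‖η - ξ‖) {ξ : ℂ}
    (hξ : ξ ∈ sphere c r) :
    Tendsto (fun ε : ℝ => ∮ η in C(c, r), (if ε < dist η ξ then h η * (η - ξ)⁻¹ else 0)) (𝓝[>] 0)
      (𝓝 ((∮ η in C(c, r), (h η - h ξ) * (η - ξ)⁻¹) + Real.pi * Complex.I * h ξ)) := by
  have hc := continuousOn_of_lipschitz hK
  have hm1 : Measurable fun θ => (circleMap c r θ - ξ)⁻¹ :=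
    ((continuous_circleMap c r).measurable.sub_const _).inv
  have hm2 : Measurable fun θ => (h (circleMap c r θ) - h ξ) * (circleMap c r θ - ξ)⁻¹ :=
    ((continuous_comp_circleMap hr hc).measurable.sub_const _).mul hm1
  have hb : ∀ η ∈ sphere c r, ‖(h η - h ξ) * (η - ξ)⁻¹‖ ≤ |K| := by
    intro η hη
    rw [norm_mul, norm_inv]
    rcases (norm_nonneg (η - ξ)).eq_or_lt with h0 | h0
    · rw [← h0, inv_zero, mul_zero]; positivity
    · rw [← div_eq_mul_inv, div_le_iff₀ h0]
      exact (hK η hη ξ hξ).trans (mul_le_mul_of_nonneg_right (le_abs_self K) h0.le)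
  have h1 := tendsto_circleIntegral_truncate (c := c) hr
    (f := fun η => (h η - h ξ) * (η - ξ)⁻¹) ξ hm2 hb
  have h2 := (tendsto_circleIntegral_truncate_inv hr hξ).mul_const (h ξ)
  refine (h1.add h2).congr' ?_
  filter_upwards [self_mem_nhdsWithin] with ε hε
  rw [mul_comm _ (h ξ), ← circleIntegral.integral_const_mul, ← circleIntegral.integral_add]
  · congr 1; ext η
    split_ifs <;> ring
  · refine circleIntegrable_of_bounded (M := |K|) (Measurable.ite
      (measurableSet_lt_dist_circleMap c r ε ξ) hm2 measurable_const) fun θ => ?_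
    split_ifs
    · exact hb _ (circleMap_mem_sphere c hr.le θ)
    · rw [norm_zero]; positivity
  · refine circleIntegrable_of_bounded (M := ‖h ξ‖ * ε⁻¹) (measurable_const.mul (Measurable.ite
      (measurableSet_lt_dist_circleMap c r ε ξ) hm1 measurable_const)) fun θ => ?_
    rw [norm_mul]
    refine mul_le_mul_of_nonneg_left ?_ (norm_nonneg _)
    split_ifs with hlt
    · rw [norm_inv, ← dist_eq_norm]; exact inv_anti₀ hε hlt.le
    · rw [norm_zero]; exact inv_nonneg.mpr (le_of_lt hε)

end Circle

end CircularRH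

end

noncomputable section

namespace CircularRH

namespace CircleSystem

/-! ### The exterior domain and a uniqueness theorem -/

section Uniqueness

variable {n : ℕ} (S : CircleSystem n)

theorem isOpen_setOf_lt_dist (s : Fin n → ℝ) : IsOpen {z : ℂ | ∀ j, s j < dist z (S.center j)} := by
  rw [Set.ofPred_forall]
  exact isOpen_iInter_of_finite fun j => isOpen_lt continuous_const
    (continuous_id.dist continuous_const)

theorem isOpen_exteriorPlane : IsOpen S.exteriorPlane := S.isOpen_setOf_lt_dist S.radius

/-- Points in the discs of radii `s_j` are moved radially to the boundary circles. -/
def pushOut (s : Fin n → ℝ) (z : ℂ) : ℂ :=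
  z + ∑ j, ((max 0 (s j / ‖z - S.center j‖ - 1) : ℝ) : ℂ) * (z - S.center j)

theorem pushOut_term_eq_zero {s t : ℝ} (ht : 0 < t) (h : s ≤ t) : max 0 (s / t - 1) = 0 :=
  max_eq_left (by rw [sub_nonpos, div_le_one ht]; exact h)

theorem continuousOn_pushOut (s : Fin n → ℝ) :
    ContinuousOn (S.pushOut s) (Set.range S.center)ᶜ := by
  unfold pushOut
  refine continuousOn_id.add (continuousOn_finsetSum _ fun j _ => ?_)
  refine ContinuousOn.mul ?_ (by fun_prop)
  refine Complex.continuous_ofReal.comp_continuousOn ?_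
  refine ContinuousOn.sup continuousOn_const (ContinuousOn.sub (continuousOn_const.div
    (by fun_prop) ?_) continuousOn_const)
  intro z hz
  exact norm_ne_zero_iff.mpr (sub_ne_zero.mpr fun h => hz ⟨j, h.symm⟩)

/-- The set is the image of the plane punctured at the finitely many centres under the continuous
retraction `pushOut`. -/
theorem isPreconnected_setOf_le_dist {s : Fin n → ℝ} (hs : ∀ j, 0 < s j)
    (hd : ∀ i j, i ≠ j → s i + s j ≤ dist (S.center i) (S.center j)) :
    IsPreconnected {z : ℂ | ∀ j, s j ≤ dist z (S.center j)} := by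
  have h1 : IsPreconnected ((Set.range S.center)ᶜ) :=
    ((Set.finite_range S.center).countable.isConnected_compl_of_one_lt_rank
      (by rw [Complex.rank_real_complex]; norm_num)).isPreconnected
  convert h1.image _ (S.continuousOn_pushOut s) using 1
  have hfix : ∀ z : ℂ, (∀ j, s j ≤ dist z (S.center j)) → S.pushOut s z = z := by
    intro z hz
    rw [pushOut, Finset.sum_eq_zero, add_zero]
    intro j _
    have h2 := hz j
    rw [dist_eq_norm] at h2
    rw [pushOut_term_eq_zero ((hs j).trans_le h2) h2]
    simp
  ext z
  constructor
  · intro hz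
    refine ⟨z, ?_, hfix z hz⟩
    rintro ⟨j, rfl⟩
    have := hz j
    rw [dist_self] at this
    exact this.not_gt (hs j)
  · rintro ⟨z, hz, rfl⟩
    by_cases h : ∀ j, s j ≤ dist z (S.center j)
    · rw [hfix z h]; exact h
    · push Not at h
      obtain ⟨j, hj⟩ := h
      have hz0 : 0 < ‖z - S.center j‖ :=
        norm_pos_iff.mpr (sub_ne_zero.mpr fun h => hz ⟨j, h.symm⟩)
      have hform : S.pushOut s z = S.center j + ((s j / ‖z - S.center j‖ : ℝ) : ℂ) *
          (z - S.center j) := by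
        rw [pushOut, Finset.sum_eq_single j]
        · rw [dist_eq_norm] at hj
          rw [max_eq_right (sub_nonneg.mpr ((one_le_div hz0).mpr hj.le))]
          push_cast
          ring
        -- The discs do not overlap, so a point inside the `j`-th one receives no contribution from
        -- the others.
        · intro i _ hij
          have h2 : s i ≤ ‖z - S.center i‖ := by
            have h3 := hd i j hij
            have h4 := dist_triangle_left (S.center i) (S.center j) z
            rw [← dist_eq_norm]
            linarith
          rw [pushOut_term_eq_zero ((hs i).trans_le h2) h2]
          simp
        · simp
      have hdist : dist (S.pushOut s z) (S.center j) = s j := by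
        rw [hform, dist_eq_norm, add_sub_cancel_left, norm_mul, Complex.norm_real,
          Real.norm_of_nonneg (div_nonneg (hs j).le hz0.le), div_mul_cancel₀ _ hz0.ne']
      intro i
      by_cases hij : i = j
      · rw [hij, hdist]
      · have h3 := hd i j hij
        have h4 := dist_triangle_left (S.center i) (S.center j) (S.pushOut s z)
        linarith

/-- Any two points lie outside discs enlarged by a common `ε`; bounding `ε` by half the gaps keeps
the enlarged discs from overlapping, so the closed version applies. -/
theorem isPreconnected_exteriorPlane : IsPreconnected S.exteriorPlane := by
  refine isPreconnected_of_forall_pair fun x hx y hy => ?_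
  obtain ⟨ε₁, h1, hε₁⟩ := exists_pos_forall_le (fun j => dist x (S.center j) - S.radius j)
    fun j => sub_pos.mpr (hx j)
  obtain ⟨ε₂, h2, hε₂⟩ := exists_pos_forall_le (fun j => dist y (S.center j) - S.radius j)
    fun j => sub_pos.mpr (hy j)
  obtain ⟨ε₃, h3, hε₃⟩ : ∃ m > 0, ∀ x : {x : Fin n × Fin n // x.1 ≠ x.2}, m ≤
      (dist (S.center x.1.1) (S.center x.1.2) - (S.radius x.1.1 + S.radius x.1.2)) / 2 :=
    exists_pos_forall_le _ fun x => by linarith [S.disjoint _ _ x.2]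
  set ε := min ε₁ (min ε₂ ε₃)
  have hε : 0 < ε := lt_min h1 (lt_min h2 h3)
  have e1 : ε ≤ ε₁ := min_le_left _ _
  have e2 : ε ≤ ε₂ := (min_le_right _ _).trans (min_le_left _ _)
  have e3 : ε ≤ ε₃ := (min_le_right _ _).trans (min_le_right _ _)
  refine ⟨{z | ∀ j, S.radius j + ε ≤ dist z (S.center j)}, ?_, ?_, ?_,
    S.isPreconnected_setOf_le_dist (s := fun j => S.radius j + ε)
      (fun j => add_pos (S.radius_pos j) hε) fun i j hij => ?_⟩
  · intro z hz j
    linarith [hz j]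
  · intro j
    linarith [hε₁ j]
  · intro j
    linarith [hε₂ j]
  · have := hε₃ ⟨(i, j), hij⟩
    simp only at this
    linarith

theorem exteriorPlane_mem_cocompact : S.exteriorPlane ∈ cocompact ℂ := by
  have h1 : ∀ j, ∀ᶠ z in cocompact ℂ, S.radius j < dist z (S.center j) := by
    intro j
    have := tendsto_norm_cocompact_atTop (E := ℂ)
    filter_upwards [this.eventually_gt_atTop (S.radius j + ‖S.center j‖)] with z hz
    rw [dist_eq_norm]
    linarith [norm_sub_norm_le z (S.center j)]
  filter_upwards [eventually_all.mpr h1] with z hz using hz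

theorem closure_exteriorPlane_subset : closure S.exteriorPlane ⊆ S.exteriorPlane ∪ S.contour := by
  intro z hz
  have h1 : ∀ j, S.radius j ≤ dist z (S.center j) := by
    intro j
    have hc : IsClosed {z : ℂ | S.radius j ≤ dist z (S.center j)} :=
      isClosed_le continuous_const (continuous_id.dist continuous_const)
    exact closure_minimal (fun w hw => (hw j).le) hc hz
  by_cases h : ∃ j, dist z (S.center j) = S.radius j
  · obtain ⟨j, hj⟩ := h
    exact Or.inr (S.circle_subset_contour j hj)
  · push Not at h
    exact Or.inl fun j => lt_of_le_of_ne (h1 j) (h j).symm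

/-- A function which is holomorphic in the exterior domain, with a limit at infinity, and whose
boundary values have a constant imaginary part on each circle, is constant. -/
theorem eq_of_im_const {f : ℂ → ℂ} (hf : AnalyticOnNhd ℂ f S.exteriorPlane) {L : ℂ}
    (hinf : Tendsto f (cocompact ℂ) (𝓝 L)) {e : Fin n → ℝ}
    (hb : ∀ j, ∀ ξ ∈ S.circle j, ∃ w, Tendsto f (𝓝[S.exteriorPlane] ξ) (𝓝 w) ∧ w.im = e j) :
    ∀ z ∈ S.exteriorPlane, f z = L := by
  -- A compactness statement: along any ultrafilter in the exterior `f` converges, and the limit is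
  -- a value of `f`, a boundary value, or `L`. In the last two cases its imaginary part lies in a
  -- finite set.
  have key : ∀ F : Ultrafilter ℂ, S.exteriorPlane ∈ F → ∃ v, Tendsto f F (𝓝 v) ∧
      (v ∈ f '' S.exteriorPlane ∨ v.im ∈ insert L.im (Set.range e)) := by
    intro F hF
    by_cases hK : ∃ K, IsCompact K ∧ K ∈ F
    · obtain ⟨K, hK, hKF⟩ := hK
      obtain ⟨z, -, hz⟩ := isCompact_iff_ultrafilter_le_nhds.mp hK F (le_principal_iff.mpr hKF)
      have hzc : z ∈ closure S.exteriorPlane := mem_closure_iff_ultrafilter.mpr ⟨F, hF, hz⟩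
      rcases S.closure_exteriorPlane_subset hzc with h | h
      · exact ⟨f z, ((hf z h).continuousAt.tendsto).mono_left hz, Or.inl ⟨z, h, rfl⟩⟩
      · obtain ⟨j, hj⟩ := Set.mem_iUnion.mp h
        obtain ⟨w, hw, hwe⟩ := hb j z hj
        exact ⟨w, hw.mono_left (le_inf hz (le_principal_iff.mpr hF)), Or.inr (Or.inr ⟨j, hwe.symm⟩)⟩
    · push Not at hK
      refine ⟨L, hinf.mono_left fun s hs => ?_, Or.inr (Or.inl rfl)⟩
      obtain ⟨K, hKc, hKs⟩ := mem_cocompact.mp hs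
      exact mem_of_superset (Ultrafilter.compl_mem_iff_notMem.mpr (hK K hKc)) hKs
  rcases hf.is_constant_or_isOpen S.isPreconnected_exteriorPlane with ⟨w, hw⟩ | hopen
  · have h1 : Tendsto f (cocompact ℂ) (𝓝 w) := by
      refine tendsto_const_nhds.congr' ?_
      filter_upwards [S.exteriorPlane_mem_cocompact] with z hz using (hw z hz).symm
    intro z hz
    rw [hw z hz, tendsto_nhds_unique h1 hinf]
  · exfalso
    have hU : IsOpen (f '' S.exteriorPlane) := hopen _ subset_rfl S.isOpen_exteriorPlane
    obtain ⟨z₀, hz₀⟩ : S.exteriorPlane.Nonempty :=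
      nonempty_of_mem S.exteriorPlane_mem_cocompact
    obtain ⟨ε, hε, hball⟩ := Metric.isOpen_iff.mp hU _ ⟨z₀, hz₀, rfl⟩
    have hfin : (insert L.im (Set.range e)).Finite := (Set.finite_range e).insert _
    -- If `f` is nonconstant its image is open. Pick a horizontal line at height `y` which meets the
    -- image near `f z₀` and avoids the finitely many exceptional imaginary parts.
    obtain ⟨y, hy, hyb⟩ : ∃ y ∈ Set.Ioo (f z₀).im ((f z₀).im + ε), y ∉ insert L.im (Set.range e) :=
      (Set.Ioo_infinite (by linarith)).exists_notMem_finite hfin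
    have hlift : ∀ u : Ultrafilter ℂ, f '' S.exteriorPlane ∈ u →
        ∃ v, (u : Filter ℂ) ≤ 𝓝 v ∧
          (v ∈ f '' S.exteriorPlane ∨ v.im ∈ insert L.im (Set.range e)) := by
      intro u hu
      obtain ⟨v, hv, hv'⟩ := key (Ultrafilter.ofComapInfPrincipal hu)
        (Ultrafilter.ofComapInfPrincipal_mem hu)
      refine ⟨v, ?_, hv'⟩
      have h2 := Ultrafilter.ofComapInfPrincipal_eq_of_map hu
      rw [← h2]
      exact hv
    set g : ℝ → ℂ := fun x => x + y * Complex.I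
    have hg : Continuous g := by fun_prop
    have hgim : ∀ x, (g x).im = y := fun x => by simp [g]
    -- On this line every limit of image points is itself in the image, since its imaginary part `y`
    -- is not exceptional.
    have hclopen : IsClopen (g ⁻¹' (f '' S.exteriorPlane)) := by
      refine ⟨?_, hU.preimage hg⟩
      rw [isClosed_iff_ultrafilter]
      intro x u hu hx
      obtain ⟨v, hv, hv'⟩ := hlift (u.map g) hx
      have hvx : v = g x :=
        tendsto_nhds_unique (f := g) (l := (u : Filter ℝ)) hv ((hg.tendsto x).mono_left hu)
      subst hvx
      rcases hv' with h | h
      · exact h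
      · rw [hgim] at h; exact absurd h hyb
    have hne : (g ⁻¹' (f '' S.exteriorPlane)).Nonempty := by
      refine ⟨(f z₀).re, hball ?_⟩
      rw [Metric.mem_ball, Complex.dist_of_re_eq (by simp [g]), Real.dist_eq, hgim,
        abs_of_pos (by linarith [hy.1])]
      linarith [hy.2]
    have huniv := hclopen.eq_univ hne
    -- By connectedness the image contains the whole line. An ultrafilter going to infinity along it
    -- would still have to converge, which is impossible.
    obtain ⟨v, hv, -⟩ := hlift ((Ultrafilter.of atTop).map g) (by
      change g ⁻¹' (f '' S.exteriorPlane) ∈ Ultrafilter.of atTop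
      rw [huniv]; exact univ_mem)
    have hre : Tendsto (fun x : ℝ => (g x).re) ((Ultrafilter.of atTop : Ultrafilter ℝ) : Filter ℝ)
        (𝓝 v.re) :=
      (Complex.continuous_re.tendsto v).comp (show Tendsto g _ _ from hv)
    have hre' : Tendsto (fun x : ℝ => (g x).re) ((Ultrafilter.of atTop : Ultrafilter ℝ) : Filter ℝ)
        atTop := by
      have : (fun x : ℝ => (g x).re) = id := by ext x; simp [g]
      rw [this]
      exact tendsto_id.mono_left (Ultrafilter.of_le _)
    exact not_tendsto_nhds_of_tendsto_atTop hre' _ hre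

end Uniqueness

end CircleSystem

end CircularRH

end

noncomputable section

namespace CircularRH

/-! ### Dependence of circle integrals on a parameter, and decay at infinity -/

section Circle

open Metric

variable {c : ℂ} {r : ℝ}

theorem circleIntegrable_mul (hr : 0 < r) {f g : ℂ → ℂ} (hf : ContinuousOn f (sphere c r))
    (hg : ContinuousOn g (sphere c r)) : CircleIntegrable (fun η => f η * g η) c r :=
  (hf.mul hg).circleIntegrable hr.le

theorem tendsto_circleIntegral_mul_of_uniform (hr : 0 < r) {ι : Type*} {l : Filter ι} {h : ℂ → ℂ}
    {F : ι → ℂ → ℂ} {f : ℂ → ℂ} (hh : ContinuousOn h (sphere c r))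
    (hF : ∀ᶠ i in l, ContinuousOn (F i) (sphere c r)) (hf : ContinuousOn f (sphere c r))
    (hu : TendstoUniformlyOn F f l (sphere c r)) :
    Tendsto (fun i => ∮ η in C(c, r), h η * F i η) l (𝓝 (∮ η in C(c, r), h η * f η)) := by
  obtain ⟨M, hM0, hM⟩ := exists_norm_le_of_continuousOn_sphere hh
  rw [Metric.tendsto_nhds]
  intro ε hε
  have hpos : 0 < 2 * Real.pi * r * M + 1 := by positivity
  filter_upwards [Metric.tendstoUniformlyOn_iff.mp hu (ε / (2 * Real.pi * r * M + 1))
    (by positivity), hF] with i hi hFi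
  rw [dist_eq_norm, ← circleIntegral.integral_sub (circleIntegrable_mul hr hh hFi)
    (circleIntegrable_mul hr hh hf)]
  refine (norm_circleIntegral_le_of_sphere hr (M := M * (ε / (2 * Real.pi * r * M + 1)))
    fun η hη => ?_).trans_lt ?_
  · rw [← mul_sub, norm_mul, ← dist_eq_norm, dist_comm]
    exact mul_le_mul (hM η hη) (hi η hη).le dist_nonneg hM0
  · rw [← mul_assoc, mul_div_assoc', div_lt_iff₀ hpos]
    nlinarith

theorem norm_circleIntegral_mul_sub_le (hr : 0 < r) {h f g : ℂ → ℂ} {M B : ℝ}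
    (hh : ContinuousOn h (sphere c r)) (hM : ∀ η ∈ sphere c r, ‖h η‖ ≤ M)
    (hf : ContinuousOn f (sphere c r)) (hg : ContinuousOn g (sphere c r))
    (hB : ∀ η ∈ sphere c r, ‖f η - g η‖ ≤ B) (hM0 : 0 ≤ M) :
    ‖(∮ η in C(c, r), h η * f η) - ∮ η in C(c, r), h η * g η‖ ≤ 2 * Real.pi * r * M * B := by
  rw [← circleIntegral.integral_sub (circleIntegrable_mul hr hh hf)
    (circleIntegrable_mul hr hh hg), mul_assoc _ M]
  refine norm_circleIntegral_le_of_sphere hr fun η hη => ?_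
  rw [← mul_sub, norm_mul]
  exact mul_le_mul (hM η hη) (hB η hη) (norm_nonneg _) hM0

theorem differentiableAt_cauchyIntegral (hr : 0 < r) {h : ℂ → ℂ} (hh : ContinuousOn h (sphere c r))
    {z : ℂ} (hz : z ∉ sphere c r) :
    DifferentiableAt ℂ (fun z => ∮ η in C(c, r), h η * (η - z)⁻¹) z := by
  obtain ⟨M, hM0, hM⟩ := exists_norm_le_of_continuousOn_sphere hh
  have hcl : IsClosed (sphere c r) := isClosed_sphere
  obtain ⟨ε, hε, hball⟩ := Metric.isOpen_iff.mp hcl.isOpen_compl z hz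
  have hdist : ∀ η ∈ sphere c r, ∀ w ∈ ball z (ε / 2), ε / 2 ≤ ‖η - w‖ := by
    intro η hη w hw
    by_contra hlt
    refine hball (show η ∈ ball z ε from ?_) hη
    rw [mem_ball] at hw ⊢
    rw [← dist_eq_norm] at hlt
    linarith [dist_triangle η w z]
  have hne : ∀ η ∈ sphere c r, ∀ w ∈ ball z (ε / 2), η - w ≠ 0 := fun η hη w hw =>
    norm_pos_iff.mp ((half_pos hε).trans_le (hdist η hη w hw))
  refine differentiableAt_circleIntegral hr (ball_mem_nhds z (half_pos hε))
    (C := M * (1 / (ε / 2) ^ 2)) (by positivity)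
    (fun w hw => hh.mul (ContinuousOn.inv₀ (by fun_prop)
      fun η hη => hne η hη w hw)) (fun η hη w hw w' hw' => ?_) fun η hη => ?_
  · rw [← mul_sub, norm_mul, mul_assoc]
    refine mul_le_mul (hM η hη) ((CircleSystem.norm_inv_sub_inv_le (half_pos hε) (hdist η hη w hw)
      (hdist η hη w' hw')).trans_eq ?_) (norm_nonneg _) hM0
    rw [sub_sub_sub_cancel_left, norm_sub_rev]
    ring
  · have h1 : DifferentiableAt ℂ (fun z => η - z) z := by fun_prop
    exact (h1.inv (hne η hη z (mem_ball_self (half_pos hε)))).const_mul _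

theorem tendsto_cauchyIntegral_cocompact (hr : 0 < r) {h : ℂ → ℂ}
    (hh : ContinuousOn h (sphere c r)) :
    Tendsto (fun z => ∮ η in C(c, r), h η * (η - z)⁻¹) (cocompact ℂ) (𝓝 0) := by
  have hlarge : ∀ R : ℝ, ∀ᶠ z : ℂ in cocompact ℂ, ∀ η ∈ sphere c r, R ≤ ‖η - z‖ := by
    intro R
    filter_upwards [(tendsto_norm_cocompact_atTop (E := ℂ)).eventually_ge_atTop (R + ‖c‖ + r)]
      with z hz η hη
    rw [mem_sphere, dist_eq_norm] at hη
    have h1 := norm_le_norm_add_norm_sub' z η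
    have h2 := norm_le_norm_add_norm_sub' η c
    rw [norm_sub_rev] at h1
    linarith
  have h0 : (∮ η in C(c, r), h η * (fun _ => (0 : ℂ)) η) = 0 := by
    simp [circleIntegral]
  rw [← h0]
  refine tendsto_circleIntegral_mul_of_uniform hr (F := fun z η => (η - z)⁻¹) hh ?_
    continuousOn_const ?_
  · filter_upwards [hlarge 1] with z hz
    exact ContinuousOn.inv₀ (by fun_prop) fun η hη => norm_pos_iff.mp (one_pos.trans_le (hz η hη))
  · rw [Metric.tendstoUniformlyOn_iff]
    intro ε hε
    filter_upwards [hlarge (2 / ε)] with z hz η hη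
    rw [dist_zero_left, norm_inv]
    refine (inv_anti₀ (by positivity) (hz η hη)).trans_lt ?_
    rw [inv_div]
    linarith

end Circle

namespace CircleSystem

/-! ### The potential near the closure of the exterior domain -/

section Potential

variable {n : ℕ} (S : CircleSystem n)

/-- The Cauchy integral over the `l`-th circle. -/
def cauchyInt (h : Fin n → ℂ → ℝ) (l : Fin n) (z : ℂ) : ℂ :=
  ∮ η in C(S.center l, S.radius l), (h l η : ℂ) * (η - z)⁻¹

/-- Continuity of a density on the circles. -/
def ContDensity (h : Fin n → ℂ → ℝ) : Prop :=
  ∀ l, ContinuousOn (fun η => (h l η : ℂ)) (S.circle l)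

/-- Lipschitz continuity of a density on the circles. -/
def LipDensity (h : Fin n → ℂ → ℝ) : Prop :=
  ∃ K, ∀ l, ∀ η ∈ S.circle l, ∀ ξ ∈ S.circle l, ‖(h l η : ℂ) - (h l ξ : ℂ)‖ ≤ K * ‖η - ξ‖

variable {S} {h : Fin n → ℂ → ℝ}

theorem LipDensity.cont (hh : S.LipDensity h) : S.ContDensity h := by
  obtain ⟨K, hK⟩ := hh
  exact fun l => continuousOn_of_lipschitz (hK l)

theorem ContDensity.exists_bound (hc : S.ContDensity h) :
    ∃ M, 0 ≤ M ∧ ∀ l, ∀ η ∈ S.circle l, ‖(h l η : ℂ)‖ ≤ M := by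
  choose M hM0 hM using fun l => exists_norm_le_of_continuousOn_sphere (hc l)
  refine ⟨∑ l, M l, Finset.sum_nonneg fun l _ => hM0 l, fun l η hη => (hM l η hη).trans ?_⟩
  exact Finset.single_le_sum (fun l _ => hM0 l) (Finset.mem_univ l)

theorem differentiableAt_cauchyInt (hc : S.ContDensity h) (l : Fin n) {z : ℂ}
    (hz : z ∉ S.circle l) : DifferentiableAt ℂ (S.cauchyInt h l) z :=
  differentiableAt_cauchyIntegral (S.radius_pos l) (hc l) hz

theorem notMem_circle_of_ne {j l : Fin n} (hlj : l ≠ j) {ξ : ℂ} (hξ : ξ ∈ S.circle j) :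
    ξ ∉ S.circle l := fun h => (S.dist_of_mem_circle_ne hlj.symm hξ).ne' h

variable [NeZero n]

variable (S) in
/-- The part of the potential which is analytic across the circles. -/
def smoothInt (zs : OnePoint ℂ) (h : Fin n → ℂ → ℝ) (p : OnePoint ℂ) : ℂ :=
  ∑ l, ∮ η in C(S.center l, S.radius l), (h l η : ℂ) * (S.regKernel zs p η - cauchyTerm η zs)

variable (S) in
/-- The planar open neighbourhood `|z - z_j| > r_j - δ/2` of the closed exterior domain. -/
def openCollar (δ : ℝ) : Set ℂ := {z | ∀ j, S.radius j - δ / 2 < dist z (S.center j)}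

omit [NeZero n] in
theorem isOpen_openCollar (δ : ℝ) : IsOpen (S.openCollar δ) := S.isOpen_setOf_lt_dist _

omit [NeZero n] in
theorem coe_mem_collar_of_openCollar {δ : ℝ} {z : ℂ} (hz : z ∈ S.openCollar δ) :
    (z : OnePoint ℂ) ∈ S.collar (δ / 2) := S.coe_mem_collar.mpr fun j => (hz j).le

omit [NeZero n] in
theorem exteriorPlane_subset_openCollar {δ : ℝ} (hδ : 0 < δ) :
    S.exteriorPlane ⊆ S.openCollar δ := fun z hz j => by linarith [hz j]

omit [NeZero n] in
theorem contour_subset_openCollar {δ : ℝ} (hδ : 0 < δ) {z : ℂ} (hz : z ∈ S.contour) :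
    z ∈ S.openCollar δ := fun j => by linarith [S.le_dist_of_mem_contour hz j]

omit [NeZero n] in
theorem ball_disjoint_contour {j : Fin n} {z : ℂ}
    (hz : z ∈ Metric.ball (S.center j) (S.radius j)) : z ∉ S.contour := fun h =>
  (S.le_dist_of_mem_contour h j).not_gt hz

namespace KernelBound

variable {zs : OnePoint ℂ} {δ : ℝ} {b : S.group → ℝ} {P : S.group → ℂ} (hb : S.KernelBound δ b P)
  (hzs : zs ∈ S.exterior) (hc : S.ContDensity h)
include hb hzs

theorem continuousOn_smoothKernel {p : OnePoint ℂ} (hp : p ∈ S.collar (δ / 2)) :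
    ContinuousOn (fun η => S.regKernel zs p η - cauchyTerm η zs) S.contour :=
  (hb.continuousOn_regKernel hp (hb.mem_collar_of_mem_exterior hzs)).sub fun _ hη =>
    (continuousAt_cauchyTerm (S.ne_of_mem_exterior hzs hη)).continuousWithinAt

theorem continuousOn_smoothKernel_circle {p : OnePoint ℂ} (hp : p ∈ S.collar (δ / 2)) (l : Fin n) :
    ContinuousOn (fun η => S.regKernel zs p η - cauchyTerm η zs)
      (Metric.sphere (S.center l) (S.radius l)) :=
  (hb.continuousOn_smoothKernel hzs hp).mono (S.circle_subset_contour l)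

include hc

/-- Only the identity term `1/(η - z)` is singular as `z` approaches the circles; everything else
goes into `smoothInt`. -/
theorem potential_coe {z : ℂ} (hz : (z : OnePoint ℂ) ∈ S.collar (δ / 2)) (hzc : z ∉ S.contour) :
    S.potential zs h z =
      1 / (2 * Real.pi) * (∑ l, S.cauchyInt h l z + S.smoothInt zs h z) := by
  rw [potential, smoothInt, ← Finset.sum_add_distrib]
  congr 1
  refine Finset.sum_congr rfl fun l _ => ?_
  have h1 : ContinuousOn (fun η => (η - z)⁻¹) (Metric.sphere (S.center l) (S.radius l)) :=
    ContinuousOn.inv₀ (by fun_prop) fun η hη h0 =>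
      hzc (sub_eq_zero.mp h0 ▸ S.circle_subset_contour l hη)
  rw [cauchyInt, ← circleIntegral.integral_add (circleIntegrable_mul (S.radius_pos l) (hc l) h1)
    (circleIntegrable_mul (S.radius_pos l) (hc l) (hb.continuousOn_smoothKernel_circle hzs hz l))]
  refine circleIntegral.integral_congr (S.radius_pos l).le fun η hη => ?_
  rw [hb.kernel_eq (S.circle_subset_contour l hη) hz (hb.mem_collar_of_mem_exterior hzs),
    cauchyTerm_coe]
  ring

omit hc in
theorem potential_infty : S.potential zs h ∞ = 1 / (2 * Real.pi) * S.smoothInt zs h ∞ := by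
  rw [potential, smoothInt]
  congr 1
  refine Finset.sum_congr rfl fun l _ => ?_
  refine circleIntegral.integral_congr (S.radius_pos l).le fun η hη => ?_
  rw [hb.kernel_eq (S.circle_subset_contour l hη) (S.infty_mem_collar _)
    (hb.mem_collar_of_mem_exterior hzs), cauchyTerm_infty]
  ring

theorem exists_smoothInt_lipschitz : ∃ C, ∀ z z' : ℂ, (z : OnePoint ℂ) ∈ S.collar (δ / 2) →
    (z' : OnePoint ℂ) ∈ S.collar (δ / 2) →
      ‖S.smoothInt zs h z - S.smoothInt zs h z'‖ ≤ C * ‖z - z'‖ := by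
  obtain ⟨M, hM0, hM⟩ := hc.exists_bound
  refine ⟨∑ l, 2 * Real.pi * S.radius l * M * ((∑' σ, b σ) / (δ / 2) ^ 2), fun z z' hz hz' => ?_⟩
  rw [smoothInt, smoothInt, ← Finset.sum_sub_distrib, Finset.sum_mul]
  refine (norm_sum_le _ _).trans (Finset.sum_le_sum fun l _ => ?_)
  rw [mul_assoc (2 * Real.pi * S.radius l * M)]
  refine norm_circleIntegral_mul_sub_le (S.radius_pos l) (hc l) (hM l)
    (hb.continuousOn_smoothKernel_circle hzs hz l) (hb.continuousOn_smoothKernel_circle hzs hz' l)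
    (fun η hη => ?_) hM0
  rw [sub_sub_sub_cancel_right]
  exact hb.norm_regKernel_sub_le_mul (S.circle_subset_contour l hη) hz hz'
    (hb.mem_collar_of_mem_exterior hzs)

theorem differentiableAt_smoothInt {z : ℂ} (hz : z ∈ S.openCollar δ) :
    DifferentiableAt ℂ (fun z : ℂ => S.smoothInt zs h z) z := by
  obtain ⟨M, hM0, hM⟩ := hc.exists_bound
  have hz' := hb.mem_collar_of_mem_exterior hzs
  unfold smoothInt
  refine DifferentiableAt.fun_sum fun l _ => ?_
  have hB : 0 ≤ (∑' σ, b σ) := tsum_nonneg hb.nonneg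
  refine differentiableAt_circleIntegral (S.radius_pos l)
    ((isOpen_openCollar δ).mem_nhds hz)
    (C := M * ((∑' σ, b σ) / (δ / 2) ^ 2)) (by positivity)
    (fun w hw => (hc l).mul
      (hb.continuousOn_smoothKernel_circle hzs (coe_mem_collar_of_openCollar hw) l))
    (fun η hη w hw w' hw' => ?_) fun η hη => ?_
  · rw [← mul_sub, norm_mul, mul_assoc, sub_sub_sub_cancel_right]
    exact mul_le_mul (hM l η hη) (hb.norm_regKernel_sub_le_mul (S.circle_subset_contour l hη)
      (coe_mem_collar_of_openCollar hw) (coe_mem_collar_of_openCollar hw') hz') (norm_nonneg _) hM0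
  · exact (((hb.differentiableOn_regKernel (S.circle_subset_contour l hη) hz').differentiableAt
      ((isOpen_openCollar δ).mem_nhds hz)).sub_const _).const_mul _

theorem tendsto_smoothInt :
    Tendsto (fun z : ℂ => S.smoothInt zs h z) (cocompact ℂ) (𝓝 (S.smoothInt zs h ∞)) := by
  have hz' := hb.mem_collar_of_mem_exterior hzs
  unfold smoothInt
  refine tendsto_finsetSum _ fun l _ => ?_
  refine tendsto_circleIntegral_mul_of_uniform (S.radius_pos l)
    (F := fun z : ℂ => fun η => S.regKernel zs z η - cauchyTerm η zs) (hc l) ?_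
    (hb.continuousOn_smoothKernel_circle hzs (S.infty_mem_collar _) l) ?_
  · filter_upwards [S.exteriorPlane_mem_cocompact] with z hz
    exact hb.continuousOn_smoothKernel_circle hzs (hb.mem_collar_of_mem_exterior
      (S.coe_mem_exterior.mpr hz)) l
  · have h1 := (hb.tendstoUniformlyOn_regKernel hz').mono (S.circle_subset_contour l)
    rw [Metric.tendstoUniformlyOn_iff] at h1 ⊢
    intro ε hε
    filter_upwards [h1 ε hε] with z hz η hη
    rw [dist_sub_right]
    exact hz η hη

theorem differentiableOn_potential :
    DifferentiableOn ℂ (fun z : ℂ => S.potential zs h z) S.exteriorPlane := by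
  intro z hz
  have hδ := hb.margin.pos
  have h1 : DifferentiableAt ℂ (fun z : ℂ => 1 / (2 * Real.pi) *
      (∑ l, S.cauchyInt h l z + S.smoothInt zs h z) : ℂ → ℂ) z := by
    refine DifferentiableAt.const_mul (DifferentiableAt.add (DifferentiableAt.fun_sum fun l _ =>
      differentiableAt_cauchyInt hc l fun h => (hz l).ne' h)
      (hb.differentiableAt_smoothInt hzs hc (exteriorPlane_subset_openCollar hδ hz))) _
  refine (h1.congr_of_eventuallyEq ?_).differentiableWithinAt
  filter_upwards [S.isOpen_exteriorPlane.mem_nhds hz] with w hw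
  exact hb.potential_coe hzs hc (hb.mem_collar_of_mem_exterior (S.coe_mem_exterior.mpr hw))
    (S.notMem_contour_of_mem_exteriorPlane hw)

theorem tendsto_potential_infty :
    Tendsto (fun z : ℂ => S.potential zs h z) (cocompact ℂ) (𝓝 (S.potential zs h ∞)) := by
  have h1 : Tendsto (fun z : ℂ => 1 / (2 * Real.pi) *
      (∑ l, S.cauchyInt h l z + S.smoothInt zs h z) : ℂ → ℂ) (cocompact ℂ)
      (𝓝 (1 / (2 * Real.pi) * (∑ _l : Fin n, 0 + S.smoothInt zs h ∞))) :=
    ((tendsto_finsetSum _ fun l _ =>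
      tendsto_cauchyIntegral_cocompact (S.radius_pos l) (hc l)).add
        (hb.tendsto_smoothInt hzs hc)).const_mul _
  rw [Finset.sum_const_zero, zero_add, ← hb.potential_infty hzs] at h1
  refine h1.congr' ?_
  filter_upwards [S.exteriorPlane_mem_cocompact] with w hw
  exact (hb.potential_coe hzs hc (hb.mem_collar_of_mem_exterior (S.coe_mem_exterior.mpr hw))
    (S.notMem_contour_of_mem_exteriorPlane hw)).symm

end KernelBound

variable (S) in
/-- Contribution of the `l`-th circle to the principal value at a point `ξ` of the `j`-th circle. -/
def cauchyMean (h : Fin n → ℂ → ℝ) (j : Fin n) (ξ : ℂ) (l : Fin n) : ℂ :=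
  if l = j then
    (∮ η in C(S.center j, S.radius j), ((h j η : ℂ) - h j ξ) * (η - ξ)⁻¹) +
      Real.pi * Complex.I * h j ξ
  else S.cauchyInt h l ξ

variable (S) in
/-- The principal value of the potential at a point `ξ` of the `j`-th circle. -/
def pvValue (zs : OnePoint ℂ) (h : Fin n → ℂ → ℝ) (j : Fin n) (ξ : ℂ) : ℂ :=
  1 / (2 * Real.pi) * (∑ l, S.cauchyMean h j ξ l + S.smoothInt zs h ξ)

namespace KernelBound

variable {zs : OnePoint ℂ} {δ : ℝ} {b : S.group → ℝ} {P : S.group → ℂ} (hb : S.KernelBound δ b P)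
  (hzs : zs ∈ S.exterior) (hh : S.LipDensity h)
include hb hzs hh

/-- Common to both sides of the circle: `v` is the deviation of the one-sided limit of the `j`-th
Cauchy integral from its principal value. The integrals over the other circles and the smooth part
are continuous at `ξ`. -/
theorem tendsto_potential_aux {j : Fin n} {ξ : ℂ} (hξ : ξ ∈ S.circle j) {s : Set ℂ} {v : ℂ}
    (hs : ∀ z ∈ s, z ∉ S.contour)
    (hv : Tendsto (S.cauchyInt h j) (𝓝[s] ξ) (𝓝 (S.cauchyMean h j ξ j + v))) :
    Tendsto (fun z : ℂ => S.potential zs h z) (𝓝[s] ξ)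
      (𝓝 (S.pvValue zs h j ξ + 1 / (2 * Real.pi) * v)) := by
  have hδ := hb.margin.pos
  have hξo := contour_subset_openCollar hδ (S.circle_subset_contour j hξ)
  have h1 : Tendsto (fun z => ∑ l, S.cauchyInt h l z) (𝓝[s] ξ)
      (𝓝 (∑ l, (S.cauchyMean h j ξ l + if l = j then v else 0))) := by
    refine tendsto_finsetSum _ fun l _ => ?_
    by_cases hl : l = j
    · subst hl; rwa [if_pos rfl]
    · rw [if_neg hl, add_zero, cauchyMean, if_neg hl]
      exact (differentiableAt_cauchyInt hh.cont l
        (notMem_circle_of_ne hl hξ)).continuousAt.tendsto.mono_left nhdsWithin_le_nhds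
  rw [Finset.sum_add_distrib, Finset.sum_ite_eq' Finset.univ j, if_pos (Finset.mem_univ j)] at h1
  have h2 := (hb.differentiableAt_smoothInt hzs hh.cont hξo).continuousAt.tendsto.mono_left
    (nhdsWithin_le_nhds (s := s))
  have h3 := (h1.add h2).const_mul (1 / (2 * Real.pi) : ℂ)
  have h4 : S.pvValue zs h j ξ + 1 / (2 * Real.pi) * v = 1 / (2 * Real.pi) *
      (∑ l, S.cauchyMean h j ξ l + v + S.smoothInt zs h ξ) := by rw [pvValue]; ring
  rw [h4]
  refine h3.congr' ?_
  filter_upwards [self_mem_nhdsWithin,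
    nhdsWithin_le_nhds ((isOpen_openCollar δ).mem_nhds hξo)] with z hz hzo
  exact (hb.potential_coe hzs hh.cont (coe_mem_collar_of_openCollar hzo) (hs z hz)).symm

/-- Boundary values of the potential from inside the `j`-th circle. -/
theorem tendsto_potential_inner {j : Fin n} {ξ : ℂ} (hξ : ξ ∈ S.circle j) :
    Tendsto (fun z : ℂ => S.potential zs h z) (𝓝[Metric.ball (S.center j) (S.radius j)] ξ)
      (𝓝 (S.pvValue zs h j ξ + Complex.I / 2 * h j ξ)) := by
  obtain ⟨K, hK⟩ := id hh
  have h1 := tendsto_cauchyIntegral_inner (S.radius_pos j) (hK j) hξ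
  have h2 : Complex.I / 2 * h j ξ = 1 / (2 * Real.pi) * (Real.pi * Complex.I * h j ξ) := by
    have : (Real.pi : ℂ) ≠ 0 := by exact_mod_cast Real.pi_ne_zero
    field_simp
  rw [h2]
  refine hb.tendsto_potential_aux hzs hh hξ (fun z hz => ball_disjoint_contour hz) ?_
  have h3 : S.cauchyMean h j ξ j + Real.pi * Complex.I * h j ξ =
      (∮ η in C(S.center j, S.radius j), ((h j η : ℂ) - h j ξ) * (η - ξ)⁻¹) +
      2 * Real.pi * Complex.I * h j ξ := by
    rw [cauchyMean, if_pos rfl]; ring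
  rw [h3]
  exact h1

/-- Boundary values of the potential from the exterior domain. -/
theorem tendsto_potential_outer {j : Fin n} {ξ : ℂ} (hξ : ξ ∈ S.circle j) :
    Tendsto (fun z : ℂ => S.potential zs h z) (𝓝[S.exteriorPlane] ξ)
      (𝓝 (S.pvValue zs h j ξ - Complex.I / 2 * h j ξ)) := by
  obtain ⟨K, hK⟩ := id hh
  have h1 := (tendsto_cauchyIntegral_outer (S.radius_pos j) (hK j) hξ).mono_left
    (nhdsWithin_mono ξ (fun z (hz : z ∈ S.exteriorPlane) => hz j))
  have h2 : S.pvValue zs h j ξ - Complex.I / 2 * h j ξ =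
      S.pvValue zs h j ξ + 1 / (2 * Real.pi) * (-(Real.pi * Complex.I * h j ξ)) := by
    have : (Real.pi : ℂ) ≠ 0 := by exact_mod_cast Real.pi_ne_zero
    field_simp
    ring
  rw [h2]
  refine hb.tendsto_potential_aux hzs hh hξ
    (fun z hz => S.notMem_contour_of_mem_exteriorPlane hz) ?_
  have h3 : S.cauchyMean h j ξ j + -(Real.pi * Complex.I * h j ξ) =
      ∮ η in C(S.center j, S.radius j), ((h j η : ℂ) - h j ξ) * (η - ξ)⁻¹ := by
    rw [cauchyMean, if_pos rfl]; ring
  rw [h3]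
  exact h1

/-- The principal value of the potential at a point of the circles. -/
theorem hasPV_coe {j : Fin n} {ξ : ℂ} (hξ : ξ ∈ S.circle j) :
    S.HasPV zs h ξ ξ (S.pvValue zs h j ξ) := by
  obtain ⟨K, hK⟩ := id hh
  have hδ := hb.margin.pos
  have hc := hh.cont
  have hξc : (ξ : OnePoint ℂ) ∈ S.collar (δ / 2) :=
    coe_mem_collar_of_openCollar (contour_subset_openCollar hδ (S.circle_subset_contour j hξ))
  rw [HasPV, pvValue]
  unfold truncPotential
  refine Tendsto.const_mul _ ?_
  rw [smoothInt, ← Finset.sum_add_distrib]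
  refine tendsto_finsetSum _ fun l _ => ?_
  have hr := S.radius_pos l
  have hsm : ContinuousOn (fun η => (h l η : ℂ) * (S.regKernel zs ξ η - cauchyTerm η zs))
      (Metric.sphere (S.center l) (S.radius l)) :=
    (hc l).mul (hb.continuousOn_smoothKernel_circle hzs hξc l)
  have hm0 : Measurable fun θ => ((h l (circleMap (S.center l) (S.radius l) θ) : ℝ) : ℂ) :=
    (continuous_comp_circleMap hr (hc l)).measurable
  have hm1 : Measurable fun θ => (circleMap (S.center l) (S.radius l) θ - ξ)⁻¹ :=
    ((continuous_circleMap _ _).measurable.sub_const _).inv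
  have hm2 := (continuous_comp_circleMap hr hsm).measurable
  obtain ⟨M, hM0, hM⟩ := hc.exists_bound
  obtain ⟨M', hM0', hM'⟩ := exists_norm_le_of_continuousOn_sphere hsm
  have h1 : Tendsto (fun ε : ℝ => ∮ η in C(S.center l, S.radius l),
      (if ε < dist η ξ then (h l η : ℂ) * (η - ξ)⁻¹ else 0)) (𝓝[>] 0)
      (𝓝 (S.cauchyMean h j ξ l)) := by
    by_cases hl : l = j
    · subst hl
      rw [cauchyMean, if_pos rfl]
      exact tendsto_cauchyIntegral_truncate hr (hK l) hξ
    · rw [cauchyMean, if_neg hl]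
      have h2 : ContinuousOn (fun η => (h l η : ℂ) * (η - ξ)⁻¹)
          (Metric.sphere (S.center l) (S.radius l)) := by
        refine (hc l).mul (ContinuousOn.inv₀ (by fun_prop) fun η hη h0 => ?_)
        exact notMem_circle_of_ne hl hξ (sub_eq_zero.mp h0 ▸ hη)
      obtain ⟨M2, -, hM2⟩ := exists_norm_le_of_continuousOn_sphere h2
      exact tendsto_circleIntegral_truncate hr ξ (hm0.mul hm1) hM2
  have h2 := tendsto_circleIntegral_truncate hr ξ hm2 hM'
  refine (h1.add h2).congr' ?_
  filter_upwards [self_mem_nhdsWithin] with ε hε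
  rw [← circleIntegral.integral_add]
  · refine circleIntegral.integral_congr hr.le fun η hη => ?_
    rw [hb.kernel_eq (S.circle_subset_contour l hη) hξc (hb.mem_collar_of_mem_exterior hzs),
      cauchyTerm_coe]
    split_ifs <;> ring
  · refine circleIntegrable_of_bounded (M := M * ε⁻¹) (Measurable.ite
      (measurableSet_lt_dist_circleMap _ _ ε ξ) (hm0.mul hm1) measurable_const) fun θ => ?_
    have hε' : 0 ≤ ε⁻¹ := inv_nonneg.mpr (le_of_lt hε)
    split_ifs with hlt
    · rw [norm_mul, norm_inv, ← dist_eq_norm]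
      exact mul_le_mul (hM l _ (circleMap_mem_sphere _ hr.le θ)) (inv_anti₀ hε hlt.le)
        (inv_nonneg.mpr dist_nonneg) hM0
    · rw [norm_zero]; positivity
  · refine circleIntegrable_of_bounded (M := M') (Measurable.ite
      (measurableSet_lt_dist_circleMap _ _ ε ξ) hm2 measurable_const) fun θ => ?_
    split_ifs
    · exact hM' _ (circleMap_mem_sphere _ hr.le θ)
    · rw [norm_zero]; exact hM0'

end KernelBound

end Potential

end CircleSystem

end CircularRH

end

noncomputable section

namespace CircularRH

theorem circleIntegral_congr_of_ne {c : ℂ} {r : ℝ} (hr : 0 < r) (ξ : ℂ) {f g : ℂ → ℂ}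
    (h : ∀ η ∈ Metric.sphere c r, η ≠ ξ → f η = g η) :
    ∮ η in C(c, r), f η = ∮ η in C(c, r), g η := by
  unfold circleIntegral
  refine intervalIntegral.integral_congr_ae ?_
  have h1 : ∀ᵐ θ : ℝ, circleMap c r θ ≠ ξ := by
    have := ((Set.countable_singleton ξ).preimage_circleMap c hr.ne').measure_zero
      MeasureTheory.volume
    rw [MeasureTheory.ae_iff]
    convert this using 2
    ext θ; simp
  filter_upwards [h1] with θ hθ _
  rw [h _ (circleMap_mem_sphere c hr.le θ) hθ]

namespace CircleSystem

/-! ### Quasiautomorphy and symmetry of the potential -/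

section Symmetry

variable {n : ℕ} {S : CircleSystem n} {h : Fin n → ℂ → ℝ}

/-- Reflection in a circle takes points outside near `ξ` to points inside near `ξ`. -/
theorem exists_tendsto_T {j : Fin n} {ξ : ℂ} (hξ : ξ ∈ S.circle j) :
    ∃ t : ℂ → ℂ, Tendsto t (𝓝[S.exteriorPlane] ξ)
      (𝓝[Metric.ball (S.center j) (S.radius j)] ξ) ∧
      ∀ z ∈ S.exteriorPlane, S.T j z = (t z : OnePoint ℂ) := by
  have hr := S.radius_pos j
  have hξ0 : conj (ξ - S.center j) ≠ 0 :=
    (map_ne_zero _).mpr (sub_ne_zero.mpr (S.ne_center_of_mem_circle hξ))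
  have hne : ∀ z ∈ S.exteriorPlane, z ≠ S.center j := fun z hz h => by
    have h1 := hz j
    rw [h, dist_self] at h1
    linarith
  refine ⟨fun z => S.center j + (S.radius j : ℂ) ^ 2 / conj (z - S.center j), ?_,
    fun z hz => S.T_coe_of_ne j (hne z hz)⟩
  refine tendsto_nhdsWithin_iff.mpr ⟨?_, ?_⟩
  · have h1 : ContinuousAt (fun z : ℂ => S.center j + (S.radius j : ℂ) ^ 2 /
        conj (z - S.center j)) ξ := by
      refine continuousAt_const.add (continuousAt_const.div ?_ hξ0)
      exact (Complex.continuous_conj.comp (continuous_id.sub continuous_const)).continuousAt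
    have h2 : S.center j + (S.radius j : ℂ) ^ 2 / conj (ξ - S.center j) = ξ := by
      rw [← S.conj_sub_of_mem_circle hξ, mul_div_cancel_right₀ _ hξ0, add_sub_cancel]
    have h3 := h1.tendsto
    rw [h2] at h3
    exact h3.mono_left nhdsWithin_le_nhds
  · filter_upwards [self_mem_nhdsWithin] with z hz
    have h1 := hz j
    have h2 : 0 < ‖z - S.center j‖ := norm_pos_iff.mpr (sub_ne_zero.mpr (hne z hz))
    rw [dist_eq_norm] at h1
    rw [Metric.mem_ball, dist_eq_norm, add_sub_cancel_left, norm_div, norm_pow, Complex.norm_conj,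
      Complex.norm_real, Real.norm_of_nonneg hr.le, div_lt_iff₀ h2, sq]
    exact mul_lt_mul_of_pos_left h1 hr

/-- Moving from `ξ` radially outwards stays in the exterior for small steps. This is needed for
uniqueness of outer limits. -/
theorem neBot_nhdsWithin_exteriorPlane {j : Fin n} {ξ : ℂ} (hξ : ξ ∈ S.circle j) :
    (𝓝[S.exteriorPlane] ξ).NeBot := by
  have hr := S.radius_pos j
  have hξn : ‖ξ - S.center j‖ = S.radius j := by rw [← dist_eq_norm]; exact hξ
  set g : ℝ → ℂ := fun s => ξ + s * (ξ - S.center j) with hg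
  have hgc : Continuous g := by fun_prop
  have hg0 : g 0 = ξ := by simp [g]
  have h1 : Tendsto g (𝓝[>] 0) (𝓝 ξ) := by
    have := hgc.tendsto 0
    rw [hg0] at this
    exact this.mono_left nhdsWithin_le_nhds
  have h2 : Tendsto g (𝓝[>] 0) (𝓝[S.exteriorPlane] ξ) := by
    refine tendsto_nhdsWithin_iff.mpr ⟨h1, ?_⟩
    have h3 : ∀ i, ∀ᶠ s : ℝ in 𝓝[>] 0, S.radius i < dist (g s) (S.center i) := by
      intro i
      by_cases hij : j = i
      · subst hij
        filter_upwards [self_mem_nhdsWithin] with s (hs : 0 < s)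
        have h4 : g s - S.center j = ((1 + s : ℝ) : ℂ) * (ξ - S.center j) := by
          simp only [hg]; push_cast; ring
        rw [dist_eq_norm, h4, norm_mul, hξn, Complex.norm_real, Real.norm_of_nonneg (by linarith)]
        nlinarith
      · have h5 : Tendsto (fun s => dist (g s) (S.center i)) (𝓝[>] 0) (𝓝 (dist ξ (S.center i))) :=
          h1.dist tendsto_const_nhds
        exact h5.eventually_const_lt (S.dist_of_mem_circle_ne hij hξ)
    filter_upwards [eventually_all.mpr h3] with s hs using hs
  exact h2.neBot

variable [NeZero n]

/-- `ξ` is fixed by `T_j`, so `T_0 ξ = (T_0 T_j) ξ` is in the orbit of a point of the circles. -/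
theorem T_zero_mem_Omega {j : Fin n} {ξ : ℂ} (hξ : ξ ∈ S.circle j) : S.T 0 ξ ∈ S.Omega := by
  refine Or.inr ⟨S.T 0 * S.T j, S.T_mul_T_mem 0 j, ξ, S.circle_subset_contour j hξ, ?_⟩
  rw [Equiv.Perm.mul_apply, S.T_of_mem_circle hξ]

theorem period_eq (zs : OnePoint ℂ) (h : Fin n → ℂ → ℝ) (j : Fin n) :
    S.period zs h j = (S.potential zs h (S.gen j zs)).im := by
  have : (1 / (2 * Real.pi) : ℂ) = ((1 / (2 * Real.pi) : ℝ) : ℂ) := by push_cast; rfl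
  rw [period, potential, this, Complex.im_ofReal_mul]
  rfl

theorem kernel_self (zs : OnePoint ℂ) (η : ℂ) : S.kernel zs zs η = 0 := by
  simp [kernel, kernelTerm]

theorem potential_self (zs : OnePoint ℂ) (h : Fin n → ℂ → ℝ) : S.potential zs h zs = 0 := by
  simp [potential, kernel_self, circleIntegral]

theorem potential_gen_zero (zs : OnePoint ℂ) (h : Fin n → ℂ → ℝ) :
    S.potential zs h (S.gen 0 zs) = 0 := by
  rw [gen_zero, Equiv.Perm.one_apply, potential_self]

namespace KernelBound

variable {zs p : OnePoint ℂ} {δ : ℝ} {b : S.group → ℝ} {P : S.group → ℂ}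
  (hb : S.KernelBound δ b P) (hzs : zs ∈ S.exterior) (hc : S.ContDensity h)
include hb hzs

theorem regular_base {σ : Equiv.Perm (OnePoint ℂ)} (hσ : σ ∈ S.group) : S.Regular zs (σ zs) :=
  hb.regular_smul hzs (hb.regular_of_mem_exterior hzs hzs) hσ

theorem regular_base_T : S.Regular zs (S.T 0 zs) :=
  hb.regular_T hzs (hb.regular_of_mem_exterior hzs hzs)

omit hb hzs in
theorem _root_.CircularRH.CircleSystem.Regular.circleIntegrable (hc : S.ContDensity h)
    (hp : S.Regular zs p) (l : Fin n) :
    CircleIntegrable (fun η => (h l η : ℂ) * S.kernel zs p η) (S.center l) (S.radius l) :=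
  circleIntegrable_mul (S.radius_pos l) (hc l) (hp.continuousOn.mono (S.circle_subset_contour l))

include hc

theorem potential_apply (hp : S.Regular zs p) {σ : Equiv.Perm (OnePoint ℂ)} (hσ : σ ∈ S.group) :
    S.potential zs h (σ p) = S.potential zs h p + S.potential zs h (σ zs) := by
  simp only [potential]
  rw [← mul_add, ← Finset.sum_add_distrib]
  congr 1
  refine Finset.sum_congr rfl fun l _ => ?_
  rw [← circleIntegral.integral_add (hp.circleIntegrable hc l)
    ((hb.regular_base hzs hσ).circleIntegrable hc l)]
  refine circleIntegral.integral_congr (S.radius_pos l).le fun η hη => ?_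
  have hη' := S.circle_subset_contour l hη
  rw [hb.kernel_apply hzs hη' (hp.summable hη') hσ, mul_add]

theorem potential_T (hp : S.Regular zs p) :
    conj (S.potential zs h (S.T 0 p)) =
      S.potential zs h p + conj (S.potential zs h (S.T 0 zs)) := by
  have key : ∀ l, (∮ η in C(S.center l, S.radius l), (h l η : ℂ) * S.kernel zs (S.T 0 p) η) -
      (∮ η in C(S.center l, S.radius l), (h l η : ℂ) * S.kernel zs (S.T 0 zs) η) =
      conj (∮ η in C(S.center l, S.radius l), (h l η : ℂ) * S.kernel zs p η) := by
    intro l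
    have hr := S.radius_pos l
    rw [← circleIntegral.integral_sub ((hb.regular_T hzs hp).circleIntegrable hc l)
      ((hb.regular_base_T hzs).circleIntegrable hc l)]
    unfold circleIntegral
    rw [← intervalIntegral.intervalIntegral_conj]
    congr 1; ext θ
    have hη : circleMap (S.center l) (S.radius l) θ ∈ S.circle l := circleMap_mem_sphere _ hr.le θ
    have h1 := hb.kernel_T hzs hη hp
    have h2 : circleMap 0 (S.radius l) θ = circleMap (S.center l) (S.radius l) θ - S.center l := by
      simp [circleMap]
    rw [deriv_circleMap, h2]
    set η := circleMap (S.center l) (S.radius l) θ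
    simp only [smul_eq_mul, map_mul, Complex.conj_ofReal, Complex.conj_I] at h1 ⊢
    -- Since `dη = i(η - c_l) dθ`, the factor `η - c_l` in the symmetry of the kernel is supplied by
    -- the differential; the minus sign there matches `conj i = -i`.
    linear_combination Complex.I * h l η * h1
  have h2 : S.potential zs h (S.T 0 p) - S.potential zs h (S.T 0 zs) =
      conj (S.potential zs h p) := by
    simp only [potential]
    rw [← mul_sub, ← Finset.sum_sub_distrib, Finset.sum_congr rfl fun l _ => key l, map_mul,
      map_sum]
    simp only [map_div₀, map_one, map_mul, Complex.conj_ofReal, Complex.conj_ofNat]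
  rw [← sub_eq_iff_eq_add, ← map_sub, h2, Complex.conj_conj]

/-- The principal value at the point `T_0(ξ)`, where `ξ` lies on the `j`-th circle. -/
theorem hasPV_T {j : Fin n} {ξ : ℂ} (hξ : ξ ∈ S.circle j) {v : ℂ} (hv : S.HasPV zs h ξ ξ v) :
    S.HasPV zs h (S.T 0 ξ) ξ (v - S.potential zs h (S.gen j zs)) := by
  have hδ := hb.margin.pos
  have hξc : (ξ : OnePoint ℂ) ∈ S.collar (δ / 2) :=
    S.contour_subset_collar (by linarith) (S.circle_subset_contour j hξ)
  have hz' := hb.mem_collar_of_mem_exterior hzs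
  have hreg := hb.regular_base hzs (S.gen_mem j)
  obtain ⟨M, hM0, hM⟩ := hc.exists_bound
  -- `T_0 ξ = σ_j⁻¹ ξ`, so the two kernels have the same singularity and differ by the continuous
  -- function `χ_{σ_j}`.
  have hker : ∀ η ∈ S.contour, S.kernel zs (S.T 0 ξ) η =
      S.kernel zs ξ η - S.kernel zs (S.gen j zs) η := by
    intro η hη
    have h1 := hb.kernel_apply hzs hη (hb.summable_of_mem_Omega hzs (T_zero_mem_Omega hξ) hη)
      (S.gen_mem j)
    have h2 : S.gen j (S.T 0 ξ) = (ξ : OnePoint ℂ) := by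
      rw [gen, Equiv.Perm.mul_apply, T_T, S.T_of_mem_circle hξ]
    rw [h2] at h1
    rw [h1, add_sub_cancel_right]
  have h1 : Tendsto (fun ε : ℝ => (1 / (2 * Real.pi) : ℂ) * ∑ l, ∮ η in C(S.center l, S.radius l),
      (if ε < dist η ξ then (h l η : ℂ) * S.kernel zs (S.gen j zs) η else 0)) (𝓝[>] 0)
      (𝓝 (S.potential zs h (S.gen j zs))) := by
    refine Tendsto.const_mul _ (tendsto_finsetSum _ fun l _ => ?_)
    have hcont : ContinuousOn (fun η => (h l η : ℂ) * S.kernel zs (S.gen j zs) η)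
        (Metric.sphere (S.center l) (S.radius l)) :=
      (hc l).mul (hreg.continuousOn.mono (S.circle_subset_contour l))
    obtain ⟨M', -, hM'⟩ := exists_norm_le_of_continuousOn_sphere hcont
    exact tendsto_circleIntegral_truncate (S.radius_pos l) ξ
      (continuous_comp_circleMap (S.radius_pos l) hcont).measurable hM'
  refine (Tendsto.sub hv h1).congr' ?_
  filter_upwards [self_mem_nhdsWithin] with ε hε
  rw [truncPotential, truncPotential, ← mul_sub, ← Finset.sum_sub_distrib]
  congr 1
  refine Finset.sum_congr rfl fun l _ => ?_
  have hr := S.radius_pos l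
  have hmem : ∀ θ, circleMap (S.center l) (S.radius l) θ ∈ S.circle l :=
    circleMap_mem_sphere _ hr.le
  have hcl : ContinuousOn (fun η => (h l η : ℂ)) (Metric.sphere (S.center l) (S.radius l)) := hc l
  have hcont1 := hb.continuousOn_smoothKernel_circle hzs hξc l
  obtain ⟨M1, hM10, hM1⟩ := exists_norm_le_of_continuousOn_sphere hcont1
  have hm0 := (continuous_comp_circleMap hr hcl).measurable
  have hcont2 : ContinuousOn (S.kernel zs (S.gen j zs))
    (Metric.sphere (S.center l) (S.radius l)) :=
    hreg.continuousOn.mono (S.circle_subset_contour l)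
  obtain ⟨M2, hM20, hM2⟩ := exists_norm_le_of_continuousOn_sphere hcont2
  have hform : ∀ θ, S.kernel zs ξ (circleMap (S.center l) (S.radius l) θ) =
      (circleMap (S.center l) (S.radius l) θ - ξ)⁻¹ +
        (S.regKernel zs ξ (circleMap (S.center l) (S.radius l) θ) -
          cauchyTerm (circleMap (S.center l) (S.radius l) θ) zs) := by
    intro θ
    rw [hb.kernel_eq (S.circle_subset_contour l (hmem θ)) hξc hz', cauchyTerm_coe]
    ring
  have hm1 : Measurable fun θ => S.kernel zs ξ (circleMap (S.center l) (S.radius l) θ) := by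
    simp only [hform]
    exact ((continuous_circleMap _ _).measurable.sub_const _).inv.add
      (continuous_comp_circleMap hr hcont1).measurable
  have hm2 := (continuous_comp_circleMap hr hcont2).measurable
  rw [← circleIntegral.integral_sub]
  · refine circleIntegral.integral_congr hr.le fun η hη => ?_
    simp only [hker η (S.circle_subset_contour l hη)]
    split_ifs <;> ring
  · refine circleIntegrable_of_bounded (M := M * (ε⁻¹ + M1)) (Measurable.ite
      (measurableSet_lt_dist_circleMap _ _ ε ξ) (hm0.mul hm1) measurable_const) fun θ => ?_
    have hε' : 0 ≤ ε⁻¹ := inv_nonneg.mpr (le_of_lt hε)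
    split_ifs with hlt
    · rw [norm_mul, hform]
      refine mul_le_mul (hM l _ (hmem θ)) ((norm_add_le _ _).trans
        (add_le_add ?_ (hM1 _ (hmem θ)))) (norm_nonneg _) hM0
      rw [norm_inv, ← dist_eq_norm]
      exact inv_anti₀ hε hlt.le
    · rw [norm_zero]; positivity
  · refine circleIntegrable_of_bounded (M := M * M2) (Measurable.ite
      (measurableSet_lt_dist_circleMap _ _ ε ξ) (hm0.mul hm2) measurable_const) fun θ => ?_
    split_ifs with hlt
    · rw [norm_mul]
      exact mul_le_mul (hM l _ (hmem θ)) (hM2 _ (hmem θ)) (norm_nonneg _) hM0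
    · rw [norm_zero]; positivity

theorem analyticOnNhd_potential :
    AnalyticOnNhd ℂ (fun z : ℂ => S.potential zs h z) S.exteriorPlane :=
  fun _ hz => (hb.differentiableOn_potential hzs hc).analyticAt (S.isOpen_exteriorPlane.mem_nhds hz)

omit hc

/-- Let `z → ξ` from outside; then `T_j z = σ_j T_0 z → ξ` from inside, and symmetry with
quasiautomorphy relates the potentials at these points. Conjugation turns the outer term `-(i/2) h`
into the inner one, so `h` drops out and only the multipliers remain. -/
theorem pvValue_sub_conj (hh : S.LipDensity h) {j : Fin n} {ξ : ℂ} (hξ : ξ ∈ S.circle j) :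
    S.pvValue zs h j ξ - conj (S.pvValue zs h j ξ) =
      S.potential zs h (S.T 0 zs) + S.potential zs h (S.gen j zs) := by
  have hne := neBot_nhdsWithin_exteriorPlane hξ
  obtain ⟨t, ht, htz⟩ := exists_tendsto_T hξ
  have h1 := (hb.tendsto_potential_inner hzs hh hξ).comp ht
  have h2 := ((Complex.continuous_conj.tendsto _).comp
    (hb.tendsto_potential_outer hzs hh hξ)).add_const
      (S.potential zs h (S.T 0 zs) + S.potential zs h (S.gen j zs))
  have h3 := tendsto_nhds_unique (h1.congr' ?_) h2
  · simp only [map_sub, map_mul, map_div₀, Complex.conj_I, Complex.conj_ofReal,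
      Complex.conj_ofNat] at h3
    linear_combination h3
  · filter_upwards [self_mem_nhdsWithin] with z hz
    have hreg := hb.regular_of_mem_exterior hzs (S.coe_mem_exterior.mpr hz)
    have h4 : S.T j z = S.gen j (S.T 0 z) := by
      rw [gen, Equiv.Perm.mul_apply, T_T]
    have h5 := congrArg conj (hb.potential_T hzs hh.cont hreg)
    rw [Complex.conj_conj, map_add, Complex.conj_conj] at h5
    simp only [Function.comp_apply]
    rw [← htz z hz, h4, hb.potential_apply hzs hh.cont (hb.regular_T hzs hreg) (S.gen_mem j), h5,
      add_assoc]

theorem two_mul_im_pvValue (hh : S.LipDensity h) {j : Fin n} {ξ : ℂ} (hξ : ξ ∈ S.circle j) :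
    2 * (S.pvValue zs h j ξ).im =
      (S.potential zs h (S.T 0 zs) + S.potential zs h (S.gen j zs)).im := by
  rw [← hb.pvValue_sub_conj hzs hh hξ, Complex.sub_im, Complex.conj_im]
  ring

omit hb hzs [NeZero n] in
theorem lipDensity_const (d : Fin n → ℝ) : S.LipDensity fun l _ => d l :=
  ⟨0, fun l η _ ξ _ => by simp⟩

/-- The multipliers of the potential of a locally constant density. -/
theorem potential_const (d : Fin n → ℝ) (j : Fin n) :
    S.potential zs (fun l _ => d l) (S.gen j zs) = Complex.I * (d j - d 0) := by
  have hh := lipDensity_const (S := S) d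
  set h : Fin n → ℂ → ℝ := fun l _ => d l with hdef
  -- The outer boundary values of `Ψ` have imaginary part equal to a constant minus `d_j / 2` on the
  -- `j`-th circle. So `Ψ` is constant in the exterior, and the constant is zero because `Ψ(ζ_*) =
  -- 0`.
  have h1 := S.eq_of_im_const (f := fun z : ℂ => S.potential zs h z)
    (hb.analyticOnNhd_potential hzs hh.cont)
    (hb.tendsto_potential_infty hzs hh.cont)
    (e := fun j => (S.potential zs h (S.T 0 zs) + S.potential zs h (S.gen j zs)).im / 2 - d j / 2)
    fun j ξ hξ => ⟨_, hb.tendsto_potential_outer hzs hh hξ, by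
      rw [← hb.two_mul_im_pvValue hzs hh hξ]
      simp [hdef]
      ring⟩
  have hL : S.potential zs h ∞ = 0 := by
    rcases hzs with hz | ⟨z, hz, hzz⟩
    · have := potential_self (S := S) zs h
      rwa [hz] at this ⊢
    · rw [← h1 z hz]
      simp only at hzz
      rw [hzz, potential_self]
  have h2 : ∀ j, Complex.I * d j =
      S.potential zs h (S.T 0 zs) + S.potential zs h (S.gen j zs) := by
    intro j
    obtain ⟨ξ, hξ, -⟩ := S.exists_mem_circle_ne j 0
    have hne := neBot_nhdsWithin_exteriorPlane hξ
    have h3 : Tendsto (fun z : ℂ => S.potential zs h z) (𝓝[S.exteriorPlane] ξ) (𝓝 0) := by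
      refine tendsto_const_nhds.congr' ?_
      filter_upwards [self_mem_nhdsWithin] with z hz
      rw [h1 z hz, hL]
    have h4 := tendsto_nhds_unique (hb.tendsto_potential_outer hzs hh hξ) h3
    have h5 : S.pvValue zs h j ξ = Complex.I / 2 * d j := by
      linear_combination h4
    rw [← hb.pvValue_sub_conj hzs hh hξ, h5]
    simp only [map_mul, map_div₀, Complex.conj_I, Complex.conj_ofReal, Complex.conj_ofNat]
    ring
  have h0 := h2 0
  rw [potential_gen_zero, add_zero] at h0
  linear_combination h0 - h2 j

omit hb hzs in
theorem _root_.CircularRH.CircleSystem.Regular.potential_sub_const (hc : S.ContDensity h)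
    (d : Fin n → ℝ) (hp : S.Regular zs p) :
    S.potential zs (fun l η => h l η - d l) p =
      S.potential zs h p - S.potential zs (fun l _ => d l) p := by
  simp only [potential]
  rw [← mul_sub, ← Finset.sum_sub_distrib]
  congr 1
  refine Finset.sum_congr rfl fun l _ => ?_
  rw [← circleIntegral.integral_sub (hp.circleIntegrable hc l)
    (hp.circleIntegrable (lipDensity_const d).cont l)]
  congr 1; ext η; push_cast; ring

include hc

/-- This is the origin of the solvability condition: requiring the periods of `h - d` to vanish
determines the differences `d_j - d_0` and nothing else. -/
theorem period_sub_const (d : Fin n → ℝ) (j : Fin n) :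
    S.period zs (fun l η => h l η - d l) j = S.period zs h j - (d j - d 0) := by
  rw [period_eq, (hb.regular_base hzs (S.gen_mem j)).potential_sub_const hc d,
    hb.potential_const hzs, period_eq]
  simp

end KernelBound

end Symmetry

end CircleSystem

end CircularRH

end

noncomputable section

namespace CircularRH

/-! ### Lipschitz continuity of the data -/

/-- Lipschitz continuity on a set, with an unspecified constant. -/
def IsLip (f : ℂ → ℂ) (s : Set ℂ) : Prop :=
  ∃ K, ∀ η ∈ s, ∀ ξ ∈ s, ‖f η - f ξ‖ ≤ K * ‖η - ξ‖

namespace IsLip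

variable {f g : ℂ → ℂ} {s : Set ℂ}

theorem const (c : ℂ) : IsLip (fun _ => c) s := ⟨0, fun η _ ξ _ => by simp⟩

theorem id : IsLip (fun z => z) s := ⟨1, fun η _ ξ _ => by simp⟩

theorem add (hf : IsLip f s) (hg : IsLip g s) : IsLip (fun z => f z + g z) s := by
  obtain ⟨K, hK⟩ := hf
  obtain ⟨L, hL⟩ := hg
  refine ⟨K + L, fun η hη ξ hξ => ?_⟩
  rw [add_sub_add_comm, add_mul]
  exact (norm_add_le _ _).trans (add_le_add (hK η hη ξ hξ) (hL η hη ξ hξ))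

theorem const_mul (c : ℂ) (hf : IsLip f s) : IsLip (fun z => c * f z) s := by
  obtain ⟨K, hK⟩ := hf
  refine ⟨‖c‖ * K, fun η hη ξ hξ => ?_⟩
  rw [← mul_sub, norm_mul, mul_assoc]
  exact mul_le_mul_of_nonneg_left (hK η hη ξ hξ) (norm_nonneg c)

theorem comp_conj (hf : IsLip f s) : IsLip (fun z => conj (f z)) s := by
  obtain ⟨K, hK⟩ := hf
  refine ⟨K, fun η hη ξ hξ => ?_⟩
  rw [← map_sub, Complex.norm_conj]
  exact hK η hη ξ hξ

theorem ofReal_re (hf : IsLip f s) : IsLip (fun z => ((f z).re : ℂ)) s := by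
  obtain ⟨K, hK⟩ := hf
  refine ⟨K, fun η hη ξ hξ => ?_⟩
  rw [← Complex.ofReal_sub, ← Complex.sub_re, Complex.norm_real]
  exact (Complex.abs_re_le_norm _).trans (hK η hη ξ hξ)

theorem ofReal_im (hf : IsLip f s) : IsLip (fun z => ((f z).im : ℂ)) s := by
  obtain ⟨K, hK⟩ := hf
  refine ⟨K, fun η hη ξ hξ => ?_⟩
  rw [← Complex.ofReal_sub, ← Complex.sub_im, Complex.norm_real]
  exact (Complex.abs_im_le_norm _).trans (hK η hη ξ hξ)

theorem sum {ι : Type*} (t : Finset ι) {F : ι → ℂ → ℂ} (hF : ∀ i ∈ t, IsLip (F i) s) :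
    IsLip (fun z => ∑ i ∈ t, F i z) s := by
  classical
  induction t using Finset.induction_on with
  | empty => simpa using const 0
  | insert i t hi ih =>
    simp only [Finset.sum_insert hi]
    exact (hF i (Finset.mem_insert_self i t)).add
      (ih fun k hk => hF k (Finset.mem_insert_of_mem hk))

theorem congr (hf : IsLip f s) (h : ∀ z ∈ s, g z = f z) : IsLip g s := by
  obtain ⟨K, hK⟩ := hf
  exact ⟨K, fun η hη ξ hξ => by rw [h η hη, h ξ hξ]; exact hK η hη ξ hξ⟩

end IsLip

namespace CircleSystem

variable {n : ℕ} {S : CircleSystem n} {h : Fin n → ℂ → ℝ}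

theorem lipDensity_of_forall (hh : ∀ l, IsLip (fun η => (h l η : ℂ)) (S.circle l)) :
    S.LipDensity h := by
  choose K hK using hh
  refine ⟨∑ l, |K l|, fun l η hη ξ hξ => (hK l η hη ξ hξ).trans ?_⟩
  refine mul_le_mul_of_nonneg_right ((le_abs_self _).trans ?_) (norm_nonneg _)
  exact Finset.single_le_sum (f := fun l => |K l|) (fun l _ => abs_nonneg _) (Finset.mem_univ l)

theorem LipDensity.isLip (hh : S.LipDensity h) (l : Fin n) :
    IsLip (fun η => (h l η : ℂ)) (S.circle l) := by
  obtain ⟨K, hK⟩ := hh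
  exact ⟨K, hK l⟩

theorem isLip_cauchyInt [NeZero n] (hc : S.ContDensity h) {j l : Fin n} (hlj : l ≠ j) :
    IsLip (S.cauchyInt h l) (S.circle j) := by
  obtain ⟨δ, hm⟩ := S.exists_isMargin
  have hδ := hm.pos
  obtain ⟨M, hM0, hM⟩ := hc.exists_bound
  have hd : ∀ ξ ∈ S.circle j, ∀ η ∈ S.circle l, δ ≤ ‖η - ξ‖ := by
    intro ξ hξ η hη
    have h1 := hm.sep l j hlj
    have h2 : dist η (S.center l) = S.radius l := hη
    have h3 : dist ξ (S.center j) = S.radius j := hξ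
    have h4 := dist_triangle4 (S.center l) η ξ (S.center j)
    rw [dist_comm (S.center l) η] at h4
    rw [← dist_eq_norm]
    linarith
  have hcont : ∀ ξ ∈ S.circle j, ContinuousOn (fun η : ℂ => (η - ξ)⁻¹)
      (Metric.sphere (S.center l) (S.radius l)) := fun ξ hξ =>
    (continuousOn_id.sub continuousOn_const).inv₀ fun η hη =>
      norm_pos_iff.mp (hδ.trans_le (hd ξ hξ η hη))
  refine ⟨2 * Real.pi * S.radius l * M * (1 / δ ^ 2), fun ξ hξ ξ' hξ' => ?_⟩
  rw [mul_assoc (2 * Real.pi * S.radius l * M)]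
  refine norm_circleIntegral_mul_sub_le (S.radius_pos l) (hc l) (hM l) (hcont ξ hξ) (hcont ξ' hξ')
    (fun η hη => ?_) hM0
  have h1 := hd ξ hξ η hη
  have h2 := hd ξ' hξ' η hη
  have h3 : η - ξ ≠ 0 := norm_pos_iff.mp (hδ.trans_le h1)
  have h4 : η - ξ' ≠ 0 := norm_pos_iff.mp (hδ.trans_le h2)
  rw [inv_sub_inv h3 h4, sub_sub_sub_cancel_left, norm_div, norm_mul, div_eq_inv_mul, sq, one_div]
  exact mul_le_mul_of_nonneg_right (inv_anti₀ (by positivity)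
    (mul_le_mul h1 h2 hδ.le (norm_nonneg _))) (norm_nonneg _)

/-- The other circles and the regular kernel contribute Lipschitz terms automatically. The singular
integral over the circle carrying `ξ` is not controlled by these arguments and enters as a
hypothesis. -/
theorem KernelBound.isLip_pvValue [NeZero n] {zs : OnePoint ℂ} {δ : ℝ} {b : S.group → ℝ}
    {P : S.group → ℂ} (hb : S.KernelBound δ b P) (hzs : zs ∈ S.exterior) (hh : S.LipDensity h)
    {j : Fin n} (hj : IsLip (fun ξ => ∮ η in C(S.center j, S.radius j),
      ((h j η : ℂ) - h j ξ) * (η - ξ)⁻¹) (S.circle j)) :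
    IsLip (S.pvValue zs h j) (S.circle j) := by
  refine IsLip.const_mul _ (IsLip.add (IsLip.sum _ fun l _ => ?_) ?_)
  · unfold cauchyMean
    by_cases hl : l = j
    · simp only [if_pos hl]
      exact hj.add ((hh.isLip j).const_mul _)
    · simp only [if_neg hl]
      exact isLip_cauchyInt hh.cont hl
  · obtain ⟨C, hC⟩ := hb.exists_smoothInt_lipschitz hzs hh.cont
    have hmem : ∀ ξ ∈ S.circle j, (ξ : OnePoint ℂ) ∈ S.collar (δ / 2) := fun ξ hξ =>
      coe_mem_collar_of_openCollar
        (contour_subset_openCollar hb.margin.pos (S.circle_subset_contour j hξ))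
    exact ⟨C, fun η hη ξ hξ => hC η ξ (hmem η hη) (hmem ξ hξ)⟩

end CircleSystem

namespace ElasticData

variable {n : ℕ} {E : ElasticData n} {S : CircleSystem n} {a : Fin n → ℝ}

theorem lipDensity_density₁ : S.LipDensity (E.density₁ a) := by
  refine CircleSystem.lipDensity_of_forall fun l => ?_
  refine IsLip.congr ((IsLip.id.const_mul E.c).ofReal_im.add (IsLip.const (-(a l : ℂ))))
    fun z _ => ?_
  simp [density₁, sub_eq_add_neg]

/-- The singular part of the principal value of the potential of `density₁`. -/
theorem circleIntegral_density₁ {j : Fin n} {ξ : ℂ} (hξ : ξ ∈ S.circle j) :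
    ∮ η in C(S.center j, S.radius j), ((E.density₁ a j η : ℂ) - E.density₁ a j ξ) * (η - ξ)⁻¹ =
      Real.pi * (conj E.c * conj (ξ - S.center j)) := by
  have hr := S.radius_pos j
  have hcont : ContinuousOn (fun η : ℂ => (η - S.center j)⁻¹)
      (Metric.sphere (S.center j) (S.radius j)) :=
    (continuousOn_id.sub continuousOn_const).inv₀ fun η hη =>
      sub_ne_zero.mpr (S.ne_center_of_mem_circle hη)
  -- On the circle `conj (η - c_j) = r²/(η - c_j)`, which makes the difference quotient of `Im(cη)`
  -- a rational function of `η` whose only pole is the centre. The value at `η = ξ` is irrelevant to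
  -- the integral.
  rw [circleIntegral_congr_of_ne hr ξ (g := fun η => E.c / (2 * Complex.I) +
    conj E.c * conj (ξ - S.center j) / (2 * Complex.I) * (η - S.center j)⁻¹)]
  · rw [circleIntegral.integral_add (continuousOn_const.circleIntegrable hr.le)
      (circleIntegrable_mul hr continuousOn_const hcont), circleIntegral.integral_const_mul,
      circleIntegral.integral_sub_center_inv _ hr.ne']
    have h0 : (∮ _ in C(S.center j, S.radius j), E.c / (2 * Complex.I)) = 0 := by
      have h1 := circleIntegral.integral_sub_zpow_of_ne (n := 0) (by norm_num)
        (S.center j) (S.center j) (S.radius j)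
      have h2 := circleIntegral.integral_const_mul (E.c / (2 * Complex.I)) (fun _ => (1 : ℂ))
        (S.center j) (S.radius j)
      simp only [zpow_zero] at h1
      simpa only [h1, mul_one, mul_zero] using h2
    rw [h0]
    field_simp [Complex.I_ne_zero]
    ring
  · intro η hη hne
    have h1 : η - S.center j ≠ 0 := sub_ne_zero.mpr (S.ne_center_of_mem_circle hη)
    have h2 : ξ - S.center j ≠ 0 := sub_ne_zero.mpr (S.ne_center_of_mem_circle hξ)
    have h3 := S.conj_sub_of_mem_circle hη
    have h4 := S.conj_sub_of_mem_circle hξ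
    have h5 : η - ξ ≠ 0 := sub_ne_zero.mpr hne
    have h6 : (E.density₁ a j η : ℂ) - E.density₁ a j ξ =
        (E.c * (η - ξ) - conj E.c * (conj (η - S.center j) - conj (ξ - S.center j))) /
          (2 * Complex.I) := by
      rw [density₁, density₁, ← Complex.ofReal_sub, sub_sub_sub_cancel_right, ← Complex.sub_im,
        ← mul_sub, Complex.im_eq_sub_conj]
      simp only [map_mul, map_sub]
      ring
    have h7 : conj (η - S.center j) - conj (ξ - S.center j) =
        -((η - ξ) * conj (ξ - S.center j) * (η - S.center j)⁻¹) := by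
      field_simp
      linear_combination h3 - h4
    rw [h6, h7]
    field_simp [Complex.I_ne_zero]
    ring

end ElasticData

namespace ElasticData

open CircleSystem

variable {n : ℕ} [NeZero n] {E : ElasticData n} {S : CircleSystem n} {a : Fin n → ℝ} {C₁ : ℝ}
  {zs : OnePoint ℂ} {δ : ℝ} {b : S.group → ℝ} {P : S.group → ℂ}

section

variable (hb : S.KernelBound δ b P) (hzs : zs ∈ S.exterior)
include hb hzs

theorem pv_density₁ {j : Fin n} {ξ : ℂ} (hξ : ξ ∈ S.circle j) :
    S.pv zs (E.density₁ a) ξ ξ = S.pvValue zs (E.density₁ a) j ξ :=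
  (hb.hasPV_coe hzs lipDensity_density₁ hξ).limUnder_eq

theorem pv_density₁_T {j : Fin n} {ξ : ℂ} (hξ : ξ ∈ S.circle j) :
    S.pv zs (E.density₁ a) (S.T 0 ξ) ξ =
      S.pvValue zs (E.density₁ a) j ξ - S.potential zs (E.density₁ a) (S.gen j zs) :=
  (hb.hasPV_T hzs lipDensity_density₁.cont hξ
    (hb.hasPV_coe hzs lipDensity_density₁ hξ)).limUnder_eq

/-- By the closed form of the singular integral both principal values in `F` are Lipschitz in `ξ`.
Consequently `g₂` is an admissible density for the second potential. -/
theorem isLip_F (j : Fin n) : IsLip (E.F S zs a C₁ j) (S.circle j) := by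
  have h1 : IsLip (S.pvValue zs (E.density₁ a) j) (S.circle j) := by
    refine hb.isLip_pvValue hzs lipDensity_density₁
      (IsLip.congr ((IsLip.comp_conj (IsLip.add IsLip.id
      (IsLip.const (-S.center j)))).const_mul (Real.pi * conj E.c)) fun ξ hξ => ?_)
    rw [circleIntegral_density₁ hξ, sub_eq_add_neg, mul_assoc]
  refine IsLip.congr ((((IsLip.id.const_mul E.c).add
    (((lipDensity_density₁ (E := E) (a := a)).isLip j).const_mul (-Complex.I))).add
    (h1.add (h1.comp_conj.add (IsLip.const
      (-conj (S.potential zs (E.density₁ a) (S.gen j zs))))))).add (IsLip.const (C₁ : ℂ)))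
    fun ξ hξ => ?_
  rw [F, pv_density₁ hb hzs hξ, pv_density₁_T hb hzs hξ, map_sub, density₁]
  ring

theorem lipDensity_g₂ : S.LipDensity (E.g₂ S zs a C₁) :=
  lipDensity_of_forall fun j => (((isLip_F hb hzs j).const_mul _).add
    (IsLip.id.const_mul _)).ofReal_re

theorem lipDensity_density₂ (d : Fin n → ℝ) : S.LipDensity (E.density₂ S zs a C₁ d) :=
  lipDensity_of_forall fun j => IsLip.congr (((lipDensity_g₂ hb hzs).isLip j).add
    (IsLip.const (-(d j : ℂ)))) fun ξ _ => by rw [density₂]; push_cast; ring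

theorem continuousOn_g₂ (j : Fin n) : ContinuousOn (E.g₂ S zs a C₁ j) (S.circle j) := by
  have h1 := (lipDensity_g₂ (E := E) (a := a) (C₁ := C₁) hb hzs).cont j
  exact (Complex.continuous_re.comp_continuousOn h1).congr fun ξ _ => by simp

end

end ElasticData

end CircularRH

end

noncomputable section

namespace CircularRH

namespace CircleSystem

variable {n : ℕ} [NeZero n] {S : CircleSystem n} {h : Fin n → ℂ → ℝ}

/-! ### Invariance of the region of discontinuity -/

theorem infty_mem_offCircles : ∞ ∈ S.offCircles :=
  ⟨1, one_mem _, ∞, Or.inl S.infty_mem_exterior, rfl⟩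

theorem mem_offCircles_of_mem_exterior {p : OnePoint ℂ} (hp : p ∈ S.exterior) :
    p ∈ S.offCircles := ⟨1, one_mem _, p, Or.inl hp, rfl⟩

theorem smul_mem_offCircles {σ : Equiv.Perm (OnePoint ℂ)} (hσ : σ ∈ S.group) {p : OnePoint ℂ}
    (hp : p ∈ S.offCircles) : σ p ∈ S.offCircles := by
  obtain ⟨ρ, hρ, q, hq, rfl⟩ := hp
  exact ⟨σ * ρ, mul_mem hσ hρ, q, hq, rfl⟩

theorem T_mem_offCircles (j : Fin n) {p : OnePoint ℂ} (hp : p ∈ S.offCircles) :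
    S.T j p ∈ S.offCircles := by
  obtain ⟨ρ, hρ, q, hq, rfl⟩ := hp
  refine ⟨S.T j * ρ * S.T 0, S.T_mul_mul_T_mem j 0 hρ, S.T 0 q, ?_, ?_⟩
  · rw [T_T]; exact hq.symm
  · simp only [Equiv.Perm.mul_apply, T_T]

theorem gen_T_zero (j : Fin n) (p : OnePoint ℂ) : S.gen j (S.T 0 p) = S.T j p := by
  rw [gen, Equiv.Perm.mul_apply, T_T]

/-! ### The symmetrized potential -/

variable (S) in
/-- The symmetrized potential `Ψ(ζ) + conj Ψ(T_0(ζ)) + C`. -/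
def symPotential (zs : OnePoint ℂ) (h : Fin n → ℂ → ℝ) (C : ℝ) (p : OnePoint ℂ) : ℂ :=
  S.potential zs h p + conj (S.potential zs h (S.T 0 p)) + C

theorem conj_symPotential_T_zero (zs : OnePoint ℂ) (h : Fin n → ℂ → ℝ) (C : ℝ) (p : OnePoint ℂ) :
    conj (S.symPotential zs h C (S.T 0 p)) = S.symPotential zs h C p := by
  simp only [symPotential, T_T, map_add, Complex.conj_conj, Complex.conj_ofReal]
  ring

namespace KernelBound

variable {zs p : OnePoint ℂ} {δ : ℝ} {b : S.group → ℝ} {P : S.group → ℂ} {C : ℝ}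
  (hb : S.KernelBound δ b P) (hzs : zs ∈ S.exterior)
include hb hzs

theorem symPotential_eq (hc : S.ContDensity h) (hp : S.Regular zs p) :
    S.symPotential zs h C p =
      2 * S.potential zs h p + conj (S.potential zs h (S.T 0 zs)) + C := by
  rw [symPotential, hb.potential_T hzs hc hp]
  ring

section

variable (hh : S.LipDensity h)
include hh

/-- On the circle `0` the multiplier of `σ_0 = id` vanishes, so `Ψ(T_0 ζ_*)` is a number minus its
conjugate. -/
theorem conj_potential_T_zero :
    conj (S.potential zs h (S.T 0 zs)) = -S.potential zs h (S.T 0 zs) := by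
  obtain ⟨ξ, hξ, -⟩ := S.exists_mem_circle_ne 0 0
  have h1 := hb.pvValue_sub_conj hzs hh hξ
  rw [potential_gen_zero, add_zero] at h1
  rw [← h1, map_sub, Complex.conj_conj, neg_sub]

theorem conj_potential_gen (j : Fin n) :
    conj (S.potential zs h (S.gen j zs)) = -S.potential zs h (S.gen j zs) := by
  obtain ⟨ξ, hξ, -⟩ := S.exists_mem_circle_ne j 0
  have h1 := hb.pvValue_sub_conj hzs hh hξ
  have h2 := congrArg conj h1
  rw [map_sub, map_add, Complex.conj_conj, hb.conj_potential_T_zero hzs hh] at h2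
  linear_combination -h2 - h1

theorem potential_gen_eq_zero {j : Fin n} (hj : S.period zs h j = 0) :
    S.potential zs h (S.gen j zs) = 0 := by
  have h1 := Complex.add_conj (S.potential zs h (S.gen j zs))
  rw [hb.conj_potential_gen hzs hh, add_neg_cancel] at h1
  refine Complex.ext ?_ (by rw [← period_eq, hj, Complex.zero_im])
  have h2 : 2 * (S.potential zs h (S.gen j zs)).re = 0 := by exact_mod_cast h1.symm
  simpa using h2

/-- The symmetrized potential is `2Ψ` plus a constant, and the multipliers `Ψ(σ ζ_*)` are additive
in `σ`. Hence automorphy means that they vanish on generators; being purely imaginary there, they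
vanish with the periods. -/
theorem automorphic_symPotential_iff :
    S.Automorphic (S.symPotential zs h C) ↔ ∀ j, S.period zs h j = 0 := by
  constructor
  · intro hA j
    have h1 := hA _ (S.gen_mem j) ∞ S.infty_mem_offCircles
    have h2 := hb.regular_of_mem_offCircles hzs (S.infty_mem_offCircles)
    rw [hb.symPotential_eq hzs hh.cont (hb.regular_smul hzs h2 (S.gen_mem j)),
      hb.symPotential_eq hzs hh.cont h2, hb.potential_apply hzs hh.cont h2 (S.gen_mem j)] at h1
    have h3 : S.potential zs h (S.gen j zs) = 0 := by linear_combination h1 / 2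
    rw [period_eq, h3, Complex.zero_im]
  · intro hper σ hσ p hp
    have h2 := hb.regular_of_mem_offCircles hzs hp
    have h3 : S.potential zs h (σ zs) = 0 := by
      induction hσ using Subgroup.closure_induction with
      | mem x hx =>
        obtain ⟨j, rfl⟩ := hx
        exact hb.potential_gen_eq_zero hzs hh (hper j)
      | one => rw [Equiv.Perm.one_apply, potential_self]
      | mul x y hx hy ihx ihy =>
        rw [Equiv.Perm.mul_apply, hb.potential_apply hzs hh.cont (hb.regular_base hzs hy) hx,
          ihx, ihy, add_zero]
      | inv x hx ih =>
        have h4 := hb.potential_apply hzs hh.cont (hb.regular_base hzs (inv_mem hx)) hx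
        rw [show x (x⁻¹ zs) = zs from x.apply_symm_apply zs, potential_self, ih, add_zero] at h4
        exact h4.symm
    rw [hb.symPotential_eq hzs hh.cont (hb.regular_smul hzs h2 hσ),
      hb.symPotential_eq hzs hh.cont h2, hb.potential_apply hzs hh.cont h2 hσ, h3, add_zero]

theorem symmetric_symPotential (hper : ∀ j, S.period zs h j = 0) :
    S.Symmetric (S.symPotential zs h C) := by
  intro j p hp
  rw [← gen_T_zero, (hb.automorphic_symPotential_iff hzs hh).mpr hper _ (S.gen_mem j) _
    (S.T_mem_offCircles 0 hp), conj_symPotential_T_zero]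

theorem conj_pvValue_sub {j : Fin n} {ξ : ℂ} (hξ : ξ ∈ S.circle j) :
    conj (S.pvValue zs h j ξ - S.potential zs h (S.gen j zs)) =
      S.pvValue zs h j ξ + conj (S.potential zs h (S.T 0 zs)) := by
  have h1 := hb.pvValue_sub_conj hzs hh hξ
  rw [map_sub, hb.conj_potential_gen hzs hh, hb.conj_potential_T_zero hzs hh]
  linear_combination -h1

theorem hasInnerValue_symPotential {j : Fin n} {ξ : ℂ} (hξ : ξ ∈ S.circle j) :
    S.HasInnerValue (S.symPotential zs h C) j ξ
      (Complex.I * h j ξ + S.pvValue zs h j ξ +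
        conj (S.pvValue zs h j ξ - S.potential zs h (S.gen j zs)) + C) := by
  have hδ := hb.margin.pos
  rw [hb.conj_pvValue_sub hzs hh hξ]
  have h1 := (((hb.tendsto_potential_inner hzs hh hξ).const_mul 2).add_const
    (conj (S.potential zs h (S.T 0 zs)))).add_const (C : ℂ)
  have h2 : ∀ x y z w : ℂ, Complex.I * x + y + (y + z) + w =
      2 * (y + Complex.I / 2 * x) + z + w := fun x y z w => by ring
  rw [h2]
  refine h1.congr' ?_
  filter_upwards [self_mem_nhdsWithin, nhdsWithin_le_nhds ((isOpen_openCollar δ).mem_nhds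
    (contour_subset_openCollar hδ (S.circle_subset_contour j hξ)))] with z hz hzo
  exact (hb.symPotential_eq hzs hh.cont (hb.regular_of_mem_collar hzs
    (coe_mem_collar_of_openCollar hzo) fun η hη hηz => ball_disjoint_contour hz
      (by rwa [OnePoint.coe_eq_coe.mp hηz]))).symm

theorem hasOuterValue_symPotential {j : Fin n} {ξ : ℂ} (hξ : ξ ∈ S.circle j) :
    S.HasOuterValue (S.symPotential zs h C) ξ
      (-(Complex.I * h j ξ) + S.pvValue zs h j ξ +
        conj (S.pvValue zs h j ξ - S.potential zs h (S.gen j zs)) + C) := by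
  rw [hb.conj_pvValue_sub hzs hh hξ]
  have h1 := (((hb.tendsto_potential_outer hzs hh hξ).const_mul 2).add_const
    (conj (S.potential zs h (S.T 0 zs)))).add_const (C : ℂ)
  have h2 : ∀ x y z w : ℂ, -(Complex.I * x) + y + (y + z) + w =
      2 * (y - Complex.I / 2 * x) + z + w := fun x y z w => by ring
  rw [h2]
  refine h1.congr' ?_
  filter_upwards [self_mem_nhdsWithin] with z hz
  exact (hb.symPotential_eq hzs hh.cont
    (hb.regular_of_mem_exterior hzs (S.coe_mem_exterior.mpr hz))).symm

omit hb hzs hh in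
-- Thus the outer boundary values of the symmetrized potential have imaginary part `-h` plus the
-- period: the prescribed value up to a constant on each circle.
theorem im_pvValue_add (j : Fin n) (ξ : ℂ) :
    (S.pvValue zs h j ξ + conj (S.pvValue zs h j ξ - S.potential zs h (S.gen j zs))).im =
      S.period zs h j := by
  rw [period_eq]
  simp

theorem analyticOnNhd_symPotential :
    AnalyticOnNhd ℂ (fun z : ℂ => S.symPotential zs h C z) S.exteriorPlane := by
  refine AnalyticOnNhd.congr S.isOpen_exteriorPlane (f := fun z : ℂ => 2 * S.potential zs h z +
    (conj (S.potential zs h (S.T 0 zs)) + C)) ?_ fun z hz => ?_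
  · exact (analyticOnNhd_const.mul (hb.analyticOnNhd_potential hzs hh.cont)).add
      analyticOnNhd_const
  · simp only [hb.symPotential_eq hzs hh.cont
      (hb.regular_of_mem_exterior hzs (S.coe_mem_exterior.mpr hz)), add_assoc]

theorem tendsto_symPotential_infty :
    Tendsto (fun z : ℂ => S.symPotential zs h C z) (cocompact ℂ)
      (𝓝 (S.symPotential zs h C ∞)) := by
  rw [hb.symPotential_eq hzs hh.cont (hb.regular_of_mem_exterior hzs S.infty_mem_exterior)]
  refine ((((hb.tendsto_potential_infty hzs hh.cont).const_mul 2).add_const _).add_const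
    (C : ℂ)).congr' ?_
  filter_upwards [S.exteriorPlane_mem_cocompact] with z hz
  exact (hb.symPotential_eq hzs hh.cont
    (hb.regular_of_mem_exterior hzs (S.coe_mem_exterior.mpr hz))).symm

/-- A function analytic in the exterior domain is determined, up to a real constant, by the
imaginary parts of its boundary values, and the multipliers of the potential vanish if it exists. -/
theorem eq_symPotential {f : ℂ → ℂ} {L : ℂ} (hf : AnalyticOnNhd ℂ f S.exteriorPlane)
    (hinf : Tendsto f (cocompact ℂ) (𝓝 L))
    (hbv : ∀ j, ∀ ξ ∈ S.circle j, ∃ w, Tendsto f (𝓝[S.exteriorPlane] ξ) (𝓝 w) ∧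
      w.im = -h j ξ) :
    (∀ j, S.period zs h j = 0) ∧
      ∃ C : ℝ, ∀ z ∈ S.exteriorPlane, f z = S.symPotential zs h C z := by
  set φ : ℂ → ℂ := fun z => S.symPotential zs h 0 z
  -- No vanishing of periods is assumed yet: the difference still has constant imaginary part on
  -- each circle, so it is a constant `K`.
  have h1 : ∀ j, ∀ ξ ∈ S.circle j, ∃ w,
      Tendsto (fun z => f z - φ z) (𝓝[S.exteriorPlane] ξ) (𝓝 w) ∧ w.im = -S.period zs h j := by
    intro j ξ hξ
    obtain ⟨w, hw, him⟩ := hbv j ξ hξ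
    refine ⟨_, hw.sub (hb.hasOuterValue_symPotential hzs hh hξ), ?_⟩
    have h2 := im_pvValue_add (S := S) (zs := zs) (h := h) j ξ
    rw [Complex.add_im] at h2
    simp [Complex.add_im, him] at h2 ⊢
    linarith
  have h2 := S.eq_of_im_const (hf.sub (hb.analyticOnNhd_symPotential hzs hh (C := 0)))
    (hinf.sub (hb.tendsto_symPotential_infty hzs hh (C := 0))) h1
  set K := L - S.symPotential zs h 0 ∞
  have h3 : ∀ j, K.im = -S.period zs h j := by
    intro j
    obtain ⟨ξ, hξ, -⟩ := S.exists_mem_circle_ne j 0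
    have hne := neBot_nhdsWithin_exteriorPlane hξ
    obtain ⟨w, hw, him⟩ := h1 j ξ hξ
    have h4 : Tendsto (fun z => f z - φ z) (𝓝[S.exteriorPlane] ξ) (𝓝 K) := by
      refine tendsto_const_nhds.congr' ?_
      filter_upwards [self_mem_nhdsWithin] with z hz using (h2 z hz).symm
    rw [tendsto_nhds_unique h4 hw, him]
  -- `σ_0` is the identity, so its period is zero; since `K` is a single number, all the other
  -- periods vanish as well.
  have h4 : K.im = 0 := by
    rw [h3 0, period_eq, potential_gen_zero, Complex.zero_im, neg_zero]
  refine ⟨fun j => by linarith [h3 j], K.re, fun z hz => ?_⟩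
  have h5 := h2 z hz
  have h6 : (K.re : ℂ) = K := Complex.ext (by simp) (by simp [h4])
  simp only [Pi.sub_apply, symPotential, Complex.ofReal_zero, add_zero] at h5
  rw [symPotential, h6, ← h5]
  ring

end

end KernelBound

end CircleSystem

end CircularRH

end

noncomputable section

namespace CircularRH

/-! ### Analytic functions on the sphere -/

/-- The coordinate of the sphere at `p`, which is `1/ζ` for `p = ∞`. -/
def chart (p : OnePoint ℂ) (w : ℂ) : OnePoint ℂ :=
  p.elim (if w = 0 then ∞ else ((w⁻¹ : ℂ) : OnePoint ℂ)) fun _ => (w : OnePoint ℂ)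

/-- The value of the coordinate at its base point. -/
def chartPoint (p : OnePoint ℂ) : ℂ := p.elim 0 id

theorem chart_infty (w : ℂ) :
    chart ∞ w = if w = 0 then ∞ else ((w⁻¹ : ℂ) : OnePoint ℂ) := rfl

theorem chart_coe (z w : ℂ) : chart (z : OnePoint ℂ) w = (w : OnePoint ℂ) := rfl

theorem chart_chartPoint (p : OnePoint ℂ) : chart p (chartPoint p) = p := by
  induction p using OnePoint.rec with
  | infty => exact if_pos rfl
  | coe z => rfl

theorem analyticAtSphere_iff {Φ : OnePoint ℂ → ℂ} {p : OnePoint ℂ} :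
    CircleSystem.AnalyticAtSphere Φ p ↔ AnalyticAt ℂ (fun w => Φ (chart p w)) (chartPoint p) := by
  induction p using OnePoint.rec with
  | infty => rfl
  | coe z => rfl

theorem analyticAt_conj_conj {f : ℂ → ℂ} {x : ℂ} (hf : AnalyticAt ℂ f (conj x)) :
    AnalyticAt ℂ (fun w => conj (f (conj w))) x := by
  rw [Complex.analyticAt_iff_eventually_differentiableAt] at hf ⊢
  filter_upwards [Complex.continuous_conj.continuousAt.eventually hf] with w hw
  have := hw.conj_conj
  rwa [Complex.conj_conj] at this

theorem tendsto_cocompact_iff {f : ℂ → ℂ} {L : ℂ} :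
    Tendsto f (cocompact ℂ) (𝓝 L) ↔ Tendsto (fun w => f w⁻¹) (𝓝[≠] 0) (𝓝 L) := by
  rw [← Metric.cobounded_eq_cocompact]
  refine ⟨fun h => h.comp tendsto_inv₀_nhdsNE_zero, fun h => ?_⟩
  refine (h.comp tendsto_inv₀_cobounded').congr fun z => ?_
  simp

theorem eventually_differentiableAt_inv {f : ℂ → ℂ}
    (hf : ∀ᶠ z in cocompact ℂ, DifferentiableAt ℂ f z) :
    ∀ᶠ w in 𝓝[≠] (0 : ℂ), DifferentiableAt ℂ (fun w => f w⁻¹) w := by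
  rw [← Metric.cobounded_eq_cocompact] at hf
  filter_upwards [tendsto_inv₀_nhdsNE_zero.eventually hf, self_mem_nhdsWithin] with w hw hw0
  exact hw.comp w (differentiableAt_inv hw0)

/-- A function which is analytic and bounded near infinity has a limit there. -/
theorem exists_tendsto_cocompact {f : ℂ → ℂ} (hf : ∀ᶠ z in cocompact ℂ, DifferentiableAt ℂ f z)
    (hb : f =O[cocompact ℂ] fun _ => (1 : ℝ)) : ∃ L, Tendsto f (cocompact ℂ) (𝓝 L) := by
  refine ⟨_, tendsto_cocompact_iff.mpr
    (Complex.tendsto_limUnder_of_differentiable_on_punctured_nhds_of_bounded_under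
      (eventually_differentiableAt_inv hf) ?_)⟩
  rw [← Metric.cobounded_eq_cocompact] at hb
  obtain ⟨K, hK⟩ := (hb.comp_tendsto tendsto_inv₀_nhdsNE_zero).bound
  refine ⟨K + ‖f (0 : ℂ)⁻¹‖, ?_⟩
  rw [eventually_map]
  filter_upwards [hK] with w hw
  simp only [Function.comp_apply, norm_one, mul_one] at hw
  exact (norm_sub_le _ _).trans (add_le_add_left hw _)

theorem analyticAtSphere_infty {Φ : OnePoint ℂ → ℂ}
    (hf : ∀ᶠ z in cocompact ℂ, DifferentiableAt ℂ (fun z : ℂ => Φ z) z)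
    (hinf : Tendsto (fun z : ℂ => Φ z) (cocompact ℂ) (𝓝 (Φ ∞))) :
    CircleSystem.AnalyticAtSphere Φ ∞ := by
  have hc : ∀ w : ℂ, w ≠ 0 → Φ (chart ∞ w) = Φ ((w⁻¹ : ℂ) : OnePoint ℂ) := fun w hw => by
    rw [chart_infty, if_neg hw]
  refine analyticAtSphere_iff.mpr
    (Complex.analyticAt_of_differentiable_on_punctured_nhds_of_continuousAt ?_ ?_)
  · filter_upwards [eventually_differentiableAt_inv hf, self_mem_nhdsWithin] with w hw hw0
    refine hw.congr_of_eventuallyEq ?_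
    filter_upwards [isOpen_ne.mem_nhds hw0] with v hv using hc v hv
  · rw [continuousAt_iff_punctured_nhds, chart_chartPoint]
    refine (tendsto_cocompact_iff.mp hinf).congr' ?_
    filter_upwards [self_mem_nhdsWithin] with w hw using (hc w hw).symm

theorem AnalyticAtSphere.tendsto_infty {Φ : OnePoint ℂ → ℂ}
    (hΦ : CircleSystem.AnalyticAtSphere Φ ∞) :
    Tendsto (fun z : ℂ => Φ z) (cocompact ℂ) (𝓝 (Φ ∞)) := by
  have h1 := (analyticAtSphere_iff.mp hΦ).continuousAt
  rw [continuousAt_iff_punctured_nhds, chart_chartPoint] at h1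
  refine tendsto_cocompact_iff.mpr (h1.congr' ?_)
  filter_upwards [self_mem_nhdsWithin] with w (hw : w ≠ 0)
  rw [chart_infty, if_neg hw]

namespace CircleSystem

variable {n : ℕ} {S : CircleSystem n}

/-- Reflection in a circle is antianalytic. -/
theorem exists_chart_T (j : Fin n) (p : OnePoint ℂ) :
    ∃ g : ℂ → ℂ, AnalyticAt ℂ g (chartPoint (S.T j p)) ∧
      conj (g (chartPoint (S.T j p))) = chartPoint p ∧
      ∀ᶠ w in 𝓝 (chartPoint (S.T j p)), S.T j (chart (S.T j p) w) = chart p (conj (g w)) := by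
  have hr : (S.radius j : ℂ) ^ 2 ≠ 0 :=
    pow_ne_zero 2 (Complex.ofReal_ne_zero.mpr (S.radius_pos j).ne')
  set c := S.center j
  set R := (S.radius j : ℂ) ^ 2 with hR
  have hRc : conj R = R := by rw [hR, map_pow, Complex.conj_ofReal]
  induction p using OnePoint.rec with
  | infty =>
    rw [T_infty]
    have h0 : conj c * (c - c) + R ≠ 0 := by simpa using hr
    have hcont : ContinuousAt (fun w => conj c * (w - c) + R) c := by fun_prop
    -- Here `g` is the conjugate of `1/T_j`, with `T_j w = c + R / conj (w - c)` and `R = r_j²`; in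
    -- this form it is visibly holomorphic at the centre.
    refine ⟨fun w => (w - c) / (conj c * (w - c) + R), ?_, ?_, ?_⟩
    · exact AnalyticAt.div (by fun_prop) (by fun_prop) h0
    · change conj ((c - c) / (conj c * (c - c) + R)) = 0
      simp
    · filter_upwards [hcont.eventually_ne h0] with w hw
      rw [chart_coe, chart_infty]
      by_cases hwc : w = c
      · rw [hwc, T_center]; simp
      · have h1 : w - c ≠ 0 := sub_ne_zero.mpr hwc
        have h2 : conj (w - c) ≠ 0 := (map_ne_zero _).mpr h1
        have h3 : c * conj (w - c) + R ≠ 0 := by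
          have := (map_ne_zero (starRingEnd ℂ)).mpr hw
          rwa [map_add, map_mul, Complex.conj_conj, hRc] at this
        rw [S.T_coe_of_ne j hwc, if_neg ((map_ne_zero _).mpr (div_ne_zero h1 hw))]
        congr 1
        rw [map_div₀, map_add, map_mul, Complex.conj_conj, hRc, inv_div, eq_div_iff h2, add_mul,
          div_mul_cancel₀ _ h2]
  | coe z =>
    by_cases hz : z = c
    · rw [hz, T_center]
      have h0 : (1 - c * 0 : ℂ) ≠ 0 := by simp
      have hcont : ContinuousAt (fun w : ℂ => 1 - c * w) 0 := by fun_prop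
      refine ⟨fun w => conj c + R * w / (1 - c * w), ?_, ?_, ?_⟩
      · exact analyticAt_const.add (AnalyticAt.div (by fun_prop) (by fun_prop) h0)
      · change conj (conj c + R * 0 / (1 - c * 0)) = c
        simp
      · filter_upwards [hcont.eventually_ne h0] with w hw
        rw [chart_coe, chart_infty]
        by_cases hw0 : w = 0
        · rw [if_pos hw0, T_infty, hw0]; simp [c]
        · have h1 : w⁻¹ - c = (1 - c * w) / w := by field_simp
          have h2 : w⁻¹ ≠ c := by
            rw [← sub_ne_zero, h1]; exact div_ne_zero hw hw0
          rw [if_neg hw0, S.T_coe_of_ne j h2, h1]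
          congr 1
          simp only [map_add, map_div₀, map_mul, Complex.conj_conj, hRc]
          rw [div_div_eq_mul_div]
    · have hzc : z - c ≠ 0 := sub_ne_zero.mpr hz
      rw [S.T_coe_of_ne j hz]
      set z' := c + R / conj (z - c) with hz'
      have h0 : z' - c ≠ 0 := by
        rw [hz', add_sub_cancel_left]
        exact div_ne_zero hr ((map_ne_zero _).mpr hzc)
      have hcont : ContinuousAt (fun w : ℂ => w - c) z' := by fun_prop
      refine ⟨fun w => conj c + R / (w - c), ?_, ?_, ?_⟩
      · exact analyticAt_const.add (AnalyticAt.div (by fun_prop) (by fun_prop) h0)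
      · change conj (conj c + R / (z' - c)) = z
        rw [hz', add_sub_cancel_left, div_div_cancel₀ hr]
        simp
      · filter_upwards [hcont.eventually_ne h0] with w hw
        rw [chart_coe, chart_coe, S.T_coe_of_ne j (sub_ne_zero.mp hw)]
        congr 1
        simp only [map_add, map_div₀, Complex.conj_conj, hRc]
        rfl

theorem AnalyticAtSphere.conj_T {Φ : OnePoint ℂ → ℂ} (j : Fin n) {p : OnePoint ℂ}
    (hΦ : AnalyticAtSphere Φ p) :
    AnalyticAtSphere (fun q => conj (Φ (S.T j q))) (S.T j p) := by
  obtain ⟨g, hg, hgp, hT⟩ := S.exists_chart_T j p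
  rw [analyticAtSphere_iff] at hΦ ⊢
  rw [← hgp] at hΦ
  refine ((analyticAt_conj_conj hΦ).comp hg).congr ?_
  filter_upwards [hT] with w hw
  rw [hw]
  rfl

variable [NeZero n]

/-- `Φ = conj ∘ Φ ∘ T_j` carries analyticity at `p` to analyticity at `T_j p`, and every group
element is a word in the reflections. Symmetry is asked on the whole sphere so that no
neighbourhoods need to be restricted. -/
theorem analyticAtSphere_of_symmetric {Φ : OnePoint ℂ → ℂ}
    (hsym : ∀ j p, conj (Φ (S.T j p)) = Φ p)
    (hext : ∀ p ∈ S.exterior, AnalyticAtSphere Φ p) {p : OnePoint ℂ} (hp : p ∈ S.offCircles) :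
    AnalyticAtSphere Φ p := by
  have hT : ∀ j p, AnalyticAtSphere Φ p → AnalyticAtSphere Φ (S.T j p) := by
    intro j p h
    have h1 := h.conj_T (S := S) j
    rwa [funext (hsym j)] at h1
  obtain ⟨σ, hσ, q, hq, rfl⟩ := hp
  have hqa : AnalyticAtSphere Φ q := by
    rcases hq with hq | hq
    · exact hext q hq
    · have h1 := hT 0 _ (hext _ hq)
      rwa [T_T] at h1
  obtain ⟨w, -, rfl⟩ := S.mem_group_iff.mp hσ
  clear hσ hq
  induction w with
  | nil => simpa [wordProd] using hqa
  | cons j w ih => simpa [wordProd] using hT j _ ih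

open Classical in
/-- Extension by zero of a symmetric function from the region of discontinuity. -/
theorem conj_indicator_T {Φ : OnePoint ℂ → ℂ} (hsym : S.Symmetric Φ) (j : Fin n) (p : OnePoint ℂ) :
    conj (S.offCircles.indicator Φ (S.T j p)) = S.offCircles.indicator Φ p := by
  by_cases hp : p ∈ S.offCircles
  · rw [Set.indicator_of_mem hp, Set.indicator_of_mem (S.T_mem_offCircles j hp), hsym j p hp]
  · have hp' : S.T j p ∉ S.offCircles := fun h => hp (by
      have h1 := S.T_mem_offCircles j h
      rwa [T_T] at h1)
    rw [Set.indicator_of_notMem hp, Set.indicator_of_notMem hp', map_zero]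

/-- A symmetric function which is analytic in the exterior domain is analytic in the region of
discontinuity. -/
theorem analyticAtSphere_indicator {Φ : OnePoint ℂ → ℂ} (hsym : S.Symmetric Φ)
    (hf : AnalyticOnNhd ℂ (fun z : ℂ => Φ z) S.exteriorPlane)
    (hinf : Tendsto (fun z : ℂ => Φ z) (cocompact ℂ) (𝓝 (Φ ∞))) {p : OnePoint ℂ}
    (hp : p ∈ S.offCircles) : AnalyticAtSphere (S.offCircles.indicator Φ) p := by
  have heq : ∀ z ∈ S.exteriorPlane, S.offCircles.indicator Φ (z : OnePoint ℂ) = Φ z := fun z hz =>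
    Set.indicator_of_mem (S.mem_offCircles_of_mem_exterior (S.coe_mem_exterior.mpr hz)) _
  have hf' : AnalyticOnNhd ℂ (fun z : ℂ => S.offCircles.indicator Φ z) S.exteriorPlane :=
    hf.congr S.isOpen_exteriorPlane fun z hz => (heq z hz).symm
  refine analyticAtSphere_of_symmetric (conj_indicator_T hsym) (fun q hq => ?_) hp
  rcases hq with rfl | ⟨z, hz, rfl⟩
  · refine analyticAtSphere_infty ?_ ?_
    · filter_upwards [S.exteriorPlane_mem_cocompact] with z hz using (hf' z hz).differentiableAt
    · rw [Set.indicator_of_mem S.infty_mem_offCircles]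
      refine hinf.congr' ?_
      filter_upwards [S.exteriorPlane_mem_cocompact] with z hz using (heq z hz).symm
  · exact hf' z hz

/-- Openness of the region, obtained from the preceding lemma with `Φ = 1`: the indicator function
is analytic, hence continuous, at each point of the region and so remains nonzero nearby. -/
theorem eventually_chart_mem_offCircles {p : OnePoint ℂ} (hp : p ∈ S.offCircles) :
    ∀ᶠ w in 𝓝 (chartPoint p), chart p w ∈ S.offCircles := by
  have h1 := (analyticAtSphere_iff.mp (S.analyticAtSphere_indicator (Φ := fun _ => 1)
    (fun j p _ => map_one _) analyticOnNhd_const tendsto_const_nhds hp)).continuousAt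
  have h2 := h1.eventually_ne (y := 0) (by
    rw [chart_chartPoint, Set.indicator_of_mem hp]; exact one_ne_zero)
  filter_upwards [h2] with w hw
  exact Set.mem_of_indicator_ne_zero hw

theorem AnalyticAtSphere.congr_offCircles {Φ Φ' : OnePoint ℂ → ℂ} {p : OnePoint ℂ}
    (hΦ : AnalyticAtSphere Φ p) (hp : p ∈ S.offCircles) (heq : ∀ q ∈ S.offCircles, Φ' q = Φ q) :
    AnalyticAtSphere Φ' p := by
  rw [analyticAtSphere_iff] at hΦ ⊢
  refine hΦ.congr ?_
  filter_upwards [eventually_chart_mem_offCircles hp] with w hw using (heq _ hw).symm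

end CircleSystem

end CircularRH

end

noncomputable section

namespace CircularRH

namespace CircleSystem

/-! ### The Riemann–Hilbert problem -/

variable {n : ℕ} [NeZero n] {S : CircleSystem n} {h : Fin n → ℂ → ℝ}

/-- Near `ξ` the reflection `T_j` sends inner points to points of the exterior, because the other
discs stay at a positive distance. The inner limit of a function known only on the region is
therefore meaningful. -/
theorem eventually_mem_offCircles {j : Fin n} {ξ : ℂ} (hξ : ξ ∈ S.circle j) :
    ∀ᶠ z : ℂ in 𝓝[Metric.ball (S.center j) (S.radius j)] ξ, (z : OnePoint ℂ) ∈ S.offCircles := by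
  have hr := S.radius_pos j
  have hξ0 : conj (ξ - S.center j) ≠ 0 :=
    (map_ne_zero _).mpr (sub_ne_zero.mpr (S.ne_center_of_mem_circle hξ))
  set t : ℂ → ℂ := fun z => S.center j + (S.radius j : ℂ) ^ 2 / conj (z - S.center j) with ht
  have h1 : ContinuousAt t ξ := by
    refine continuousAt_const.add (continuousAt_const.div ?_ hξ0)
    exact (Complex.continuous_conj.comp (continuous_id.sub continuous_const)).continuousAt
  have h2 : t ξ = ξ := by
    rw [ht]
    simp only
    rw [← S.conj_sub_of_mem_circle hξ, mul_div_cancel_right₀ _ hξ0, add_sub_cancel]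
  have h3 : ∀ i, ∀ᶠ z in 𝓝[Metric.ball (S.center j) (S.radius j)] ξ,
      z ≠ S.center j → S.radius i < dist (t z) (S.center i) := by
    intro i
    by_cases hij : j = i
    · subst hij
      filter_upwards [self_mem_nhdsWithin] with z hz hzc
      have h4 : 0 < ‖z - S.center j‖ := norm_pos_iff.mpr (sub_ne_zero.mpr hzc)
      rw [Metric.mem_ball, dist_eq_norm] at hz
      rw [dist_eq_norm, add_sub_cancel_left, norm_div, norm_pow, Complex.norm_conj,
        Complex.norm_real, Real.norm_of_nonneg hr.le, lt_div_iff₀ h4, sq]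
      exact mul_lt_mul_of_pos_left hz hr
    · have h5 : Tendsto (fun z => dist (t z) (S.center i)) (𝓝 ξ) (𝓝 (dist ξ (S.center i))) := by
        have := h1.tendsto
        rw [h2] at this
        exact this.dist tendsto_const_nhds
      filter_upwards [nhdsWithin_le_nhds
        (h5.eventually_const_lt (S.dist_of_mem_circle_ne hij hξ))] with z hz _ using hz
  filter_upwards [eventually_all.mpr h3, nhdsWithin_le_nhds
    (isOpen_ne.mem_nhds (S.ne_center_of_mem_circle hξ))] with z hz hzc
  have h6 : S.T j z ∈ S.offCircles := by
    rw [S.T_coe_of_ne j hzc]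
    exact S.mem_offCircles_of_mem_exterior (S.coe_mem_exterior.mpr fun i => hz i hzc)
  have h7 := S.T_mem_offCircles j h6
  rwa [T_T] at h7

namespace KernelBound

variable {zs : OnePoint ℂ} {δ : ℝ} {b : S.group → ℝ} {P : S.group → ℂ} {g : Fin n → ℂ → ℝ}
  {d : Fin n → ℝ} {Φ : OnePoint ℂ → ℂ} (hb : S.KernelBound δ b P) (hzs : zs ∈ S.exterior)
  (hh : S.LipDensity fun l η => g l η - d l)
include hb hzs hh

theorem eq_symPotential_of_solvesRH (hΦ : S.SolvesRH g d Φ) :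
    (∀ j, S.period zs (fun l η => g l η - d l) j = 0) ∧
      ∃ C : ℝ, ∀ p ∈ S.offCircles, Φ p = S.symPotential zs (fun l η => g l η - d l) C p := by
  have hinf := AnalyticAtSphere.tendsto_infty (hΦ.analytic ∞ S.infty_mem_offCircles)
  have hmem : ∀ z ∈ S.exteriorPlane, (z : OnePoint ℂ) ∈ S.offCircles := fun z hz =>
    S.mem_offCircles_of_mem_exterior (S.coe_mem_exterior.mpr hz)
  obtain ⟨hper, C, hC⟩ := hb.eq_symPotential hzs hh
    (fun z hz => hΦ.analytic z (hmem z hz)) hinf fun j ξ hξ => by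
      obtain ⟨vp, vm, hvp, hvm, hjump⟩ := hΦ.jump j ξ hξ
      refine ⟨vm, hvm, ?_⟩
      have hne := neBot_nhdsWithin_exteriorPlane hξ
      obtain ⟨t, ht, htz⟩ := exists_tendsto_T hξ
      -- `T_j` exchanges the sides of the circle, so symmetry conjugates the boundary values. The
      -- jump then equals `-2i Im Φ⁻`, which prescribes `Im Φ⁻ = d_j - g_j`.
      have h1 : vp = conj vm := by
        refine tendsto_nhds_unique ((Tendsto.comp hvp ht).congr' ?_)
          ((Complex.continuous_conj.tendsto _).comp hvm)
        filter_upwards [self_mem_nhdsWithin] with z hz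
        have h2 := hΦ.symmetric j z (hmem z hz)
        simp only [Function.comp_apply]
        rw [← htz z hz, ← h2, Complex.conj_conj]
      rw [h1] at hjump
      have h2 := congrArg Complex.im hjump
      simp at h2
      linarith
  refine ⟨hper, C, ?_⟩
  have hext : ∀ p ∈ S.exterior, Φ p = S.symPotential zs (fun l η => g l η - d l) C p := by
    rintro p (rfl | ⟨z, hz, rfl⟩)
    · refine tendsto_nhds_unique (hinf.congr' ?_) (hb.tendsto_symPotential_infty hzs hh)
      filter_upwards [S.exteriorPlane_mem_cocompact] with z hz using hC z hz
    · exact hC z hz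
  -- Equality in the exterior passes to `T_0` of it by symmetry, and to the remaining components by
  -- automorphy of both functions.
  rintro p ⟨σ, hσ, q, hq, rfl⟩
  have hqm : q ∈ S.offCircles := ⟨1, one_mem _, q, hq, rfl⟩
  rw [hΦ.automorphic σ hσ q hqm, (hb.automorphic_symPotential_iff hzs hh).mpr hper σ hσ q hqm]
  rcases hq with hq | hq
  · exact hext q hq
  · rw [← hΦ.symmetric 0 q hqm, hext _ hq, conj_symPotential_T_zero]

theorem solvesRH_of_eq_symPotential
    (hper : ∀ j, S.period zs (fun l η => g l η - d l) j = 0) {C : ℝ}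
    (hΦ : ∀ p ∈ S.offCircles, Φ p = S.symPotential zs (fun l η => g l η - d l) C p) :
    S.SolvesRH g d Φ where
  analytic p hp := by
    refine (S.analyticAtSphere_indicator (hb.symmetric_symPotential hzs hh hper (C := C))
      (hb.analyticOnNhd_symPotential hzs hh) (hb.tendsto_symPotential_infty hzs hh)
      hp).congr_offCircles hp fun q hq => ?_
    rw [hΦ q hq, Set.indicator_of_mem hq]
  automorphic σ hσ p hp := by
    rw [hΦ _ (S.smul_mem_offCircles hσ hp), hΦ p hp,
      (hb.automorphic_symPotential_iff hzs hh).mpr hper σ hσ p hp]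
  symmetric j p hp := by
    rw [hΦ _ (S.T_mem_offCircles j hp), hΦ p hp, hb.symmetric_symPotential hzs hh hper j p hp]
  jump j ξ hξ := by
    refine ⟨_, _, (hb.hasInnerValue_symPotential hzs hh (C := C) hξ).congr' ?_,
      (hb.hasOuterValue_symPotential hzs hh (C := C) hξ).congr' ?_, ?_⟩
    · filter_upwards [eventually_mem_offCircles hξ] with z hz using (hΦ _ hz).symm
    · filter_upwards [self_mem_nhdsWithin] with z hz
      exact (hΦ _ (S.mem_offCircles_of_mem_exterior (S.coe_mem_exterior.mpr hz))).symm
    · push_cast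
      ring

end KernelBound

end CircleSystem

/-! ### The second problem: admissible constants, jump problem and Schwarz problem -/

namespace ElasticData

open CircleSystem

variable {n : ℕ} [NeZero n] {E : ElasticData n} {S : CircleSystem n} {a : Fin n → ℝ} {C₁ : ℝ}
  {zs : OnePoint ℂ} {δ : ℝ} {b : S.group → ℝ} {P : S.group → ℂ}
  (hb : S.KernelBound δ b P) (hzs : zs ∈ S.exterior)
include hb hzs

theorem secondConstants_iff (d : Fin n → ℝ) :
    E.SecondConstants S zs a C₁ d ↔ ∀ j, S.period zs (E.density₂ S zs a C₁ d) j = 0 := by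
  have h1 : ∀ j, S.period zs (E.density₂ S zs a C₁ d) j =
      S.period zs (E.g₂ S zs a C₁) j - (d j - d 0) := fun j =>
    hb.period_sub_const hzs (lipDensity_g₂ hb hzs).cont d j
  constructor
  · intro h j
    rw [h1]
    -- The condition on the constants omits `j = 0`, where the period vanishes because `σ_0` is the
    -- identity.
    by_cases hj : j = 0
    · rw [hj, period_eq, potential_gen_zero]; simp
    · rw [h j hj]; ring
  · intro h j _
    have := h j
    rw [h1] at this
    linarith

theorem automorphic_Phi₂_iff (d : Fin n → ℝ) (C₂ : ℝ) :
    S.Automorphic (E.Phi₂ S zs a C₁ d C₂) ↔ E.SecondConstants S zs a C₁ d := by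
  rw [secondConstants_iff hb hzs]
  -- `Phi₂` is by definition the symmetrized potential of `density₂`.
  exact hb.automorphic_symPotential_iff hzs (lipDensity_density₂ hb hzs d)

theorem existsUnique_automorphic (d₀ C₂ : ℝ) :
    ∃! d : Fin n → ℝ, d 0 = d₀ ∧ S.Automorphic (E.Phi₂ S zs a C₁ d C₂) := by
  simp only [automorphic_Phi₂_iff hb hzs]
  refine ⟨fun j => if j = 0 then d₀ else d₀ + S.period zs (E.g₂ S zs a C₁) j,
    ⟨if_pos rfl, fun j hj => by simp [hj]⟩, fun d hd => ?_⟩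
  ext j
  by_cases hj : j = 0
  · rw [hj, if_pos rfl, hd.1]
  · rw [if_neg hj, hd.2 j hj, hd.1]

theorem solvesRH_iff (d : Fin n → ℝ) (Φ : OnePoint ℂ → ℂ) :
    S.SolvesRH (E.g₂ S zs a C₁) d Φ ↔ E.SecondConstants S zs a C₁ d ∧
      ∃ C₂ : ℝ, ∀ p ∈ S.offCircles, Φ p = E.Phi₂ S zs a C₁ d C₂ p := by
  have hh := lipDensity_density₂ (E := E) (a := a) (C₁ := C₁) hb hzs d
  rw [secondConstants_iff hb hzs]
  exact ⟨fun h => hb.eq_symPotential_of_solvesRH hzs hh h,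
    fun ⟨hper, C, hC⟩ => hb.solvesRH_of_eq_symPotential hzs hh hper hC⟩

omit hb hzs in
/-- The boundary condition of the Schwarz problem in terms of the imaginary part of the boundary
values of `(i conj τ / μ) (ω - c_{-1} ζ)`. -/
theorem boundary_iff {d' : Fin n → ℝ} (j : Fin n) (ξ w : ℂ) :
    (conj E.tau / E.mu * w).re = E.lam j * ((E.F S zs a C₁ j ξ).re - d' j) ↔
      (Complex.I * conj E.tau / E.mu * (w - E.cm1 * ξ)).im =
        -E.density₂ S zs a C₁ (fun j => E.kappa j / (E.kappa j - 1) * d' j) j ξ := by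
  have h1 : E.lam j = -(E.kappa j / (E.kappa j - 1)) := by
    rw [lam, ← neg_sub (E.kappa j) 1, div_neg]
  have h2 : Complex.I * conj E.tau / E.mu * (w - E.cm1 * ξ) =
      Complex.I * (conj E.tau / E.mu * w - conj E.tau / E.mu * E.cm1 * ξ) := by ring
  rw [h2, Complex.I_mul_im, Complex.sub_re, density₂, g₂, Complex.add_re, Complex.re_ofReal_mul, h1]
  constructor <;> intro h <;> linarith

theorem solvesSchwarz_iff (d' : Fin n → ℝ) (ω : ℂ → ℂ) :
    E.SolvesSchwarz S zs a C₁ d' ω ↔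
      E.SecondConstants S zs a C₁ (fun j => E.kappa j / (E.kappa j - 1) * d' j) ∧
        ∃ C₂ : ℝ, ∀ ζ ∈ S.exteriorPlane,
          Complex.I * conj E.tau / E.mu * (ω ζ - E.cm1 * ζ) =
            E.Phi₂ S zs a C₁ (fun j => E.kappa j / (E.kappa j - 1) * d' j) C₂
              (ζ : OnePoint ℂ) := by
  set d : Fin n → ℝ := fun j => E.kappa j / (E.kappa j - 1) * d' j
  have hh := lipDensity_density₂ (E := E) (a := a) (C₁ := C₁) hb hzs d
  set m : ℂ := Complex.I * conj E.tau / E.mu with hm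
  have hm0 : m ≠ 0 := div_ne_zero (mul_ne_zero Complex.I_ne_zero ((map_ne_zero _).mpr E.tau_ne))
    (Complex.ofReal_ne_zero.mpr E.mu_pos.ne')
  have hlin : ∀ ξ : ℂ, Tendsto (fun ζ : ℂ => E.cm1 * ζ) (𝓝[S.exteriorPlane] ξ)
      (𝓝 (E.cm1 * ξ)) := fun ξ =>
    ((continuous_const.mul continuous_id).tendsto ξ).mono_left nhdsWithin_le_nhds
  rw [secondConstants_iff hb hzs]
  constructor
  · intro h
    have hf : AnalyticOnNhd ℂ (fun ζ => m * (ω ζ - E.cm1 * ζ)) S.exteriorPlane :=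
      analyticOnNhd_const.mul (h.analytic.sub (analyticOnNhd_const.mul analyticOnNhd_id))
    -- Boundedness of `ω - c_{-1} ζ` makes infinity a removable singularity, providing the limit
    -- required by the uniqueness theorem.
    obtain ⟨L, hL⟩ := exists_tendsto_cocompact (f := fun ζ => m * (ω ζ - E.cm1 * ζ))
      (by filter_upwards [S.exteriorPlane_mem_cocompact] with z hz using (hf z hz).differentiableAt)
      (h.at_infty.const_mul_left m)
    refine hb.eq_symPotential hzs hh hf hL fun j ξ hξ => ?_
    obtain ⟨w, hw, hre⟩ := h.boundary j ξ hξ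
    exact ⟨_, (hw.sub (hlin ξ)).const_mul m, (boundary_iff j ξ w).mp hre⟩
  · rintro ⟨hper, C, hC⟩
    -- Since `τ ≠ 0`, the relation can be solved for `ω`, whose properties are then read off from
    -- those of the symmetrized potential.
    have hω : ∀ ζ ∈ S.exteriorPlane, ω ζ =
        m⁻¹ * S.symPotential zs (E.density₂ S zs a C₁ d) C ζ + E.cm1 * ζ := by
      intro ζ hζ
      have h1 : S.symPotential zs (E.density₂ S zs a C₁ d) C ζ = m * (ω ζ - E.cm1 * ζ) :=
        (hC ζ hζ).symm
      rw [h1, inv_mul_cancel_left₀ hm0, sub_add_cancel]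
    refine ⟨?_, ?_, fun j ξ hξ => ?_⟩
    · refine AnalyticOnNhd.congr S.isOpen_exteriorPlane
        ((analyticOnNhd_const.mul (hb.analyticOnNhd_symPotential hzs hh)).add
          (analyticOnNhd_const.mul analyticOnNhd_id)) fun ζ hζ => (hω ζ hζ).symm
    · have h1 := ((hb.tendsto_symPotential_infty hzs hh (C := C)).const_mul m⁻¹).isBigO_one ℝ
      refine h1.congr' ?_ EventuallyEq.rfl
      filter_upwards [S.exteriorPlane_mem_cocompact] with ζ hζ
      rw [hω ζ hζ, add_sub_cancel_right]
    · set v := -(Complex.I * (E.density₂ S zs a C₁ d j ξ : ℂ)) +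
        S.pvValue zs (E.density₂ S zs a C₁ d) j ξ +
        conj (S.pvValue zs (E.density₂ S zs a C₁ d) j ξ -
          S.potential zs (E.density₂ S zs a C₁ d) (S.gen j zs)) + C with hv
      refine ⟨m⁻¹ * v + E.cm1 * ξ, ?_, ?_⟩
      · refine (((hb.hasOuterValue_symPotential hzs hh hξ (C := C)).const_mul m⁻¹).add
          (hlin ξ)).congr' ?_
        filter_upwards [self_mem_nhdsWithin] with ζ hζ using (hω ζ hζ).symm
      · refine (boundary_iff j ξ _).mpr ?_
        rw [add_sub_cancel_right, ← hm, mul_inv_cancel_left₀ hm0, hv]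
        have h2 := KernelBound.im_pvValue_add (S := S) (zs := zs) (h := E.density₂ S zs a C₁ d) j ξ
        rw [hper j] at h2
        rw [add_assoc (-_), Complex.add_im, Complex.add_im, h2]
        simp [d]

end ElasticData

end CircularRH

end

/-! ### The main theorem -/

theorem mainTheorem3 {n : ℕ} [NeZero n]
    (S : CircularRH.CircleSystem n) (hS : S.FirstClass)
    (E : CircularRH.ElasticData n)
    (zs : OnePoint ℂ) (hzs : zs ∈ S.exterior)
    (a : Fin n → ℝ) (ha : E.FirstConstants S zs a) (C₁ : ℝ) :
    -- the kernel series converges absolutely, and the kernel is continuous off its poles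
    (∀ ζ ∈ S.Omega, ∀ η ∈ S.contour, Summable (fun σ => ‖S.kernelTerm zs ζ η σ‖)) ∧
    (∀ ζ ∈ S.Omega, ContinuousOn (S.kernel zs ζ)
      {η | η ∈ S.contour ∧ ∀ σ ∈ S.group, σ ζ ≠ (η : OnePoint ℂ)}) ∧
    -- the data are well defined and continuous
    (∀ j, ∀ ξ ∈ S.circle j,
      S.HasPV zs (E.density₁ a) (ξ : OnePoint ℂ) ξ
        (S.pv zs (E.density₁ a) (ξ : OnePoint ℂ) ξ) ∧
      S.HasPV zs (E.density₁ a) (S.T 0 (ξ : OnePoint ℂ)) ξ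
        (S.pv zs (E.density₁ a) (S.T 0 (ξ : OnePoint ℂ)) ξ)) ∧
    (∀ j, ContinuousOn (E.g₂ S zs a C₁ j) (S.circle j)) ∧
    -- boundary values, with Cauchy principal values
    (∀ (d : Fin n → ℝ) (C₂ : ℝ), ∀ j, ∀ ξ ∈ S.circle j, ∃ p q : ℂ,
      S.HasPV zs (E.density₂ S zs a C₁ d) (ξ : OnePoint ℂ) ξ p ∧
      S.HasPV zs (E.density₂ S zs a C₁ d) (S.T 0 (ξ : OnePoint ℂ)) ξ q ∧
      S.HasInnerValue (E.Phi₂ S zs a C₁ d C₂) j ξ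
        (Complex.I * (E.g₂ S zs a C₁ j ξ - d j : ℝ) + p + conj q + C₂) ∧
      S.HasOuterValue (E.Phi₂ S zs a C₁ d C₂) ξ
        (-(Complex.I * (E.g₂ S zs a C₁ j ξ - d j : ℝ)) + p + conj q + C₂)) ∧
    -- the function is automorphic exactly for the stated constants, `d̃_0` being free
    (∀ (d : Fin n → ℝ) (C₂ : ℝ),
      S.Automorphic (E.Phi₂ S zs a C₁ d C₂) ↔ E.SecondConstants S zs a C₁ d) ∧
    (∀ (d₀ C₂ : ℝ), ∃! d : Fin n → ℝ, d 0 = d₀ ∧ S.Automorphic (E.Phi₂ S zs a C₁ d C₂)) ∧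
    -- general solution of the second jump problem
    (∀ (d : Fin n → ℝ) (Φ : OnePoint ℂ → ℂ),
      S.SolvesRH (E.g₂ S zs a C₁) d Φ ↔
        E.SecondConstants S zs a C₁ d ∧
          ∃ C₂ : ℝ, ∀ p ∈ S.offCircles, Φ p = E.Phi₂ S zs a C₁ d C₂ p) ∧
    -- the solutions of the Schwarz problem for `ω`, through `Φ₂ = (i conj τ / μ)(ω - c_{-1} ζ)`
    (∀ (d' : Fin n → ℝ) (ω : ℂ → ℂ),
      E.SolvesSchwarz S zs a C₁ d' ω ↔
        E.SecondConstants S zs a C₁ (fun j => E.kappa j / (E.kappa j - 1) * d' j) ∧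
          ∃ C₂ : ℝ, ∀ ζ ∈ S.exteriorPlane,
            Complex.I * conj E.tau / E.mu * (ω ζ - E.cm1 * ζ) =
              E.Phi₂ S zs a C₁ (fun j => E.kappa j / (E.kappa j - 1) * d' j) C₂
                (ζ : OnePoint ℂ)) := by
  obtain ⟨δ, b, P, hb⟩ := CircularRH.CircleSystem.exists_kernelBound S hS
  refine ⟨fun ζ hζ η hη => (hb.summable_of_mem_Omega hzs hζ hη).norm,
    fun ζ hζ => hb.continuousOn_kernel_of_mem_Omega hzs hζ, fun j ξ hξ => ⟨?_, ?_⟩,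
    CircularRH.ElasticData.continuousOn_g₂ hb hzs, fun d C₂ j ξ hξ => ?_,
    CircularRH.ElasticData.automorphic_Phi₂_iff hb hzs,
    CircularRH.ElasticData.existsUnique_automorphic hb hzs,
    CircularRH.ElasticData.solvesRH_iff hb hzs,
    CircularRH.ElasticData.solvesSchwarz_iff hb hzs⟩
  · rw [CircularRH.ElasticData.pv_density₁ hb hzs hξ]
    exact hb.hasPV_coe hzs CircularRH.ElasticData.lipDensity_density₁ hξ
  · rw [CircularRH.ElasticData.pv_density₁_T hb hzs hξ]
    exact hb.hasPV_T hzs CircularRH.ElasticData.lipDensity_density₁.cont hξ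
      (hb.hasPV_coe hzs CircularRH.ElasticData.lipDensity_density₁ hξ)
  · have hh := CircularRH.ElasticData.lipDensity_density₂ (E := E) (a := a) (C₁ := C₁) hb hzs d
    exact ⟨_, _, hb.hasPV_coe hzs hh hξ, hb.hasPV_T hzs hh.cont hξ (hb.hasPV_coe hzs hh hξ),
      hb.hasInnerValue_symPotential hzs hh hξ, hb.hasOuterValue_symPotential hzs hh hξ⟩
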